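/- Notation. For $|q|<1$ let $(x;q)_n=\prod_{k=0}^{n-1}(1-xq^k)$, $(x;q)_\infty=\prod_{k\ge 0}(1-xq^k)$, $j(x;q)=(x;q)_\infty(q/x;q)_\infty(q;q)_\infty$, $J_{a,m}=j(q^a;q^m)$, $\overline J_{a,m}=j(-q^a;q^m)$, $J_m=(q^m;q^m)_\infty$. Let $\mathrm{sg}(r)=1$ for $r\ge 0$ and $\mathrm{sg}(r)=-1$ for $r<0$, and put $$m(x,q,z)=\frac{1}{j(z;q)}\sum_{r\in\mathbb Z}\frac{(-1)^rq^{\binom r2}z^r}{1-q^{r-1}xz},\qquad f_{a,b,c}(x,y,q)=\sum_{\mathrm{sg}(r)=\mathrm{sg}(s)}\mathrm{sg}(r)(-1)^{r+s}x^ry^sq^{a\binom r2+brs+c\binom s2},$$ and let $\overline f_{a,b,c}(x,y,q)$ be the same sum as $f_{a,b,c}$ without the factor $\mathrm{sg}(r)$. For coprime positive integers $n,p$ let $$\Phi_{n,p}(x,y,q)=\frac{J_{p^2(2n+p)}^3}{\overline J_{0,np(2n+p)}}\sum_{r^*=0}^{p-1}\sum_{s^*=0}^{p-1}q^{n\binom{A}{2}+(n+p)AB+n\binom{B}{2}}(-x)^{A}(-y)^{B}\,\frac{j(-q^{np(s-r)}x^n/y^n;q^{np^2})\,j(q^{p(2n+p)(r+s)+p(n+p)}x^py^p;q^{p^2(2n+p)})}{j\big(q^{p(2n+p)r+p(n+p)/2}\tfrac{(-y)^{n+p}}{(-x)^n};q^{p^2(2n+p)}\big)\,j\big(q^{p(2n+p)s+p(n+p)/2}\tfrac{(-x)^{n+p}}{(-y)^n};q^{p^2(2n+p)}\big)},$$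 where $r=r^*+\{(n-1)/2\}$, $s=s^*+\{(n-1)/2\}$ ($\{\cdot\}$ denotes the fractional part), $A=r-(n-1)/2$, $B=s+(n+1)/2$. Theorem. Let $q\in\mathbb C$ with $|q|<1$. All series below converge, and the following identities hold (those involving $f$, $\overline f$, $m$, $\Phi$ for $q\neq 0$; $q^{1/2}$ denotes either square root of $q$, and $q^{k/2}=(q^{1/2})^k$). (0) $\displaystyle F_1^{(5)}(q):=\sum_{n\ge0}\frac{q^{2n(n+1)}}{(q;q^2)_{n+1}}=\frac{1}{(q^2;q^2)_\infty}\sum_{n\ge0}\sum_{j=0}^{2n}(-1)^nq^{5n^2+4n-\binom{j+1}2}(1+q^{2n+1}).$ (1) $$\sum_{n\ge0}(-1)^n\frac{(q^2;q^2)_n}{(q;q^2)_{n+1}}q^{n(n+1)}=\sum_{n\ge0}\sum_{j=-n}^n(1+q^{2n+1})q^{4n^2+3n-2j^2-j}=\overline f_{1,3,1}(-q^4,-q^6,q^4)+q^7\overline f_{1,3,1}(-q^{12},-q^{14},q^4).$$ (2) $$\sum_{n\ge0}\frac{q^{n(n+1)}(-q^2;q^2)_n}{(q;q^2)_{n+1}}=\frac{(-q^2;q^2)_\infty}{(q^2;q^2)_\infty}\sum_{n\ge0}(1+q^{2n+1})(-1)^nq^{4n^2+3n}\sum_{j=-n}^nq^{-2j^2-j}$$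 $$=\frac{J_4}{J_2^2}\left(f_{1,3,1}(q^4,q^6,q^4)-q^7f_{1,3,1}(q^{12},q^{14},q^4)\right)=-q^{-1}m(q,q^8,q^{-1/2})+q^{-1}\frac{J_{3/2,8}^2J_8^3}{J_{1/2,8}^2J_{1,8}J_{2,8}}.$$ The left side is $T_1^{(8)}(-q)$, where $$T_1^{(8)}(q):=\sum_{n\ge0}\frac{q^{n(n+1)}(-q^2;q^2)_n}{(-q;q^2)_{n+1}}=\frac{(-q^2;q^2)_\infty}{(q^2;q^2)_\infty}\sum_{n\ge0}q^{4n^2+3n}(1-q^{2n+1})\sum_{j=-n}^n(-1)^jq^{-2j^2-j}.$$ (3) $$\psi_-^{(6)}(q):=\sum_{n\ge1}\frac{q^n(-q;q)_{2n-2}}{(q;q^2)_n}=q\frac{(-q;q)_\infty}{(q;q)_\infty}\sum_{n\ge0}(-1)^nq^{3n^2+3n}\sum_{j=-n}^nq^{-2j^2-j}$$ $$=\frac12q\frac{J_2}{J_1^2}\left(f_{1,5,1}(q^3,q^5,q^2)-q^6f_{1,5,1}(q^9,q^{11},q^2)\right)=q\frac{J_2}{J_1^2}f_{1,5,1}(q^3,q^5,q^2)$$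 $$=-m(-q^{18},q^{48},-1)+q^{-3}m(-q^6,q^{48},-1)+q\frac{J_2}{J_1^2}\Phi_{1,4}(q^3,q^5,q^2)=-m(-q^3,q^{12},q)+q^2\frac{J_2^2J_{12}J_{24}J_{4,24}^2}{J_1^2J_{1,24}J_{10,24}J_{11,24}}.$$ (4) $$V_1^{(8)}(q):=\sum_{n\ge0}\frac{q^{(n+1)^2}(-q;q^2)_n}{(q;q^2)_{n+1}}=q\frac{(-q;q^2)_\infty}{(q^2;q^2)_\infty}\sum_{n\ge0}(-1)^nq^{4n^2+4n}\sum_{j=-n}^nq^{-2j^2-j}$$ $$=\frac12q\frac{J_2}{J_1J_4}\left(f_{1,3,1}(q^5,q^7,q^4)-q^8f_{1,3,1}(q^{13},q^{15},q^4)\right)=q\frac{J_2}{J_1J_4}f_{1,3,1}(q^5,q^7,q^4)$$ $$=-m(q^2,q^8,q^{-1/2})+\frac{J_{5/2,8}J_8^3}{J_{1/2,8}J_{1,8}J_{3,8}}.$$ (For $q=0$ the monomials $q^{4n^2+3n}q^{-2j^2-j}$ and the like are read as single powers of $q$ with nonnegative exponent.) -/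

import Mathlib

open scoped BigOperators

noncomputable section

namespace MockHecke

/-- The finite `q`-shifted factorial `(x;q)_n = ∏_{k=0}^{n-1} (1 - x q^k)`. -/
def qPoch (x q : ℂ) (n : ℕ) : ℂ := ∏ k ∈ Finset.range n, (1 - x * q ^ k)

/-- The infinite `q`-shifted factorial `(x;q)_∞ = ∏_{k≥0} (1 - x q^k)`. -/
def qPochInf (x q : ℂ) : ℂ := ∏' k : ℕ, (1 - x * q ^ k)

/-- `j(x;q) = (x;q)_∞ (q/x;q)_∞ (q;q)_∞`. -/
def jTheta (x q : ℂ) : ℂ := qPochInf x q * qPochInf (q / x) q * qPochInf q q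

/-- `J_{a,m} = j(q^a; q^m)` for natural numbers `a`, `m`. -/
def thetaJ (a m : ℕ) (q : ℂ) : ℂ := jTheta (q ^ a) (q ^ m)

/-- `J_m = (q^m; q^m)_∞`. -/
def etaJ (m : ℕ) (q : ℂ) : ℂ := qPochInf (q ^ m) (q ^ m)

/-- `sg(r) = 1` for `r ≥ 0` and `sg(r) = -1` for `r < 0`. -/
def sg (r : ℤ) : ℤ := if 0 ≤ r then 1 else -1

/-- The binomial coefficient `r(r-1)/2` for an integer `r` (the division is exact). -/
def binom2 (r : ℤ) : ℤ := r * (r - 1) / 2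

/-- The general term of the bilateral series in `m(x,q,z)`. -/
def appellTerm (x q z : ℂ) (r : ℤ) : ℂ :=
  (-1) ^ r * q ^ binom2 r * z ^ r / (1 - q ^ (r - 1) * x * z)

/-- The Appell-Lerch building block
`m(x,q,z) = j(z;q)⁻¹ ∑_{r ∈ ℤ} (-1)^r q^{r(r-1)/2} z^r / (1 - q^{r-1} x z)`. -/
def appellM (x q z : ℂ) : ℂ := 1 / jTheta z q * ∑' r : ℤ, appellTerm x q z r

/-- The general term of `f_{a,b,c}(x,y,q)`, extended by zero to the pairs `(r,s)` with
`sg(r) ≠ sg(s)`. -/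
def heckeTerm (a b c : ℤ) (x y q : ℂ) (p : ℤ × ℤ) : ℂ :=
  if sg p.1 = sg p.2 then
    (sg p.1 : ℂ) * (-1) ^ (p.1 + p.2) * x ^ p.1 * y ^ p.2 *
      q ^ (a * binom2 p.1 + b * p.1 * p.2 + c * binom2 p.2)
  else 0

/-- `f_{a,b,c}(x,y,q) =
∑_{sg(r)=sg(s)} sg(r) (-1)^{r+s} x^r y^s q^{a r(r-1)/2 + b r s + c s(s-1)/2}`. -/
def heckeF (a b c : ℤ) (x y q : ℂ) : ℂ := ∑' p : ℤ × ℤ, heckeTerm a b c x y q p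

/-- The general term of `\bar f_{a,b,c}(x,y,q)`: the same without the factor `sg(r)`. -/
def heckeBarTerm (a b c : ℤ) (x y q : ℂ) (p : ℤ × ℤ) : ℂ :=
  if sg p.1 = sg p.2 then
    (-1) ^ (p.1 + p.2) * x ^ p.1 * y ^ p.2 *
      q ^ (a * binom2 p.1 + b * p.1 * p.2 + c * binom2 p.2)
  else 0

/-- `\bar f_{a,b,c}(x,y,q) =
∑_{sg(r)=sg(s)} (-1)^{r+s} x^r y^s q^{a r(r-1)/2 + b r s + c s(s-1)/2}`. -/
def heckeFbar (a b c : ℤ) (x y q : ℂ) : ℂ := ∑' p : ℤ × ℤ, heckeBarTerm a b c x y q p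

/-- The theta quotient `Φ_{n,p}(x,y,q)` of Hickerson and Mortenson, for positive `n`, `p`.
In the usual notation `r = r* + {(n-1)/2}`, `s = s* + {(n-1)/2}` with `0 ≤ r*, s* < p`. Here
* `e = 2 {(n-1)/2} ∈ {0,1}`,
* `A r* = r - (n-1)/2` and `B s* = s + (n+1)/2`, which are integers,
* `E r* = p(2n+p) r + p(n+p)/2`, which is an integer, and likewise `E s*`,
* `M = p²(2n+p)`. -/
def PhiHM (n p : ℕ) (x y q : ℂ) : ℂ :=
  let e : ℤ := ((n : ℤ) + 1) % 2
  let A : ℕ → ℤ := fun r => (r : ℤ) - ((n : ℤ) - 1) / 2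
  let B : ℕ → ℤ := fun s => (s : ℤ) + (n : ℤ) / 2 + 1
  let E : ℕ → ℤ := fun r => (p : ℤ) * ((2 * n + p) * (2 * r + e) + (n + p)) / 2
  let M : ℕ := p ^ 2 * (2 * n + p)
  etaJ M q ^ 3 / jTheta (-1) (q ^ (n * p * (2 * n + p))) *
    ∑ r ∈ Finset.range p, ∑ s ∈ Finset.range p,
      q ^ ((n : ℤ) * binom2 (A r) + ((n : ℤ) + p) * A r * B s + (n : ℤ) * binom2 (B s)) *
        (-x) ^ A r * (-y) ^ B s *
        jTheta (-q ^ ((n : ℤ) * p * ((s : ℤ) - r)) * x ^ n / y ^ n) (q ^ (n * p ^ 2)) *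
        jTheta (q ^ ((p : ℤ) * (2 * n + p) * (r + s + e) + (p : ℤ) * (n + p)) * x ^ p * y ^ p)
          (q ^ M) /
        (jTheta (q ^ E r * (-y) ^ (n + p) / (-x) ^ n) (q ^ M) *
          jTheta (q ^ E s * (-x) ^ (n + p) / (-y) ^ n) (q ^ M))

/-- The general term of `F_1^{(5)}(q) = ∑_{n≥0} q^{2n(n+1)} / (q;q²)_{n+1}`. -/
def F1Term (q : ℂ) (n : ℕ) : ℂ := q ^ (2 * n * (n + 1)) / qPoch q (q ^ 2) (n + 1)

/-- The fifth order mock theta function `F_1^{(5)}(q)`. -/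
def F1 (q : ℂ) : ℂ := ∑' n : ℕ, F1Term q n

/-- The general term of
`ψ_-^{(6)}(q) = ∑_{n≥1} q^n (-q;q)_{2n-2} / (q;q²)_n`, with `n` shifted by one. -/
def psiMinusTerm (q : ℂ) (n : ℕ) : ℂ :=
  q ^ (n + 1) * qPoch (-q) q (2 * n) / qPoch q (q ^ 2) (n + 1)

/-- The sixth order mock theta function `ψ_-^{(6)}(q)`. -/
def psiMinus (q : ℂ) : ℂ := ∑' n : ℕ, psiMinusTerm q n

/-- The general term of
`T_1^{(8)}(q) = ∑_{n≥0} q^{n(n+1)} (-q²;q²)_n / (-q;q²)_{n+1}`. -/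
def T1Term (q : ℂ) (n : ℕ) : ℂ :=
  q ^ (n * (n + 1)) * qPoch (-q ^ 2) (q ^ 2) n / qPoch (-q) (q ^ 2) (n + 1)

/-- The eighth order mock theta function `T_1^{(8)}(q)`. -/
def T1 (q : ℂ) : ℂ := ∑' n : ℕ, T1Term q n

/-- The general term of
`V_1^{(8)}(q) = ∑_{n≥0} q^{(n+1)²} (-q;q²)_n / (q;q²)_{n+1}`. -/
def V1Term (q : ℂ) (n : ℕ) : ℂ :=
  q ^ ((n + 1) ^ 2) * qPoch (-q) (q ^ 2) n / qPoch q (q ^ 2) (n + 1)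

/-- The eighth order mock theta function `V_1^{(8)}(q)`. -/
def V1 (q : ℂ) : ℂ := ∑' n : ℕ, V1Term q n

/-- The general term of the series `∑_{n≥0} (-1)^n (q²;q²)_n q^{n(n+1)} / (q;q²)_{n+1}`. -/
def altTerm (q : ℂ) (n : ℕ) : ℂ :=
  (-1) ^ n * qPoch (q ^ 2) (q ^ 2) n / qPoch q (q ^ 2) (n + 1) * q ^ (n * (n + 1))

/-- The general term of the series `∑_{n≥0} q^{n(n+1)} (-q²;q²)_n / (q;q²)_{n+1}`, which is
`T_1^{(8)}(-q)`. -/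
def T1NegTerm (q : ℂ) (n : ℕ) : ℂ :=
  q ^ (n * (n + 1)) * qPoch (-q ^ 2) (q ^ 2) n / qPoch q (q ^ 2) (n + 1)

end MockHecke

end

open MockHecke

/-!
The identities fall into two groups.

**Hecke-type series.** With `baileyAlpha` the sequence whose `n`-th term is
`(-1)^n q^{3n²+2n} (1 + q^{2n+1}) ∑_{|j| ≤ n} q^{-2j²-j}`, the pair
`(baileyAlpha, 1/(q;q²)_{n+1})` is a Bailey pair relative to `q²` in base `q²`; this is `sum_baileyAlpha`, proved by telescoping. Bailey's lemma
(`bailey_lemma`) holds for all Bailey pairs because it holds for each term of the `α` side, where it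
is the `q`-Gauss sum (`tsum_gaussTerm`). Its two free parameters `ρ₁`, `ρ₂` enter through `b = 1/ρ₁`
and `c = 1/ρ₂`, so that `ρ = ∞` is the regular value `0`. The five Eulerian series are its
specialisations at

* `(∞, ∞)` for `F_1^{(5)}(q)`,
* `(q², ∞)` for `∑ (-1)^n (q²;q²)_n q^{n(n+1)} / (q;q²)_{n+1}`,
* `(-q², ∞)` for `T_1^{(8)}(-q)`,
* `(-q, ∞)` for `V_1^{(8)}(q)`,
* `(-q, -q²)` for `ψ_-^{(6)}(q)`.

The parameters `1/ρ` need `q ≠ 0`; at `q = 0` only the terms with `n = 0` survive. The series for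
`T_1^{(8)}(q)` is that for `T_1^{(8)}(-q)` with `q` replaced by `-q`.

**Expressions through building blocks.** Let `cone k l = (sg k + sg l) / 2`, which is `±1` or `0`.
Both `f_{a,b,c}` and the Hecke-type series are sums over `ℤ²` weighted by `cone`: for the former the
weight is `cone r s`, and for the latter it is `cone (n + j) (n - j)` (`hasSum_nat_of_cone`). The two
kinds are related by splitting according to the parity of `n + j` (`tsum_cone_parity`), and
for `ψ_-^{(6)}` and `V_1^{(8)}` the reflection `(r, s) ↦ (-1-s, -1-r)` identifies the two functions
`f` that occur (`heckeF_reflect`).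

For the Appell-Lerch expressions, the double sum is multiplied by a theta series in a new variable
`t`. In the resulting sum over `ℤ³` the weight is decomposed by the sign identity `cone_split`,

`cone k l = cone k (t - k - a) + cone l (-t - l) + cone (k - t + a - 1) (l + t - 1)`.

* The quadratic form and the theta series are chosen so that, after a linear substitution, the sums
  with the first two weights are products of a theta series and an Appell-Lerch series; the latter
  appears as a double series through `1 / (1 - X) = ∑_k cone k T * X^k` (`hasSum_appell`).
* In the sum with the third weight the two arguments of `cone` become independent variables, running
  over finitely many residue classes. On each class the sum is a theta series times a Kronecker
  double series `∑ cone r s * x^r y^s q^{rs}`, which is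
  `(q;q)_∞³ j(xy;q) / (j(x;q) j(y;q))` (`hasSum_kronTerm`). The proof is elementary: by
  the Jacobi triple product (`tsum_thetaTerm`) the Kronecker series times `j(y;q)` is `j(xy;q)` times
  a series depending on `x` only (`jTheta_mul_tsum_kronTerm`); by the symmetry in `x` and `y`, the
  latter times `j(x;q)` is constant, and the constant is found by letting `x → 1`.

Division by the theta function gives the results. For `f_{1,5,1}(q³,q⁵,q²)` and `j(-1;q^48)` there
are sixteen residue classes, and they are the sixteen terms of `Φ_{1,4}` (`PhiHM_one_four`). For the
other expressions of `ψ_-^{(6)}`, `V_1^{(8)}` and `T_1^{(8)}` the triple sum is built on the sum over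
`(n, j)`, one or two distinct Kronecker terms remain, and a sum of two of them is a single theta
quotient by the product formula `jTheta_mul_jTheta` (`psi_theta_quotient`, `V_theta_quotient`,
`T_theta_quotient`).
-/

noncomputable section

namespace MockHecke

open Filter Topology

/-! ### Shifted factorials -/

lemma qPoch_succ (x q : ℂ) (n : ℕ) : qPoch x q (n + 1) = qPoch x q n * (1 - x * q ^ n) := by
  simp [qPoch, Finset.prod_range_succ]

lemma qPoch_add (x q : ℂ) (m n : ℕ) :
    qPoch x q (m + n) = qPoch x q m * qPoch (x * q ^ m) q n := by
  simp only [qPoch, Finset.prod_range_add, pow_add, mul_assoc]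

lemma qPoch_succ' (x q : ℂ) (n : ℕ) : qPoch x q (n + 1) = (1 - x) * qPoch (x * q) q n := by
  rw [add_comm, qPoch_add]; simp [qPoch]

lemma summable_norm_mul_pow {q : ℂ} (hq : ‖q‖ < 1) (x : ℂ) :
    Summable fun k : ℕ => ‖-(x * q ^ k)‖ := by
  simpa [norm_mul, norm_pow] using
    (summable_geometric_of_lt_one (norm_nonneg q) hq).mul_left ‖x‖

lemma multipliable_qPochInf {q : ℂ} (hq : ‖q‖ < 1) (x : ℂ) :
    Multipliable fun k : ℕ => 1 - x * q ^ k := by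
  simpa [sub_eq_add_neg] using multipliable_one_add_of_summable (summable_norm_mul_pow hq x)

lemma tendsto_qPoch {q : ℂ} (hq : ‖q‖ < 1) (x : ℂ) :
    Tendsto (qPoch x q) atTop (𝓝 (qPochInf x q)) :=
  (multipliable_qPochInf hq x).tendsto_prod_tprod_nat

lemma qPoch_mul_qPochInf {q : ℂ} (hq : ‖q‖ < 1) (x : ℂ) (n : ℕ) :
    qPoch x q n * qPochInf (x * q ^ n) q = qPochInf x q := by
  refine tendsto_nhds_unique ((tendsto_qPoch hq (x * q ^ n)).const_mul (qPoch x q n)) ?_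
  simp_rw [← qPoch_add, add_comm n]
  exact (tendsto_add_atTop_iff_nat n).2 (tendsto_qPoch hq x)

lemma qPochInf_eq_mul {q : ℂ} (hq : ‖q‖ < 1) (x : ℂ) :
    qPochInf x q = (1 - x) * qPochInf (x * q) q := by
  simpa [qPoch] using (qPoch_mul_qPochInf hq x 1).symm

lemma qPochInf_zero_left (q : ℂ) : qPochInf 0 q = 1 := by simp [qPochInf]

lemma qPochInf_ne_zero {q : ℂ} (hq : ‖q‖ < 1) {x : ℂ} (hx : ∀ k : ℕ, x * q ^ k ≠ 1) :
    qPochInf x q ≠ 0 := by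
  have := tprod_one_add_ne_zero_of_summable (f := fun k : ℕ => -(x * q ^ k))
    (fun k h => hx k (by linear_combination -h)) (summable_norm_mul_pow hq x)
  simpa [qPochInf, sub_eq_add_neg] using this

lemma qPochInf_ne_zero_of_norm_lt {q : ℂ} (hq : ‖q‖ < 1) {x : ℂ} (hx : ‖x‖ < 1) :
    qPochInf x q ≠ 0 := by
  refine qPochInf_ne_zero hq fun k h => ?_
  have := congrArg norm h
  rw [norm_mul, norm_pow, norm_one] at this
  have h2 : ‖q‖ ^ k ≤ 1 := pow_le_one₀ (norm_nonneg _) hq.le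
  nlinarith [norm_nonneg x, norm_nonneg q, pow_nonneg (norm_nonneg q) k]

lemma qPoch_ne_zero_of_norm_lt {q : ℂ} (hq : ‖q‖ < 1) {x : ℂ} (hx : ‖x‖ < 1) (n : ℕ) :
    qPoch x q n ≠ 0 := by
  intro h
  apply qPochInf_ne_zero_of_norm_lt hq hx
  rw [← qPoch_mul_qPochInf hq x n, h, zero_mul]

lemma exists_norm_qPoch_le {q : ℂ} (hq : ‖q‖ < 1) (x : ℂ) : ∃ C : ℝ, ∀ n, ‖qPoch x q n‖ ≤ C := by
  obtain ⟨C, hC⟩ := (tendsto_qPoch hq x).norm.bddAbove_range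
  exact ⟨C, fun n => hC ⟨n, rfl⟩⟩

lemma exists_norm_inv_qPoch_le {q : ℂ} (hq : ‖q‖ < 1) {x : ℂ} (hx : ‖x‖ < 1) :
    ∃ C : ℝ, 0 ≤ C ∧ ∀ n, ‖(qPoch x q n)⁻¹‖ ≤ C := by
  obtain ⟨C, hC⟩ :=
    ((tendsto_qPoch hq x).inv₀ (qPochInf_ne_zero_of_norm_lt hq hx)).norm.bddAbove_range
  exact ⟨C, (norm_nonneg _).trans (hC ⟨0, rfl⟩), fun n => hC ⟨n, rfl⟩⟩

lemma continuous_qPochInf {q : ℂ} (hq : ‖q‖ < 1) : Continuous fun x => qPochInf x q := by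
  rw [continuous_iff_continuousAt]
  intro x
  have h := tendsto_tprod_one_add_of_dominated_convergence (𝓕 := 𝓝 x)
    (f := fun (y : ℂ) (k : ℕ) => -(y * q ^ k)) (g := fun k => -(x * q ^ k))
    (bound := fun k => (‖x‖ + 1) * ‖q‖ ^ k)
    ((summable_geometric_of_lt_one (norm_nonneg q) hq).mul_left _)
    (fun k => (Continuous.tendsto (by fun_prop) x)) ?_
  · simpa [ContinuousAt, qPochInf, sub_eq_add_neg] using h
  · filter_upwards [(continuous_norm.tendsto x).eventually (gt_mem_nhds (lt_add_one ‖x‖))]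
      with y hy k
    rw [norm_neg, norm_mul, norm_pow]
    gcongr

/-- Splitting the factors of `(x;q)_∞` according to the residue of the exponent modulo `m`. -/
lemma qPochInf_dissect {q : ℂ} (hq : ‖q‖ < 1) (x : ℂ) {m : ℕ} (hm : m ≠ 0) :
    qPochInf x q = ∏ i ∈ Finset.range m, qPochInf (x * q ^ i) (q ^ m) := by
  have hqm : ‖q ^ m‖ < 1 := by rw [norm_pow]; exact pow_lt_one₀ (norm_nonneg _) hq hm
  have key : ∀ n, qPoch x q (m * n) = ∏ i ∈ Finset.range m, qPoch (x * q ^ i) (q ^ m) n := by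
    intro n
    induction n with
    | zero => simp [qPoch]
    | succ n ih =>
      simp_rw [qPoch_succ, Finset.prod_mul_distrib, ← ih, mul_add, mul_one, qPoch_add]
      congr 1
      refine Finset.prod_congr rfl fun i _ => ?_
      ring
  refine tendsto_nhds_unique (((tendsto_qPoch hq x).comp
    (tendsto_id.const_mul_atTop' (Nat.pos_of_ne_zero hm)))) ?_
  refine Tendsto.congr (fun n => (key n).symm) ?_
  exact tendsto_finsetProd _ fun i _ => tendsto_qPoch hqm _

lemma qPochInf_mul_neg {q : ℂ} (hq : ‖q‖ < 1) (x : ℂ) :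
    qPochInf x q * qPochInf (-x) q = qPochInf (x ^ 2) (q ^ 2) := by
  rw [qPochInf, qPochInf, qPochInf,
    ← (multipliable_qPochInf hq x).tprod_mul (multipliable_qPochInf hq (-x))]
  refine tprod_congr fun k => ?_
  ring

/-! ### A Bailey pair -/

/-- `1 / (q;q)_m`, extended by zero to negative `m`. With this convention the recurrence
`invPoch_sub_one` holds for all integers. -/
def invPoch (q : ℂ) (m : ℤ) : ℂ := if 0 ≤ m then (qPoch q q m.toNat)⁻¹ else 0

lemma invPoch_natCast (q : ℂ) (m : ℕ) : invPoch q m = (qPoch q q m)⁻¹ := by simp [invPoch]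

lemma invPoch_of_neg (q : ℂ) {m : ℤ} (hm : m < 0) : invPoch q m = 0 := by
  simp [invPoch, not_le.2 hm]

lemma invPoch_sub_one {q : ℂ} (hq : ‖q‖ < 1) (m : ℤ) :
    invPoch q (m - 1) = (1 - q ^ m) * invPoch q m := by
  rcases lt_trichotomy m 0 with h | rfl | h
  · rw [invPoch_of_neg _ h, invPoch_of_neg _ (by omega), mul_zero]
  · rw [invPoch_of_neg _ (by omega)]; simp
  · obtain ⟨k, rfl⟩ : ∃ k : ℕ, m = k + 1 := ⟨(m - 1).toNat, by omega⟩
    have h1 := qPoch_ne_zero_of_norm_lt hq hq (k + 1)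
    have e : ((k : ℤ) + 1) = ((k + 1 : ℕ) : ℤ) := by push_cast; ring
    rw [show ((k : ℤ) + 1 - 1) = (k : ℤ) by ring, e, invPoch_natCast, invPoch_natCast, zpow_natCast]
    rw [qPoch_succ] at h1 ⊢
    have h2 := left_ne_zero_of_mul h1
    have h3 := right_ne_zero_of_mul h1
    rw [pow_succ'] at *
    field_simp

lemma sum_Icc_neg_succ {M : Type*} [AddCommMonoid M] (f : ℤ → M) (n : ℕ) :
    ∑ j ∈ Finset.Icc (-((n + 1 : ℕ) : ℤ)) ((n + 1 : ℕ) : ℤ), f j =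
      ∑ j ∈ Finset.Icc (-(n : ℤ)) n, f j + (f (n + 1) + f (-(n + 1))) := by
  have h : Finset.Icc (-((n + 1 : ℕ) : ℤ)) ((n + 1 : ℕ) : ℤ) =
      insert ((n : ℤ) + 1) (insert (-((n : ℤ) + 1)) (Finset.Icc (-(n : ℤ)) n)) := by
    ext j; simp only [Finset.mem_insert, Finset.mem_Icc]; omega
  rw [h, Finset.sum_insert, Finset.sum_insert]
  · abel
  · simp
  · simp only [Finset.mem_insert, Finset.mem_Icc]; omega

/-- Summation by parts against the symmetric partial sums of `e`, for an even sequence `G`. -/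
lemma sum_sub_mul_symm_sum (G e : ℤ → ℂ) (hG : ∀ r, G (-r) = G r) (n : ℕ) :
    ∑ r ∈ Finset.range (n + 1), (G r - G (r + 1)) * ∑ j ∈ Finset.Icc (-(r : ℤ)) r, e j =
      ∑ r ∈ Finset.Icc (-(n : ℤ)) n, G r * e r
        - G (n + 1) * ∑ j ∈ Finset.Icc (-(n : ℤ)) n, e j := by
  induction n with
  | zero => simp; ring
  | succ n ih =>
    rw [Finset.sum_range_succ, ih, sum_Icc_neg_succ, sum_Icc_neg_succ, hG]
    push_cast
    ring

lemma neg_one_zpow_sub (a b : ℤ) : (-1 : ℂ) ^ (a - b) = (-1) ^ (a + b) := by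
  rw [zpow_sub₀ (by norm_num), zpow_add₀ (by norm_num), div_eq_mul_inv]
  congr 1
  rcases Int.even_or_odd b with h | h
  · simp [h.neg_one_zpow]
  · simp [h.neg_one_zpow]

/-- A case of the finite `q`-binomial theorem at a zero of the product. -/
lemma sum_invPoch_mul_invPoch_eq_zero {q : ℂ} (hq : ‖q‖ < 1) (h0 : q ≠ 0) {n : ℕ} (hn : n ≠ 0) :
    ∑ r ∈ Finset.Icc (-(n : ℤ)) n, (-1 : ℂ) ^ r * q ^ (r * r - r) *
      (invPoch (q ^ 2) (n - r) * invPoch (q ^ 2) (n + r)) = 0 := by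
  have hQ : ‖q ^ 2‖ < 1 := by rw [norm_pow]; exact pow_lt_one₀ (norm_nonneg _) hq two_ne_zero
  set A : ℤ → ℂ := fun r => (-1 : ℂ) ^ r * q ^ (r * r - r) *
    (invPoch (q ^ 2) (n - r) * invPoch (q ^ 2) (n + r - 1)) with hA
  set B : ℤ → ℂ := fun r => (-1 : ℂ) ^ r * q ^ (r * r + r + 2 * n) *
    (invPoch (q ^ 2) (n - r - 1) * invPoch (q ^ 2) (n + r)) with hB
  have hA0 : ∑' r, A r = 0 := by
    have h := (Equiv.subLeft (1 : ℤ)).tsum_eq A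
    have h2 : ∀ r, A (Equiv.subLeft (1 : ℤ) r) = -A r := by
      intro r
      simp only [hA, Equiv.subLeft_apply]
      rw [neg_one_zpow_sub, zpow_add₀ (by norm_num),
        show (n : ℤ) - (1 - r) = n + r - 1 by ring, show (n : ℤ) + (1 - r) - 1 = n - r by ring,
        show (1 - r) * (1 - r) - (1 - r) = r * r - r by ring]
      rw [zpow_one]; ring
    simp_rw [h2, tsum_neg] at h
    linear_combination (-1 / 2) * h
  have hB0 : ∑' r, B r = 0 := by
    have h := (Equiv.subLeft (-1 : ℤ)).tsum_eq B
    have h2 : ∀ r, B (Equiv.subLeft (-1 : ℤ) r) = -B r := by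
      intro r
      simp only [hB, Equiv.subLeft_apply]
      rw [neg_one_zpow_sub, zpow_add₀ (by norm_num),
        show (n : ℤ) - (-1 - r) - 1 = n + r by ring, show (n : ℤ) + (-1 - r) = n - r - 1 by ring,
        show (-1 - r) * (-1 - r) + (-1 - r) + 2 * n = r * r + r + 2 * n by ring]
      rw [show (-1 : ℂ) ^ (-1 : ℤ) = -1 by norm_num]; ring
    simp_rw [h2, tsum_neg] at h
    linear_combination (-1 / 2) * h
  rw [tsum_eq_sum (s := Finset.Icc (-(n : ℤ)) n)] at hA0 hB0
  · have h1 : (1 - (q ^ 2) ^ (2 * n : ℤ)) ≠ 0 := by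
      intro h
      have h2 : ‖(q ^ 2) ^ (2 * n)‖ < 1 := by
        rw [norm_pow]; exact pow_lt_one₀ (norm_nonneg _) hQ (by omega)
      have h3 : (q ^ 2) ^ (2 * n) = 1 := by
        have : ((q ^ 2) ^ (2 * n : ℤ) : ℂ) = 1 := by linear_combination -h
        exact_mod_cast this
      rw [h3] at h2
      simp at h2
    refine (mul_eq_zero.1 ?_).resolve_left h1
    rw [← add_zero 0]
    nth_rewrite 2 [← hA0]
    rw [← hB0, ← Finset.sum_add_distrib, Finset.mul_sum]
    refine Finset.sum_congr rfl fun r _ => ?_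
    simp only [hA, hB]
    rw [invPoch_sub_one hQ, invPoch_sub_one hQ]
    rw [show (r * r + r + 2 * n) = (r * r - r) + 2 * (n + r) by ring, zpow_add₀ h0 (r * r - r),
      show (2 * n : ℤ) = (n - r) + (n + r) by ring, zpow_add₀ (pow_ne_zero 2 h0),
      zpow_mul q 2 (n + r)]
    norm_cast
    ring
  · intro r hr
    simp only [Finset.mem_Icc, not_and_or, not_le] at hr
    simp only [hB]
    rcases hr with h | h
    · rw [invPoch_of_neg _ (show (n + r : ℤ) < 0 by omega)]; ring
    · rw [invPoch_of_neg _ (show (n - r - 1 : ℤ) < 0 by omega)]; ring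
  · intro r hr
    simp only [Finset.mem_Icc, not_and_or, not_le] at hr
    simp only [hA]
    rcases hr with h | h
    · rw [invPoch_of_neg _ (show (n + r - 1 : ℤ) < 0 by omega)]; ring
    · rw [invPoch_of_neg _ (show (n - r : ℤ) < 0 by omega)]; ring

/-- The sequence `α_r` of the Bailey pair whose `β_n` is `1 / (q;q²)_{n+1}`, relative to `q²` in
base `q²`, up to the constant factor `1 - q²`. -/
def baileyAlpha (q : ℂ) (r : ℕ) : ℂ :=
  (-1) ^ r * q ^ (3 * (r : ℤ) ^ 2 + 2 * r) * (1 + q ^ (2 * r + 1)) *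
    ∑ j ∈ Finset.Icc (-(r : ℤ)) r, q ^ (-2 * j ^ 2 - j)

/-- The Bailey pair. Both sides satisfy `(1 - q^{2n+1}) U_n = U_{n-1}`: for the left side the
difference of the two terms telescopes against the partial sums in `α_r`. -/
theorem sum_baileyAlpha {q : ℂ} (hq : ‖q‖ < 1) (h0 : q ≠ 0) (n : ℕ) :
    ∑ r ∈ Finset.range (n + 1), baileyAlpha q r *
      (invPoch (q ^ 2) (n - r) * invPoch (q ^ 2) (n + r + 1)) = (qPoch q (q ^ 2) (n + 1))⁻¹ := by
  have hQ : ‖q ^ 2‖ < 1 := by rw [norm_pow]; exact pow_lt_one₀ (norm_nonneg _) hq two_ne_zero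
  have hne : ∀ n, qPoch q (q ^ 2) n ≠ 0 := qPoch_ne_zero_of_norm_lt hQ hq
  induction n with
  | zero =>
    have h1 := hne 1
    have h2 := qPoch_ne_zero_of_norm_lt hQ hQ 1
    have e : ((0 : ℕ) : ℤ) + ((0 : ℕ) : ℤ) + 1 = ((1 : ℕ) : ℤ) := by simp
    simp only [qPoch, Finset.prod_range_one, pow_zero, mul_one] at h1 h2
    rw [zero_add, Finset.sum_range_one, sub_self, e, invPoch_natCast,
      show (0 : ℤ) = ((0 : ℕ) : ℤ) by simp, invPoch_natCast]
    simp only [qPoch, baileyAlpha, Finset.prod_range_one, pow_zero, mul_one]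
    simp
    field_simp
    ring
  | succ n ih =>
    have hr : (1 - q * (q ^ 2) ^ (n + 1)) ≠ 0 := by
      have := hne (n + 1 + 1); rw [qPoch_succ] at this; exact right_ne_zero_of_mul this
    rw [qPoch_succ, mul_inv, ← ih, ← div_eq_mul_inv, eq_div_iff hr]
    set N : ℤ := ((n + 1 : ℕ) : ℤ) with hN
    set G : ℤ → ℂ := fun r => (-1 : ℂ) ^ r * q ^ (3 * r ^ 2 + 2 * N) *
      (invPoch (q ^ 2) (N - r) * invPoch (q ^ 2) (N + r)) with hG
    have hGe : ∀ r, G (-r) = G r := by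
      intro r
      simp only [hG]
      rw [show N - -r = N + r by ring, show N + -r = N - r by ring, neg_sq, zpow_neg, ← inv_zpow]
      norm_num
      left; ring
    -- the difference of the two sides is a sum by parts
    have key : ∀ r : ℕ, baileyAlpha q r *
        (invPoch (q ^ 2) (N - r) * invPoch (q ^ 2) (N + r + 1)) * (1 - q * (q ^ 2) ^ (n + 1)) -
        baileyAlpha q r * (invPoch (q ^ 2) (n - r) * invPoch (q ^ 2) (n + r + 1)) =
        (G r - G (r + 1)) * ∑ j ∈ Finset.Icc (-(r : ℤ)) r, q ^ (-2 * j ^ 2 - j) := by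
      intro r
      simp only [hG, baileyAlpha]
      have i1 : invPoch (q ^ 2) (N - r - 1) = _ := invPoch_sub_one hQ (N - r)
      have i2 : invPoch (q ^ 2) (N + r) =
          (1 - (q ^ 2) ^ (N + r + 1)) * invPoch (q ^ 2) (N + r + 1) := by
        rw [← invPoch_sub_one hQ (N + r + 1), add_sub_cancel_right]
      rw [show (n : ℤ) - r = N - r - 1 by rw [hN]; push_cast; ring,
        show (n : ℤ) + r + 1 = N + r by rw [hN]; push_cast; ring,
        show N - ((r : ℤ) + 1) = N - r - 1 by ring,
        show N + ((r : ℤ) + 1) = N + r + 1 by ring, i1, i2]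
      have p1 : (q ^ 2) ^ (N - r) = (q ^ 2) ^ (n + 1) * (q ^ (2 * r))⁻¹ := by
        rw [zpow_sub₀ (pow_ne_zero 2 h0), hN, zpow_natCast, zpow_natCast, pow_mul, div_eq_mul_inv]
      have p2 : (q ^ 2) ^ (N + r + 1) = (q ^ 2) ^ (n + 1) * q ^ (2 * r) * q ^ 2 := by
        rw [zpow_add₀ (pow_ne_zero 2 h0), zpow_add₀ (pow_ne_zero 2 h0), hN, zpow_natCast,
          zpow_natCast, pow_mul, zpow_one]
      have p3 : q ^ (3 * (r : ℤ) ^ 2 + 2 * N) = q ^ (3 * (r : ℤ) ^ 2) * (q ^ 2) ^ (n + 1) := by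
        rw [zpow_add₀ h0, zpow_mul q 2 N, hN, zpow_natCast]; norm_cast
      have p4 : q ^ (3 * ((r : ℤ) + 1) ^ 2 + 2 * N) =
          q ^ (3 * (r : ℤ) ^ 2) * (q ^ (2 * r)) ^ 3 * q ^ 3 * (q ^ 2) ^ (n + 1) := by
        rw [show 3 * ((r : ℤ) + 1) ^ 2 + 2 * N = 3 * (r : ℤ) ^ 2 + (2 * r : ℕ) * (3 : ℕ) + (3 : ℕ)
          + 2 * N by push_cast; ring, zpow_add₀ h0, zpow_add₀ h0, zpow_add₀ h0, zpow_mul q 2 N, hN,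
          zpow_natCast, zpow_mul q ((2 * r : ℕ) : ℤ) (3 : ℕ), zpow_natCast, zpow_natCast,
          zpow_natCast]
        norm_cast
      have p5 : q ^ (3 * (r : ℤ) ^ 2 + 2 * (r : ℤ)) = q ^ (3 * (r : ℤ) ^ 2) * q ^ (2 * r) := by
        rw [zpow_add₀ h0]; norm_cast
      have p6 : (-1 : ℂ) ^ ((r : ℤ) + 1) = -(-1) ^ (r : ℕ) := by
        rw [zpow_add₀ (by norm_num), zpow_natCast, zpow_one]; ring
      have hqr : q ^ (2 * r) ≠ 0 := pow_ne_zero _ h0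
      rw [p1, p2, p3, p4, p5, p6, zpow_natCast, pow_succ q (2 * r)]
      field_simp
      ring
    have hlast : baileyAlpha q (n + 1) * (invPoch (q ^ 2) (n - (n + 1 : ℕ)) *
        invPoch (q ^ 2) (n + (n + 1 : ℕ) + 1)) = 0 := by
      rw [invPoch_of_neg _ (show (n : ℤ) - (n + 1 : ℕ) < 0 by push_cast; omega)]; ring
    rw [← sub_eq_zero, ← add_zero (∑ r ∈ Finset.range (n + 1), _), ← hlast,
      ← Finset.sum_range_succ (fun r : ℕ => baileyAlpha q r *
        (invPoch (q ^ 2) (n - r) * invPoch (q ^ 2) (n + r + 1))) (n + 1),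
      Finset.sum_mul, ← Finset.sum_sub_distrib, Finset.sum_congr rfl fun r _ => key r,
      sum_sub_mul_symm_sum G _ hGe]
    have hG1 : G (((n + 1 : ℕ) : ℤ) + 1) = 0 := by
      simp only [hG]
      rw [invPoch_of_neg _ (show N - (((n + 1 : ℕ) : ℤ) + 1) < 0 by omega)]; ring
    rw [hG1, zero_mul, sub_zero, hlast]
    have hz := sum_invPoch_mul_invPoch_eq_zero hq h0 (n := n + 1) (by omega)
    rw [← mul_zero (q ^ (2 * N)), ← hz, Finset.mul_sum]
    refine Finset.sum_congr rfl fun r _ => ?_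
    simp only [hG]
    rw [show 3 * r ^ 2 + 2 * N = 2 * N + (r * r - r) + (2 * r ^ 2 + r) by ring, zpow_add₀ h0,
      zpow_add₀ h0 (2 * N), show -2 * r ^ 2 - r = -(2 * r ^ 2 + r) by ring, zpow_neg]
    have : q ^ (2 * r ^ 2 + r) ≠ 0 := zpow_ne_zero _ h0
    field_simp
    rfl

/-! ### The `q`-Gauss sum and Bailey's lemma -/

/-- `∏_{k<m} (b - u q^k)`. For `b = 1/ρ` and `u = 1` this is `(ρ;q)_m / ρ^m`, so that the parameter
`ρ = ∞` of the usual statements is the value `b = 0`. -/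
def revPoch (b u q : ℂ) (m : ℕ) : ℂ := ∏ k ∈ Finset.range m, (b - u * q ^ k)

lemma revPoch_succ (b u q : ℂ) (m : ℕ) :
    revPoch b u q (m + 1) = revPoch b u q m * (b - u * q ^ m) := by
  simp [revPoch, Finset.prod_range_succ]

lemma revPoch_add (b q : ℂ) (r m : ℕ) :
    revPoch b 1 q (r + m) = revPoch b 1 q r * revPoch b (q ^ r) q m := by
  simp only [revPoch, Finset.prod_range_add, pow_add, one_mul]

lemma summable_norm_revPoch_mul {q : ℂ} (hq : ‖q‖ < 1) (b c u v : ℂ) (h : ‖b * c * v‖ < 1) :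
    Summable fun m : ℕ => ‖revPoch b u q m * revPoch c u q m * v ^ m‖ := by
  obtain ⟨ρ, hρ, hρ1⟩ := exists_between h
  refine summable_of_ratio_norm_eventually_le (r := ρ) hρ1 ?_
  have h1 : Tendsto (fun m : ℕ => ‖(b - u * q ^ m) * (c - u * q ^ m) * v‖) atTop
      (𝓝 ‖b * c * v‖) := by
    have h0 := tendsto_pow_atTop_nhds_zero_of_norm_lt_one hq
    have : Tendsto (fun m : ℕ => (b - u * q ^ m) * (c - u * q ^ m) * v) atTop
      (𝓝 ((b - u * 0) * (c - u * 0) * v)) :=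
      (((h0.const_mul u).const_sub b).mul ((h0.const_mul u).const_sub c)).mul_const v
    simpa using this.norm
  filter_upwards [h1.eventually (gt_mem_nhds hρ)] with m hm
  rw [norm_norm, norm_norm, revPoch_succ, revPoch_succ]
  calc _ = ‖(b - u * q ^ m) * (c - u * q ^ m) * v‖ *
        ‖revPoch b u q m * revPoch c u q m * v ^ m‖ := by rw [← norm_mul]; congr 1; ring
    _ ≤ _ := by gcongr

/-- The general term of the `q`-Gauss series `₂φ₁(u/b, u/c; u²v; q, bcv)`. -/
def gaussTerm (b c u q v : ℂ) (m : ℕ) : ℂ :=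
  revPoch b u q m * revPoch c u q m * v ^ m * ((qPoch q q m)⁻¹ * (qPoch (u ^ 2 * v) q m)⁻¹)

lemma summable_gaussTerm {q : ℂ} (hq : ‖q‖ < 1) {b c u v : ℂ} (hC : ‖u ^ 2 * v‖ < 1)
    (h : ‖b * c * v‖ < 1) : Summable (gaussTerm b c u q v) := by
  obtain ⟨K, hK0, hK⟩ := exists_norm_inv_qPoch_le hq hq
  obtain ⟨L, hL0, hL⟩ := exists_norm_inv_qPoch_le hq hC
  refine Summable.of_norm_bounded ((summable_norm_revPoch_mul hq b c u v h).mul_right (K * L)) ?_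
  intro m
  rw [gaussTerm, norm_mul, norm_mul (_⁻¹)]
  gcongr
  exacts [hK m, hL m]

/-- The contiguous relation for the `q`-Gauss series, by telescoping. -/
lemma tsum_gaussTerm_contiguous {q : ℂ} (hq : ‖q‖ < 1) {b c u v : ℂ} (hC : ‖u ^ 2 * v‖ < 1)
    (h : ‖b * c * v‖ < 1) :
    (1 - b * c * v) * (1 - u ^ 2 * v) * ∑' m, gaussTerm b c u q v m =
      (1 - b * u * v) * (1 - c * u * v) * ∑' m, gaussTerm b c u q (v * q) m := by
  have hC' : ‖u ^ 2 * (v * q)‖ < 1 := by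
    rw [← mul_assoc, norm_mul]; nlinarith [norm_nonneg (u ^ 2 * v), norm_nonneg q]
  have h' : ‖b * c * (v * q)‖ < 1 := by
    rw [← mul_assoc, norm_mul]; nlinarith [norm_nonneg (b * c * v), norm_nonneg q]
  have s1 := summable_gaussTerm hq hC h
  have s2 := summable_gaussTerm hq hC' h'
  set H : ℕ → ℂ := fun m => revPoch b u q m * revPoch c u q m * v ^ m *
    ((qPoch q q m)⁻¹ * (qPoch (u ^ 2 * (v * q)) q m)⁻¹) * ((1 - q ^ m) * (1 - u ^ 2 * v * q ^ m))
    with hH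
  have hstep : ∀ m, (1 - b * c * v) * (1 - u ^ 2 * v) * gaussTerm b c u q v m -
      (1 - b * u * v) * (1 - c * u * v) * gaussTerm b c u q (v * q) m = H m - H (m + 1) := by
    intro m
    simp only [hH, gaussTerm]
    have n1 := qPoch_ne_zero_of_norm_lt hq hq (m + 1)
    have n2 := qPoch_ne_zero_of_norm_lt hq hC' (m + 1)
    have n3 := qPoch_ne_zero_of_norm_lt hq hC (m + 1)
    have n3' := n3
    have e : qPoch (u ^ 2 * v) q m * (1 - u ^ 2 * v * q ^ m) =
        (1 - u ^ 2 * v) * qPoch (u ^ 2 * (v * q)) q m := by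
      rw [← qPoch_succ, qPoch_succ', mul_assoc (u ^ 2)]
    rw [qPoch_succ] at n1 n2 n3
    rw [qPoch_succ'] at n3'
    have m1 := left_ne_zero_of_mul n1
    have m1' := right_ne_zero_of_mul n1
    have m2 := left_ne_zero_of_mul n2
    have m2' := right_ne_zero_of_mul n2
    have m3 := left_ne_zero_of_mul n3
    have m3' := left_ne_zero_of_mul n3'
    have m4 := right_ne_zero_of_mul n3
    have e2 : (qPoch (u ^ 2 * v) q m)⁻¹ = (1 - u ^ 2 * v * q ^ m) *
        ((1 - u ^ 2 * v)⁻¹ * (qPoch (u ^ 2 * (v * q)) q m)⁻¹) := by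
      rw [← mul_inv, ← e]
      field_simp
    rw [e2, revPoch_succ, revPoch_succ, qPoch_succ, qPoch_succ,
      show q * q ^ m = q ^ (m + 1) by ring, show u ^ 2 * (v * q) * q ^ m = u ^ 2 * v * q ^ (m + 1) by
        ring]
    rw [show q * q ^ m = q ^ (m + 1) by ring] at m1'
    rw [show u ^ 2 * (v * q) * q ^ m = u ^ 2 * v * q ^ (m + 1) by ring] at m2'
    rw [mul_inv, mul_inv, mul_pow, pow_succ v]
    have c1 : (1 - q ^ (m + 1))⁻¹ * (1 - q ^ (m + 1)) = 1 := inv_mul_cancel₀ m1'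
    have c2 : (1 - u ^ 2 * v * q ^ (m + 1))⁻¹ * (1 - u ^ 2 * v * q ^ (m + 1)) = 1 :=
      inv_mul_cancel₀ m2'
    have c3 : (1 - u ^ 2 * v) * (1 - u ^ 2 * v)⁻¹ = 1 := mul_inv_cancel₀ m3'
    set E := revPoch b u q m * revPoch c u q m * v ^ m *
      ((qPoch q q m)⁻¹ * (qPoch (u ^ 2 * (v * q)) q m)⁻¹)
    calc _ = E * ((1 - b * c * v) * (1 - u ^ 2 * v * q ^ m)
          * ((1 - u ^ 2 * v) * (1 - u ^ 2 * v)⁻¹)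
          - (1 - b * u * v) * (1 - c * u * v) * q ^ m) := by ring
      _ = E * ((1 - q ^ m) * (1 - u ^ 2 * v * q ^ m)
          - v * (b - u * q ^ m) * (c - u * q ^ m)
            * ((1 - q ^ (m + 1))⁻¹ * (1 - q ^ (m + 1)))
            * ((1 - u ^ 2 * v * q ^ (m + 1))⁻¹ * (1 - u ^ 2 * v * q ^ (m + 1)))) := by
          rw [c1, c2, c3]; ring
      _ = _ := by ring
  have hH0 : H 0 = 0 := by simp [hH]
  have hsum := (s1.mul_left ((1 - b * c * v) * (1 - u ^ 2 * v))).sub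
    (s2.mul_left ((1 - b * u * v) * (1 - c * u * v)))
  have hlim : Tendsto H atTop (𝓝 0) := by
    obtain ⟨K, hK0, hK⟩ := exists_norm_inv_qPoch_le hq hq
    obtain ⟨L, hL0, hL⟩ := exists_norm_inv_qPoch_le hq hC'
    have := ((summable_norm_revPoch_mul hq b c u v h).tendsto_atTop_zero).mul_const (K * L * (2 * 2))
    rw [zero_mul] at this
    refine squeeze_zero_norm (fun m => ?_) this
    have q1 : ‖q ^ m‖ ≤ 1 := by rw [norm_pow]; exact pow_le_one₀ (norm_nonneg _) hq.le
    have q2 : ‖u ^ 2 * v * q ^ m‖ ≤ 1 := by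
      rw [norm_mul]; exact mul_le_one₀ hC.le (norm_nonneg _) q1
    have q3 : ‖1 - q ^ m‖ ≤ 2 := (norm_sub_le _ _).trans (by rw [norm_one]; linarith)
    have q4 : ‖1 - u ^ 2 * v * q ^ m‖ ≤ 2 := (norm_sub_le _ _).trans (by rw [norm_one]; linarith)
    simp only [hH]
    rw [norm_mul, norm_mul _ (_ * _⁻¹), norm_mul (_⁻¹), norm_mul (1 - q ^ m), mul_assoc]
    gcongr
    exacts [hK m, hL m]
  have ht : Tendsto (fun n => ∑ m ∈ Finset.range n, (H m - H (m + 1))) atTop (𝓝 0) := by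
    simp_rw [Finset.sum_range_sub', hH0]
    simpa using hlim.neg
  have := tendsto_nhds_unique hsum.hasSum.tendsto_sum_nat (by simpa only [hstep] using ht)
  rw [Summable.tsum_sub (s1.mul_left _) (s2.mul_left _), tsum_mul_left, tsum_mul_left] at this
  linear_combination this

/-- The `q`-Gauss sum, obtained by iterating the contiguous relation. -/
theorem tsum_gaussTerm {q : ℂ} (hq : ‖q‖ < 1) {b c u v : ℂ} (hC : ‖u ^ 2 * v‖ < 1)
    (h : ‖b * c * v‖ < 1) :
    ∑' m, gaussTerm b c u q v m = qPochInf (b * u * v) q * qPochInf (c * u * v) q /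
      (qPochInf (u ^ 2 * v) q * qPochInf (b * c * v) q) := by
  have hpow : ∀ (x : ℂ) (N : ℕ), ‖x‖ < 1 → ‖x * q ^ N‖ < 1 := fun x N hx => by
    rw [norm_mul, norm_pow]
    have := pow_le_one₀ (n := N) (norm_nonneg q) hq.le
    nlinarith [norm_nonneg x, pow_nonneg (norm_nonneg q) N]
  have hiter : ∀ N : ℕ, qPoch (b * c * v) q N * qPoch (u ^ 2 * v) q N * ∑' m, gaussTerm b c u q v m
      = qPoch (b * u * v) q N * qPoch (c * u * v) q N *
        ∑' m, gaussTerm b c u q (v * q ^ N) m := by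
    intro N
    induction N with
    | zero => simp [qPoch]
    | succ N ih =>
      have := tsum_gaussTerm_contiguous hq (b := b) (c := c) (u := u) (v := v * q ^ N)
        (by rw [← mul_assoc]; exact hpow _ _ hC) (by rw [← mul_assoc]; exact hpow _ _ h)
      rw [mul_assoc v, ← pow_succ] at this
      simp_rw [qPoch_succ]
      linear_combination (1 - b * c * v * q ^ N) * (1 - u ^ 2 * v * q ^ N) * ih +
        qPoch (b * u * v) q N * qPoch (c * u * v) q N * this
  have hlim : Tendsto (fun N : ℕ => ∑' m, gaussTerm b c u q (v * q ^ N) m) atTop (𝓝 1) := by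
    obtain ⟨K, hK0, hK⟩ := exists_norm_inv_qPoch_le hq hq
    obtain ⟨L, hL0, hL⟩ := exists_norm_inv_qPoch_le hq hC
    obtain ⟨M, hM⟩ := exists_norm_qPoch_le hq (u ^ 2 * v)
    have hM0 : 0 ≤ M := (norm_nonneg _).trans (hM 0)
    set bd : ℕ → ℝ := fun m => ‖revPoch b u q m * revPoch c u q m * v ^ m‖ * (K * (M * L)) with hbd
    have hb : ∀ N m, ‖gaussTerm b c u q (v * q ^ N) m‖ ≤ bd m * (‖q‖ ^ N) ^ m := by
      intro N m
      have e : (qPoch (u ^ 2 * (v * q ^ N)) q m)⁻¹ =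
          qPoch (u ^ 2 * v) q N * (qPoch (u ^ 2 * v) q (N + m))⁻¹ := by
        rw [qPoch_add, ← mul_assoc (u ^ 2) v, mul_inv,
          mul_inv_cancel_left₀ (qPoch_ne_zero_of_norm_lt hq hC N)]
      rw [gaussTerm, e, mul_pow, ← mul_assoc (revPoch b u q m * revPoch c u q m)]
      simp only [hbd]
      rw [mul_right_comm, norm_mul, norm_mul _ ((_)⁻¹ * _), norm_mul (_)⁻¹, norm_mul (qPoch _ _ N),
        norm_pow, norm_pow]
      gcongr
      exacts [hK m, hM N, hL _]
    have hs : Summable bd := (summable_norm_revPoch_mul hq b c u v h).mul_right _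
    have := tendsto_tsum_of_dominated_convergence (𝓕 := atTop) (bound := bd)
      (f := fun N m => gaussTerm b c u q (v * q ^ N) m) (g := fun m => if m = 0 then 1 else 0) hs ?_ ?_
    · simpa using this
    · intro m
      rcases Nat.eq_zero_or_pos m with rfl | hm
      · simp [gaussTerm, revPoch, qPoch]
      · rw [if_neg hm.ne']
        have h0 : Tendsto (fun N : ℕ => bd m * (‖q‖ ^ N) ^ m) atTop (𝓝 (bd m * 0 ^ m)) :=
          ((tendsto_pow_atTop_nhds_zero_of_lt_one (norm_nonneg q) hq).pow m).const_mul _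
        rw [zero_pow hm.ne', mul_zero] at h0
        exact squeeze_zero_norm (fun N => hb N m) h0
    · refine Eventually.of_forall fun N m => (hb N m).trans ?_
      have : (‖q‖ ^ N) ^ m ≤ 1 := pow_le_one₀ (by positivity) (pow_le_one₀ (norm_nonneg _) hq.le)
      have h0 : 0 ≤ bd m := by simp only [hbd]; positivity
      nlinarith
  have l1 := ((tendsto_qPoch hq (b * c * v)).mul (tendsto_qPoch hq (u ^ 2 * v))).mul_const
    (∑' m, gaussTerm b c u q v m)
  have l2 := ((tendsto_qPoch hq (b * u * v)).mul (tendsto_qPoch hq (c * u * v))).mul hlim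
  simp_rw [hiter] at l1
  have := tendsto_nhds_unique l1 l2
  rw [eq_div_iff (mul_ne_zero (qPochInf_ne_zero_of_norm_lt hq hC)
    (qPochInf_ne_zero_of_norm_lt hq h))]
  linear_combination this

/-- Bailey's lemma relative to `q` in base `q`, for summable `α`. -/
theorem bailey_lemma {q : ℂ} (hq : ‖q‖ < 1) {b c : ℂ} (h : ‖b * c * q ^ 2‖ < 1)
    {α β : ℕ → ℂ} (hα : Summable fun r => ‖α r‖)
    (hβ : ∀ n : ℕ, β n = ∑ r ∈ Finset.range (n + 1),
      α r * (invPoch q (n - r) * invPoch q (n + r + 1))) :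
    HasSum (fun n => revPoch b 1 q n * revPoch c 1 q n * (q ^ 2) ^ n * β n)
      (∑' r, α r * (revPoch b 1 q r * revPoch c 1 q r * (q ^ 2) ^ r *
        (qPochInf (b * q ^ (r + 2)) q * qPochInf (c * q ^ (r + 2)) q /
          (qPochInf q q * qPochInf (b * c * q ^ 2) q)))) ∧
    Summable (fun r => α r * (revPoch b 1 q r * revPoch c 1 q r * (q ^ 2) ^ r *
        (qPochInf (b * q ^ (r + 2)) q * qPochInf (c * q ^ (r + 2)) q /
          (qPochInf q q * qPochInf (b * c * q ^ 2) q)))) := by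
  set a : ℕ → ℂ := fun n => revPoch b 1 q n * revPoch c 1 q n * (q ^ 2) ^ n with ha
  obtain ⟨K, hK0, hK⟩ := exists_norm_inv_qPoch_le hq hq
  have hip : ∀ m, ‖invPoch q m‖ ≤ K := by
    intro m
    rcases lt_or_ge m 0 with hm | hm
    · rw [invPoch_of_neg _ hm, norm_zero]; exact hK0
    · lift m to ℕ using hm
      rw [invPoch_natCast]; exact hK m
  set F : ℕ × ℕ → ℂ := fun p => a p.1 * α p.2 *
    (invPoch q (p.1 - p.2) * invPoch q (p.1 + p.2 + 1)) with hF
  have hFs : Summable F := by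
    refine Summable.of_norm_bounded (((summable_norm_revPoch_mul hq b c 1 (q ^ 2) h).mul_of_nonneg hα
      (fun _ => norm_nonneg _) (fun _ => norm_nonneg _)).mul_right (K * K)) ?_
    rintro ⟨n, r⟩
    simp only [hF]
    rw [norm_mul, norm_mul, norm_mul (invPoch _ _)]
    gcongr
    exacts [hip _, hip _]
  have h1 : ∀ n, ∑' r, F (n, r) = a n * β n := by
    intro n
    rw [tsum_eq_sum (s := Finset.range (n + 1)), hβ, Finset.mul_sum]
    · refine Finset.sum_congr rfl fun r _ => ?_
      simp only [hF]; ring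
    · intro r hr
      rw [Finset.mem_range, not_lt] at hr
      simp only [hF]
      rw [invPoch_of_neg _ (show (n : ℤ) - r < 0 by omega)]; ring
  have h2 : ∀ r, ∑' n, F (n, r) = α r * (a r *
        (qPochInf (b * q ^ (r + 2)) q * qPochInf (c * q ^ (r + 2)) q /
          (qPochInf q q * qPochInf (b * c * q ^ 2) q))) := by
    intro r
    have hs : Summable fun n => F (n, r) := (hFs.comp_injective Prod.swap_injective).prod_factor r
    rw [← hs.sum_add_tsum_nat_add r, Finset.sum_eq_zero, zero_add]
    · have hC : ‖(q ^ r) ^ 2 * q ^ 2‖ < 1 := by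
        rw [← pow_mul, ← pow_add, norm_pow]; exact pow_lt_one₀ (norm_nonneg _) hq (by omega)
      have hg := tsum_gaussTerm hq (b := b) (c := c) (u := q ^ r) (v := q ^ 2) hC h
      have ht : ∀ m, F (m + r, r) = α r * a r * (qPoch q q (2 * r + 1))⁻¹ *
          gaussTerm b c (q ^ r) q (q ^ 2) m := by
        intro m
        simp only [hF, ha, gaussTerm]
        rw [add_comm m r, revPoch_add, revPoch_add,
          show (((r + m : ℕ) : ℤ) - (r : ℤ)) = (m : ℕ) by push_cast; ring,
          show (((r + m : ℕ) : ℤ) + (r : ℤ) + 1) = ((2 * r + 1 + m : ℕ) : ℤ) by push_cast; ring,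
          invPoch_natCast, invPoch_natCast, qPoch_add q q (2 * r + 1),
          show q * q ^ (2 * r + 1) = (q ^ r) ^ 2 * q ^ 2 by ring, mul_inv, pow_add (q ^ 2)]
        ring
      simp_rw [ht]
      rw [tsum_mul_left, hg, show b * q ^ r * q ^ 2 = b * q ^ (r + 2) by ring,
        show c * q ^ r * q ^ 2 = c * q ^ (r + 2) by ring]
      have e := qPoch_mul_qPochInf hq q (2 * r + 1)
      rw [show q * q ^ (2 * r + 1) = (q ^ r) ^ 2 * q ^ 2 by ring] at e
      rw [← e]
      have n1 := qPoch_ne_zero_of_norm_lt hq hq (2 * r + 1)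
      have n2 := qPochInf_ne_zero_of_norm_lt hq hC
      have n3 := qPochInf_ne_zero_of_norm_lt hq h
      field_simp
    · intro n hn
      rw [Finset.mem_range] at hn
      simp only [hF]
      rw [invPoch_of_neg _ (show (n : ℤ) - r < 0 by omega)]; ring
  constructor
  · have := hFs.prod.hasSum
    simp_rw [h1] at this
    have hval := hFs.tsum_comm' (fun n => hFs.prod_factor n)
      (fun r => (hFs.comp_injective Prod.swap_injective).prod_factor r)
    simp_rw [h1, h2] at hval
    rwa [← hval] at this
  · have := (hFs.comp_injective Prod.swap_injective).prod
    refine this.congr fun r => ?_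
    rw [← h2 r]
    rfl

/-! ### Hecke-type series -/

lemma norm_pow_lt_one {q : ℂ} (hq : ‖q‖ < 1) {m : ℕ} (hm : m ≠ 0) : ‖q ^ m‖ < 1 := by
  rw [norm_pow]; exact pow_lt_one₀ (norm_nonneg _) hq hm

lemma sum_zpow_sub_sub {q : ℂ} (h0 : q ≠ 0) (s : Finset ℤ) (a : ℤ) :
    ∑ j ∈ s, q ^ (a - 2 * j ^ 2 - j) = q ^ a * ∑ j ∈ s, q ^ (-2 * j ^ 2 - j) := by
  rw [Finset.mul_sum]
  refine Finset.sum_congr rfl fun j _ => ?_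
  rw [← zpow_add₀ h0]; congr 1; ring

lemma summable_norm_baileyAlpha {q : ℂ} (hq : ‖q‖ < 1) (h0 : q ≠ 0) :
    Summable fun r => ‖baileyAlpha q r‖ := by
  have hs : Summable fun r : ℕ => 2 * ((2 * r + 1) * ‖q‖ ^ r) := by
    have h1 := summable_pow_mul_geometric_of_norm_lt_one 1 (r := ‖q‖) (by simpa using hq)
    have h2 := summable_geometric_of_lt_one (norm_nonneg q) hq
    refine (((h1.mul_left 2).add h2).mul_left 2).congr fun r => ?_
    ring
  refine Summable.of_nonneg_of_le (fun _ => norm_nonneg _) (fun r => ?_) hs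
  have hqp : 0 < ‖q‖ := norm_pos_iff.2 h0
  have e : baileyAlpha q r = (1 + q ^ (2 * r + 1)) * ((-1) ^ r *
      ∑ j ∈ Finset.Icc (-(r : ℤ)) r, q ^ (3 * (r : ℤ) ^ 2 + 2 * r - 2 * j ^ 2 - j)) := by
    rw [sum_zpow_sub_sub h0, baileyAlpha]; ring
  rw [e, norm_mul, norm_mul, norm_pow, norm_neg, norm_one, one_pow, one_mul]
  have h1 : ‖1 + q ^ (2 * r + 1)‖ ≤ 2 :=
    (norm_add_le _ _).trans (by
      rw [norm_one]; linarith [(norm_pow_lt_one hq (Nat.succ_ne_zero (2 * r))).le])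
  have h2 : ‖∑ j ∈ Finset.Icc (-(r : ℤ)) r, q ^ (3 * (r : ℤ) ^ 2 + 2 * r - 2 * j ^ 2 - j)‖ ≤
      (2 * r + 1) * ‖q‖ ^ r := by
    refine (norm_sum_le_of_le (f := fun j : ℤ => q ^ (3 * (r : ℤ) ^ 2 + 2 * r - 2 * j ^ 2 - j))
      (n := fun _ => ‖q‖ ^ r) _ fun j hj => ?_).trans ?_
    · rw [Finset.mem_Icc] at hj
      rw [norm_zpow, ← zpow_natCast]
      refine zpow_le_zpow_right_of_le_one₀ hqp hq.le ?_
      nlinarith [mul_nonneg (sub_nonneg.2 hj.2) (show 0 ≤ j + r by linarith [hj.1])]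
    · rw [Finset.sum_const, Int.card_Icc, nsmul_eq_mul]
      gcongr
      rw [show ((r : ℤ) + 1 - -(r : ℤ)).toNat = 2 * r + 1 by omega]
      push_cast; exact le_rfl
  gcongr

lemma revPoch_zero_left (q : ℂ) (n : ℕ) :
    revPoch 0 1 q n = (-1) ^ n * ∏ k ∈ Finset.range n, q ^ k := by
  rw [revPoch, ← Finset.card_range n, ← Finset.prod_const, Finset.card_range,
    ← Finset.prod_mul_distrib]
  exact Finset.prod_congr rfl fun k _ => by ring

lemma prod_range_sq_pow (q : ℂ) (n : ℕ) :
    (∏ k ∈ Finset.range n, (q ^ 2) ^ k) * q ^ n = q ^ (n * n) := by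
  induction n with
  | zero => simp
  | succ n ih =>
    rw [Finset.prod_range_succ]
    linear_combination (q ^ 2) ^ n * q * ih

lemma revPoch_inv {ρ : ℂ} (hρ : ρ ≠ 0) (q : ℂ) (n : ℕ) :
    revPoch ρ⁻¹ 1 q n = ρ⁻¹ ^ n * qPoch ρ q n := by
  rw [revPoch, qPoch]
  conv_rhs => rw [← Finset.card_range n, ← Finset.prod_const, Finset.card_range,
    ← Finset.prod_mul_distrib]
  exact Finset.prod_congr rfl fun k _ => by field_simp

/-- Bailey's lemma for the pair of `sum_baileyAlpha`, with the terms renormalised by constants. -/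
lemma hasSum_of_bailey {q : ℂ} (hq : ‖q‖ < 1) (h0 : q ≠ 0) {b c : ℂ}
    (h : ‖b * c * (q ^ 2) ^ 2‖ < 1) {f w : ℕ → ℂ} {κ lam : ℂ} (hκ : κ ≠ 0)
    (hf : ∀ n, f n = lam * (revPoch b 1 (q ^ 2) n * revPoch c 1 (q ^ 2) n * ((q ^ 2) ^ 2) ^ n *
      (qPoch q (q ^ 2) (n + 1))⁻¹))
    (hw : ∀ r, lam * (baileyAlpha q r *
      (revPoch b 1 (q ^ 2) r * revPoch c 1 (q ^ 2) r * ((q ^ 2) ^ 2) ^ r *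
        (qPochInf (b * (q ^ 2) ^ (r + 2)) (q ^ 2) * qPochInf (c * (q ^ 2) ^ (r + 2)) (q ^ 2) /
          (qPochInf (q ^ 2) (q ^ 2) * qPochInf (b * c * (q ^ 2) ^ 2) (q ^ 2))))) = κ * w r) :
    Summable f ∧ ∃ S, HasSum w S ∧ ∑' n, f n = κ * S := by
  obtain ⟨h1, h2⟩ := bailey_lemma (norm_pow_lt_one hq two_ne_zero) h
    (summable_norm_baileyAlpha hq h0) (fun n => (sum_baileyAlpha hq h0 n).symm)
  replace h1 := h1.mul_left lam
  replace h2 := h2.mul_left lam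
  have hfe : (fun n => lam * (revPoch b 1 (q ^ 2) n * revPoch c 1 (q ^ 2) n * ((q ^ 2) ^ 2) ^ n *
      (qPoch q (q ^ 2) (n + 1))⁻¹)) = f := (funext hf).symm
  rw [hfe] at h1
  simp_rw [hw] at h2
  rw [← tsum_mul_left] at h1
  simp_rw [hw] at h1
  have h3 : Summable w := (summable_mul_left_iff hκ).1 h2
  exact ⟨h1.summable, _, h3.hasSum, by rw [h1.tsum_eq, tsum_mul_left]⟩

/-- The exponents `j(j+1)/2`, `0 ≤ j ≤ 2n`, are the exponents `2j² + j`, `|j| ≤ n`. -/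
lemma sum_Icc_binom2 (q : ℂ) (a : ℤ) (n : ℕ) :
    ∑ j ∈ Finset.Icc (0 : ℤ) (2 * n), q ^ (a - binom2 (j + 1)) =
      ∑ j ∈ Finset.Icc (-(n : ℤ)) n, q ^ (a - 2 * j ^ 2 - j) := by
  have hb : ∀ j : ℤ, binom2 (2 * j + 1) = 2 * j ^ 2 + j := fun j => by
    rw [binom2]; exact Int.ediv_eq_of_eq_mul_left two_ne_zero (by ring)
  have hb' : ∀ j : ℤ, binom2 (2 * j + 2) = 2 * j ^ 2 + 3 * j + 1 := fun j => by
    rw [binom2]; exact Int.ediv_eq_of_eq_mul_left two_ne_zero (by ring)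
  induction n with
  | zero => simp [binom2]
  | succ n ih =>
    rw [sum_Icc_neg_succ, ← ih]
    have e : Finset.Icc (0 : ℤ) (2 * ((n + 1 : ℕ) : ℤ)) =
        insert (2 * (n : ℤ) + 2) (insert (2 * (n : ℤ) + 1) (Finset.Icc (0 : ℤ) (2 * n))) := by
      ext j; simp only [Finset.mem_insert, Finset.mem_Icc]; omega
    rw [e, Finset.sum_insert (by simp), Finset.sum_insert (by simp),
      show (2 * (n : ℤ) + 2 + 1) = 2 * ((n : ℤ) + 1) + 1 by ring, hb,
      show (2 * (n : ℤ) + 1 + 1) = 2 * (n : ℤ) + 2 by ring, hb',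
      show a - 2 * ((n : ℤ) + 1) ^ 2 - ((n : ℤ) + 1) = a - (2 * ((n : ℤ) + 1) ^ 2 + ((n : ℤ) + 1)) by
        ring,
      show a - 2 * (-((n : ℤ) + 1)) ^ 2 - -((n : ℤ) + 1) = a - (2 * (n : ℤ) ^ 2 + 3 * n + 1) by ring]
    ring

/-- The case `ρ₁ = ρ₂ = ∞` of Bailey's lemma. -/
lemma F1_hecke_of_ne {q : ℂ} (hq : ‖q‖ < 1) (h0 : q ≠ 0) :
    Summable (F1Term q) ∧ ∃ S : ℂ,
      HasSum (fun n : ℕ => ∑ j ∈ Finset.Icc (0 : ℤ) (2 * n),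
        (-1 : ℂ) ^ n * q ^ (5 * (n : ℤ) ^ 2 + 4 * n - binom2 (j + 1)) * (1 + q ^ (2 * n + 1))) S ∧
      ∑' n, F1Term q n = 1 / qPochInf (q ^ 2) (q ^ 2) * S := by
  have hQ := norm_pow_lt_one hq two_ne_zero
  have hR : ∀ n : ℕ, revPoch 0 1 (q ^ 2) n * revPoch 0 1 (q ^ 2) n * ((q ^ 2) ^ 2) ^ n =
      q ^ (2 * n * (n + 1)) := by
    intro n
    rw [revPoch_zero_left]
    have h1 := prod_range_sq_pow q n
    have h2 : ((-1 : ℂ) ^ n) ^ 2 = 1 := by rw [← pow_mul, mul_comm, pow_mul]; norm_num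
    calc _ = ((-1 : ℂ) ^ n) ^ 2 * ((∏ k ∈ Finset.range n, (q ^ 2) ^ k) * q ^ n) ^ 2 *
          q ^ (2 * n) := by ring
      _ = _ := by rw [h1, h2]; ring
  refine hasSum_of_bailey hq h0 (b := 0) (c := 0) (lam := 1) (by simp)
    (one_div_ne_zero (qPochInf_ne_zero_of_norm_lt hQ hQ)) (fun n => ?_) (fun r => ?_)
  · rw [hR, F1Term, div_eq_mul_inv, one_mul]
  · rw [hR]
    simp only [zero_mul, qPochInf_zero_left, mul_one]
    rw [← Finset.sum_mul, ← Finset.mul_sum, sum_Icc_binom2, sum_zpow_sub_sub h0, baileyAlpha,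
      show (5 * (r : ℤ) ^ 2 + 4 * r) = 3 * (r : ℤ) ^ 2 + 2 * r + (2 * r * (r + 1) : ℕ) by
        push_cast; ring, zpow_add₀ h0 _ ((2 * r * (r + 1) : ℕ) : ℤ), zpow_natCast]
    ring

/-- The case `ρ₁ = q²`, `ρ₂ = ∞` of Bailey's lemma. -/
lemma alt_hecke_of_ne {q : ℂ} (hq : ‖q‖ < 1) (h0 : q ≠ 0) :
    Summable (altTerm q) ∧
    HasSum (fun n : ℕ => ∑ j ∈ Finset.Icc (-(n : ℤ)) n,
        (1 + q ^ (2 * n + 1)) * q ^ (4 * (n : ℤ) ^ 2 + 3 * n - 2 * j ^ 2 - j))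
      (∑' n : ℕ, altTerm q n) := by
  have hQ := norm_pow_lt_one hq two_ne_zero
  have hQ0 : q ^ 2 ≠ 0 := pow_ne_zero 2 h0
  have hR : ∀ n : ℕ, revPoch (q ^ 2)⁻¹ 1 (q ^ 2) n * revPoch 0 1 (q ^ 2) n * ((q ^ 2) ^ 2) ^ n =
      (-1) ^ n * qPoch (q ^ 2) (q ^ 2) n * q ^ (n * (n + 1)) := by
    intro n
    rw [revPoch_zero_left, revPoch_inv hQ0]
    have h1 := prod_range_sq_pow q n
    have h2 : (q ^ 2)⁻¹ ^ n * (q ^ n) ^ 2 = 1 := by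
      rw [← pow_mul, mul_comm n, pow_mul, ← mul_pow, inv_mul_cancel₀ hQ0, one_pow]
    calc _ = (-1) ^ n * qPoch (q ^ 2) (q ^ 2) n * ((∏ k ∈ Finset.range n, (q ^ 2) ^ k) * q ^ n) *
          ((q ^ 2)⁻¹ ^ n * (q ^ n) ^ 2) * q ^ n := by ring
      _ = _ := by rw [h1, h2]; ring
  suffices key : Summable (altTerm q) ∧ ∃ S, HasSum (fun n : ℕ => ∑ j ∈ Finset.Icc (-(n : ℤ)) n,
      (1 + q ^ (2 * n + 1)) * q ^ (4 * (n : ℤ) ^ 2 + 3 * n - 2 * j ^ 2 - j)) S ∧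
      ∑' n, altTerm q n = 1 * S by
    obtain ⟨h1, S, h2, h3⟩ := key
    rw [h3, one_mul]
    exact ⟨h1, h2⟩
  refine hasSum_of_bailey hq h0 (b := (q ^ 2)⁻¹) (c := 0) (lam := 1) (κ := 1)
    (by simp) one_ne_zero (fun n => ?_) (fun r => ?_)
  · rw [hR, altTerm, div_eq_mul_inv, one_mul]; ring
  · have e := qPoch_mul_qPochInf hQ (q ^ 2) r
    have n1 := qPochInf_ne_zero_of_norm_lt hQ hQ
    rw [hR, show (q ^ 2)⁻¹ * (q ^ 2) ^ (r + 2) = q ^ 2 * (q ^ 2) ^ r by field_simp; ring]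
    simp only [zero_mul, mul_zero, qPochInf_zero_left, mul_one, one_mul]
    rw [← Finset.mul_sum, sum_zpow_sub_sub h0, baileyAlpha,
      show (4 * (r : ℤ) ^ 2 + 3 * r) = 3 * (r : ℤ) ^ 2 + 2 * r + (r * (r + 1) : ℕ) by
        push_cast; ring, zpow_add₀ h0 _ ((r * (r + 1) : ℕ) : ℤ), zpow_natCast]
    have h2 : ((-1 : ℂ) ^ r) ^ 2 = 1 := by rw [← pow_mul, mul_comm, pow_mul]; norm_num
    rw [mul_div_assoc', mul_div_assoc', div_eq_iff n1]
    rw [← e]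
    linear_combination (q ^ (3 * (r : ℤ) ^ 2 + 2 * r) * (1 + q ^ (2 * r + 1)) *
      (∑ j ∈ Finset.Icc (-(r : ℤ)) r, q ^ (-2 * j ^ 2 - j)) * qPoch (q ^ 2) (q ^ 2) r *
      q ^ (r * (r + 1)) * qPochInf (q ^ 2 * (q ^ 2) ^ r) (q ^ 2)) * h2

/-- The case `ρ₁ = -q²`, `ρ₂ = ∞` of Bailey's lemma. -/
lemma T1Neg_hecke_of_ne {q : ℂ} (hq : ‖q‖ < 1) (h0 : q ≠ 0) :
    Summable (T1NegTerm q) ∧ ∃ S : ℂ,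
      HasSum (fun n : ℕ => (1 + q ^ (2 * n + 1)) * (-1) ^ n *
        ∑ j ∈ Finset.Icc (-(n : ℤ)) n, q ^ (4 * (n : ℤ) ^ 2 + 3 * n - 2 * j ^ 2 - j)) S ∧
      ∑' n : ℕ, T1NegTerm q n =
        qPochInf (-q ^ 2) (q ^ 2) / qPochInf (q ^ 2) (q ^ 2) * S := by
  have hQ := norm_pow_lt_one hq two_ne_zero
  have hQ' : ‖-q ^ 2‖ < 1 := by rwa [norm_neg]
  have hQ0 : -q ^ 2 ≠ 0 := neg_ne_zero.2 (pow_ne_zero 2 h0)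
  have hR : ∀ n : ℕ, revPoch (-q ^ 2)⁻¹ 1 (q ^ 2) n * revPoch 0 1 (q ^ 2) n * ((q ^ 2) ^ 2) ^ n =
      qPoch (-q ^ 2) (q ^ 2) n * q ^ (n * (n + 1)) := by
    intro n
    rw [revPoch_zero_left, revPoch_inv hQ0]
    have h1 := prod_range_sq_pow q n
    have h2 : (-q ^ 2)⁻¹ ^ n * (-1) ^ n * (q ^ n) ^ 2 = 1 := by
      rw [← pow_mul, mul_comm n, pow_mul, ← mul_pow, ← mul_pow, mul_assoc, neg_one_mul,
        inv_mul_cancel₀ hQ0, one_pow]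
    calc _ = qPoch (-q ^ 2) (q ^ 2) n * ((∏ k ∈ Finset.range n, (q ^ 2) ^ k) * q ^ n) *
          ((-q ^ 2)⁻¹ ^ n * (-1) ^ n * (q ^ n) ^ 2) * q ^ n := by ring
      _ = _ := by rw [h1, h2]; ring
  refine hasSum_of_bailey hq h0 (b := (-q ^ 2)⁻¹) (c := 0) (lam := 1) (by simp)
    (div_ne_zero (qPochInf_ne_zero_of_norm_lt hQ hQ') (qPochInf_ne_zero_of_norm_lt hQ hQ))
    (fun n => ?_) (fun r => ?_)
  · rw [hR, T1NegTerm, div_eq_mul_inv, one_mul]; ring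
  · have e := qPoch_mul_qPochInf hQ (-q ^ 2) r
    have n1 := qPochInf_ne_zero_of_norm_lt hQ hQ
    rw [hR, show (-q ^ 2)⁻¹ * (q ^ 2) ^ (r + 2) = -q ^ 2 * (q ^ 2) ^ r by
      field_simp; ring]
    simp only [zero_mul, mul_zero, qPochInf_zero_left, mul_one, one_mul]
    rw [sum_zpow_sub_sub h0, baileyAlpha,
      show (4 * (r : ℤ) ^ 2 + 3 * r) = 3 * (r : ℤ) ^ 2 + 2 * r + (r * (r + 1) : ℕ) by
        push_cast; ring, zpow_add₀ h0 _ ((r * (r + 1) : ℕ) : ℤ), zpow_natCast, ← e]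
    ring

/-- The case `ρ₁ = -q`, `ρ₂ = ∞` of Bailey's lemma. -/
lemma V1_hecke_of_ne {q : ℂ} (hq : ‖q‖ < 1) (h0 : q ≠ 0) :
    Summable (V1Term q) ∧ ∃ S : ℂ,
      HasSum (fun n : ℕ => (-1) ^ n *
        ∑ j ∈ Finset.Icc (-(n : ℤ)) n, q ^ (4 * (n : ℤ) ^ 2 + 4 * n - 2 * j ^ 2 - j)) S ∧
      ∑' n, V1Term q n = q * (qPochInf (-q) (q ^ 2) / qPochInf (q ^ 2) (q ^ 2)) * S := by
  have hQ := norm_pow_lt_one hq two_ne_zero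
  have hq' : ‖-q‖ < 1 := by rwa [norm_neg]
  have hn : -q ≠ 0 := neg_ne_zero.2 h0
  have hR : ∀ n : ℕ, revPoch (-q)⁻¹ 1 (q ^ 2) n * revPoch 0 1 (q ^ 2) n * ((q ^ 2) ^ 2) ^ n =
      qPoch (-q) (q ^ 2) n * q ^ (n * (n + 2)) := by
    intro n
    rw [revPoch_zero_left, revPoch_inv hn]
    have h1 := prod_range_sq_pow q n
    have h2 : (-q)⁻¹ ^ n * (-1) ^ n * q ^ n = 1 := by
      rw [← mul_pow, ← mul_pow, mul_assoc, neg_one_mul, inv_mul_cancel₀ hn, one_pow]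
    calc _ = qPoch (-q) (q ^ 2) n * ((∏ k ∈ Finset.range n, (q ^ 2) ^ k) * q ^ n) *
          ((-q)⁻¹ ^ n * (-1) ^ n * q ^ n) * (q ^ n) ^ 2 := by ring
      _ = _ := by rw [h1, h2]; ring
  refine hasSum_of_bailey hq h0 (b := (-q)⁻¹) (c := 0) (lam := q) (by simp)
    (mul_ne_zero h0 (div_ne_zero (qPochInf_ne_zero_of_norm_lt hQ hq')
      (qPochInf_ne_zero_of_norm_lt hQ hQ))) (fun n => ?_) (fun r => ?_)
  · rw [hR, V1Term, div_eq_mul_inv]; ring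
  · have e := qPoch_mul_qPochInf hQ (-q) (r + 1)
    have n1 := qPochInf_ne_zero_of_norm_lt hQ hQ
    rw [hR, show (-q)⁻¹ * (q ^ 2) ^ (r + 2) = -q * (q ^ 2) ^ (r + 1) by
      field_simp; ring]
    simp only [zero_mul, mul_zero, qPochInf_zero_left, mul_one]
    rw [sum_zpow_sub_sub h0, baileyAlpha,
      show (4 * (r : ℤ) ^ 2 + 4 * r) = 3 * (r : ℤ) ^ 2 + 2 * r + (r * (r + 2) : ℕ) by
        push_cast; ring, zpow_add₀ h0 _ ((r * (r + 2) : ℕ) : ℤ), zpow_natCast, ← e, qPoch_succ]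
    ring

/-- The case `ρ₁ = -q`, `ρ₂ = -q²` of Bailey's lemma. -/
lemma psiMinus_hecke_of_ne {q : ℂ} (hq : ‖q‖ < 1) (h0 : q ≠ 0) :
    Summable (psiMinusTerm q) ∧ ∃ S : ℂ,
      HasSum (fun n : ℕ => (-1) ^ n *
        ∑ j ∈ Finset.Icc (-(n : ℤ)) n, q ^ (3 * (n : ℤ) ^ 2 + 3 * n - 2 * j ^ 2 - j)) S ∧
      ∑' n, psiMinusTerm q n = q * (qPochInf (-q) q / qPochInf q q) * S := by
  have hQ := norm_pow_lt_one hq two_ne_zero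
  have hq' : ‖-q‖ < 1 := by rwa [norm_neg]
  have hn : -q ≠ 0 := neg_ne_zero.2 h0
  have hQ0 : -q ^ 2 ≠ 0 := neg_ne_zero.2 (pow_ne_zero 2 h0)
  have hdis : ∀ x : ℂ, qPochInf x q = qPochInf x (q ^ 2) * qPochInf (x * q) (q ^ 2) := fun x => by
    rw [qPochInf_dissect hq x two_ne_zero]; simp [Finset.prod_range_succ]
  have h2n : ∀ n, qPoch (-q) q (2 * n) = qPoch (-q) (q ^ 2) n * qPoch (-q ^ 2) (q ^ 2) n := by
    intro n
    induction n with
    | zero => simp [qPoch]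
    | succ n ih =>
      rw [mul_add, mul_one, qPoch_succ, qPoch_succ _ q, ih, qPoch_succ, qPoch_succ]; ring
  have hR : ∀ n : ℕ, revPoch (-q)⁻¹ 1 (q ^ 2) n * revPoch (-q ^ 2)⁻¹ 1 (q ^ 2) n *
      ((q ^ 2) ^ 2) ^ n = qPoch (-q) (q ^ 2) n * qPoch (-q ^ 2) (q ^ 2) n * q ^ n := by
    intro n
    rw [revPoch_inv hQ0, revPoch_inv hn]
    have h2 : (-q)⁻¹ ^ n * (-q ^ 2)⁻¹ ^ n * ((q ^ 2) ^ 2) ^ n = q ^ n := by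
      rw [← mul_pow, ← mul_pow]; congr 1; field_simp
    linear_combination qPoch (-q) (q ^ 2) n * qPoch (-q ^ 2) (q ^ 2) n * h2
  have hbc : (-q)⁻¹ * (-q ^ 2)⁻¹ * (q ^ 2) ^ 2 = q := by field_simp
  refine hasSum_of_bailey hq h0 (b := (-q)⁻¹) (c := (-q ^ 2)⁻¹) (lam := q) (by rwa [hbc])
    (mul_ne_zero h0 (div_ne_zero (qPochInf_ne_zero_of_norm_lt hq hq')
      (qPochInf_ne_zero_of_norm_lt hq hq))) (fun n => ?_) (fun r => ?_)
  · rw [hR, psiMinusTerm, div_eq_mul_inv, h2n]; ring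
  · have e := qPoch_mul_qPochInf hQ (-q) (r + 1)
    have e2 := qPoch_mul_qPochInf hQ (-q ^ 2) r
    rw [hR, hbc, show (-q)⁻¹ * (q ^ 2) ^ (r + 2) = -q * (q ^ 2) ^ (r + 1) by
      field_simp; ring, show (-q ^ 2)⁻¹ * (q ^ 2) ^ (r + 2) = -q ^ 2 * (q ^ 2) ^ r by
      field_simp; ring, hdis q, hdis (-q), show -q * q = -q ^ 2 by ring, ← sq, ← e, ← e2,
      sum_zpow_sub_sub h0, baileyAlpha,
      show (3 * (r : ℤ) ^ 2 + 3 * r) = 3 * (r : ℤ) ^ 2 + 2 * r + (r : ℕ) by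
        ring, zpow_add₀ h0 _ (r : ℤ), zpow_natCast, qPoch_succ]
    ring

/-- At `q = 0` only the constant term of a Hecke-type series survives: `0 ^ e = 0` for `e ≠ 0`, of
either sign. -/
lemma hasSum_zero_of_zpow {c : ℕ → ℂ} (hc : c 0 = 1) {e : ℕ → ℤ → ℤ} (he0 : e 0 0 = 0)
    (he : ∀ (n : ℕ) (j : ℤ), n ≠ 0 → -(n : ℤ) ≤ j → j ≤ n → e n j ≠ 0) :
    HasSum (fun n : ℕ => c n * ∑ j ∈ Finset.Icc (-(n : ℤ)) n, (0 : ℂ) ^ e n j) 1 := by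
  convert hasSum_single (f := fun n : ℕ => c n * ∑ j ∈ Finset.Icc (-(n : ℤ)) n, (0 : ℂ) ^ e n j)
    0 (fun n hn => ?_) using 1
  · simp [hc, he0]
  · rw [Finset.sum_eq_zero, mul_zero]
    intro j hj
    rw [Finset.mem_Icc] at hj
    exact zero_zpow _ (he n j hn hj.1 hj.2)

lemma summable_of_forall_ne_zero {f : ℕ → ℂ} (h : ∀ n ≠ 0, f n = 0) : Summable f :=
  (hasSum_single 0 h).summable

lemma tsum_of_forall_ne_zero {f : ℕ → ℂ} (h : ∀ n ≠ 0, f n = 0) : ∑' n, f n = f 0 :=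
  (hasSum_single 0 h).tsum_eq

lemma hecke_exponent_ne_zero {a b : ℤ} (ha : 3 ≤ a) (hb : 3 ≤ b) (n : ℕ) (j : ℤ) (hn : n ≠ 0)
    (h1 : -(n : ℤ) ≤ j) (h2 : j ≤ n) : a * (n : ℤ) ^ 2 + b * n - 2 * j ^ 2 - j ≠ 0 := by
  have h3 : (1 : ℤ) ≤ n := by omega
  have h4 := mul_nonneg (sub_nonneg.2 h2) (show 0 ≤ j + n by linarith)
  have : 0 < a * (n : ℤ) ^ 2 + b * n - 2 * j ^ 2 - j := by
    nlinarith [mul_nonneg (sub_nonneg.2 ha) (sq_nonneg (n : ℤ)),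
      mul_nonneg (sub_nonneg.2 hb) (show (0 : ℤ) ≤ n by omega)]
  exact this.ne'

lemma F1_hecke {q : ℂ} (hq : ‖q‖ < 1) : Summable (F1Term q) ∧ ∃ S : ℂ,
      HasSum (fun n : ℕ => ∑ j ∈ Finset.Icc (0 : ℤ) (2 * n),
        (-1 : ℂ) ^ n * q ^ (5 * (n : ℤ) ^ 2 + 4 * n - binom2 (j + 1)) * (1 + q ^ (2 * n + 1))) S ∧
      ∑' n, F1Term q n = 1 / qPochInf (q ^ 2) (q ^ 2) * S := by
  rcases eq_or_ne q 0 with rfl | h0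
  · have hz : ∀ n ≠ 0, F1Term 0 n = 0 := fun n hn => by simp [F1Term, hn]
    refine ⟨summable_of_forall_ne_zero hz, 1, ?_, ?_⟩
    · simp_rw [← Finset.sum_mul, ← Finset.mul_sum, sum_Icc_binom2]
      simpa using hasSum_zero_of_zpow (c := fun n => (-1) ^ n) (by simp)
        (e := fun n j => 5 * (n : ℤ) ^ 2 + 4 * n - 2 * j ^ 2 - j) (by simp)
        (fun n j => hecke_exponent_ne_zero (by norm_num) (by norm_num) n j)
    · rw [tsum_of_forall_ne_zero hz]; simp [F1Term, qPoch, qPochInf_zero_left]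
  · exact F1_hecke_of_ne hq h0

lemma alt_hecke {q : ℂ} (hq : ‖q‖ < 1) : Summable (altTerm q) ∧
    HasSum (fun n : ℕ => ∑ j ∈ Finset.Icc (-(n : ℤ)) n,
        (1 + q ^ (2 * n + 1)) * q ^ (4 * (n : ℤ) ^ 2 + 3 * n - 2 * j ^ 2 - j))
      (∑' n : ℕ, altTerm q n) := by
  rcases eq_or_ne q 0 with rfl | h0
  · have hz : ∀ n ≠ 0, altTerm 0 n = 0 := fun n hn => by simp [altTerm, hn]
    refine ⟨summable_of_forall_ne_zero hz, ?_⟩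
    rw [tsum_of_forall_ne_zero hz, show altTerm 0 0 = 1 by simp [altTerm, qPoch]]
    simpa using hasSum_zero_of_zpow (c := fun n => 1) (by simp)
        (e := fun n j => 4 * (n : ℤ) ^ 2 + 3 * n - 2 * j ^ 2 - j) (by simp)
        (fun n j => hecke_exponent_ne_zero (by norm_num) (by norm_num) n j)
  · exact alt_hecke_of_ne hq h0

lemma T1Neg_hecke {q : ℂ} (hq : ‖q‖ < 1) : Summable (T1NegTerm q) ∧ ∃ S : ℂ,
      HasSum (fun n : ℕ => (1 + q ^ (2 * n + 1)) * (-1) ^ n *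
        ∑ j ∈ Finset.Icc (-(n : ℤ)) n, q ^ (4 * (n : ℤ) ^ 2 + 3 * n - 2 * j ^ 2 - j)) S ∧
      ∑' n : ℕ, T1NegTerm q n =
        qPochInf (-q ^ 2) (q ^ 2) / qPochInf (q ^ 2) (q ^ 2) * S := by
  rcases eq_or_ne q 0 with rfl | h0
  · have hz : ∀ n ≠ 0, T1NegTerm 0 n = 0 := fun n hn => by simp [T1NegTerm, hn]
    refine ⟨summable_of_forall_ne_zero hz, 1, ?_, ?_⟩
    · simpa using hasSum_zero_of_zpow (c := fun n => (-1) ^ n) (by simp)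
        (e := fun n j => 4 * (n : ℤ) ^ 2 + 3 * n - 2 * j ^ 2 - j) (by simp)
        (fun n j => hecke_exponent_ne_zero (by norm_num) (by norm_num) n j)
    · rw [tsum_of_forall_ne_zero hz]; simp [T1NegTerm, qPoch, qPochInf_zero_left]
  · exact T1Neg_hecke_of_ne hq h0

lemma V1_hecke {q : ℂ} (hq : ‖q‖ < 1) : Summable (V1Term q) ∧ ∃ S : ℂ,
      HasSum (fun n : ℕ => (-1) ^ n *
        ∑ j ∈ Finset.Icc (-(n : ℤ)) n, q ^ (4 * (n : ℤ) ^ 2 + 4 * n - 2 * j ^ 2 - j)) S ∧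
      ∑' n, V1Term q n = q * (qPochInf (-q) (q ^ 2) / qPochInf (q ^ 2) (q ^ 2)) * S := by
  rcases eq_or_ne q 0 with rfl | h0
  · have hz : ∀ n, V1Term 0 n = 0 := fun n => by simp [V1Term]
    refine ⟨summable_of_forall_ne_zero fun n _ => hz n, 1, ?_, ?_⟩
    · exact hasSum_zero_of_zpow (c := fun n => (-1) ^ n) (by simp)
        (e := fun n j => 4 * (n : ℤ) ^ 2 + 4 * n - 2 * j ^ 2 - j) (by simp)
        (fun n j => hecke_exponent_ne_zero (by norm_num) (by norm_num) n j)
    · simp [hz]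
  · exact V1_hecke_of_ne hq h0

lemma psiMinus_hecke {q : ℂ} (hq : ‖q‖ < 1) : Summable (psiMinusTerm q) ∧ ∃ S : ℂ,
      HasSum (fun n : ℕ => (-1) ^ n *
        ∑ j ∈ Finset.Icc (-(n : ℤ)) n, q ^ (3 * (n : ℤ) ^ 2 + 3 * n - 2 * j ^ 2 - j)) S ∧
      ∑' n, psiMinusTerm q n = q * (qPochInf (-q) q / qPochInf q q) * S := by
  rcases eq_or_ne q 0 with rfl | h0
  · have hz : ∀ n, psiMinusTerm 0 n = 0 := fun n => by simp [psiMinusTerm]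
    refine ⟨summable_of_forall_ne_zero fun n _ => hz n, 1, ?_, ?_⟩
    · exact hasSum_zero_of_zpow (c := fun n => (-1) ^ n) (by simp)
        (e := fun n j => 3 * (n : ℤ) ^ 2 + 3 * n - 2 * j ^ 2 - j) (by simp)
        (fun n j => hecke_exponent_ne_zero (by norm_num) (by norm_num) n j)
    · simp [hz]
  · exact psiMinus_hecke_of_ne hq h0

lemma T1NegTerm_neg (q : ℂ) (n : ℕ) : T1NegTerm (-q) n = T1Term q n := by
  rw [T1NegTerm, T1Term, neg_sq, (Nat.even_mul_succ_self n).neg_pow]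

/-- The series for `T_1^{(8)}(q)` is that for `T_1^{(8)}(-q)` at `-q`. -/
lemma T1_hecke {q : ℂ} (hq : ‖q‖ < 1) : Summable (T1Term q) ∧ ∃ S : ℂ,
      HasSum (fun n : ℕ => (1 - q ^ (2 * n + 1)) *
        ∑ j ∈ Finset.Icc (-(n : ℤ)) n,
          (-1) ^ j * q ^ (4 * (n : ℤ) ^ 2 + 3 * n - 2 * j ^ 2 - j)) S ∧
      T1 q = qPochInf (-q ^ 2) (q ^ 2) / qPochInf (q ^ 2) (q ^ 2) * S := by
  obtain ⟨h1, S, h2, h3⟩ := T1Neg_hecke (q := -q) (by rwa [norm_neg])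
  rw [neg_sq] at h3
  simp_rw [T1NegTerm_neg] at h3
  refine ⟨h1.congr fun n => T1NegTerm_neg q n, S, ?_, h3⟩
  convert h2 using 2 with n
  rw [Odd.neg_pow ⟨n, rfl⟩, ← sub_eq_add_neg, mul_assoc]
  congr 1
  rw [Finset.mul_sum]
  refine Finset.sum_congr rfl fun j _ => ?_
  -- the exponent of `q` has the parity of `n + j`
  have hpar : ∀ a : ℤ, (-q) ^ a = (-1) ^ a * q ^ a := fun a => by rw [← mul_zpow, neg_one_mul]
  rw [hpar, ← mul_assoc, ← zpow_natCast (-1 : ℂ) n, ← zpow_add₀ (by norm_num)]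
  congr 1
  rw [show (n : ℤ) + (4 * (n : ℤ) ^ 2 + 3 * n - 2 * j ^ 2 - j) =
    2 * (2 * (n : ℤ) ^ 2 + 2 * n - j ^ 2 - j) + j by ring, zpow_add₀ (by norm_num),
    (even_two_mul _).neg_one_zpow, one_mul]

/-! ### The Jacobi triple product -/

lemma two_mul_binom2 (r : ℤ) : 2 * binom2 r = r * (r - 1) := by
  rw [binom2]
  exact Int.mul_ediv_cancel' (even_iff_two_dvd.1 (Int.even_mul_pred_self r))

lemma binom2_eq {r m : ℤ} (h : r * (r - 1) = 2 * m) : binom2 r = m :=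
  mul_left_cancel₀ two_ne_zero ((two_mul_binom2 r).trans h)

lemma binom2_add (a b : ℤ) : binom2 (a + b) = binom2 a + binom2 b + a * b :=
  binom2_eq (by linear_combination -(two_mul_binom2 a) - two_mul_binom2 b)

lemma binom2_neg (a : ℤ) : binom2 (-a) = binom2 a + a :=
  binom2_eq (by linear_combination -(two_mul_binom2 a))

lemma binom2_sub (a b : ℤ) : binom2 (a - b) = binom2 a + binom2 b + b - a * b := by
  rw [sub_eq_add_neg, binom2_add, binom2_neg]; ring

lemma binom2_one : binom2 1 = 0 := binom2_eq (by norm_num)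

lemma pow_two_mul_zpow_binom2 (q : ℂ) (k : ℕ) (r : ℤ) :
    (q ^ (2 * k)) ^ binom2 r = q ^ ((k : ℤ) * (r * r - r)) := by
  rw [← zpow_natCast, ← zpow_mul]; congr 1
  push_cast
  linear_combination (k : ℤ) * two_mul_binom2 r

/-- The general term `(-1)^n q^{n(n-1)/2} x^n` of the theta series. -/
def thetaTerm (x q : ℂ) (n : ℤ) : ℂ := (-1) ^ n * q ^ binom2 n * x ^ n

lemma neg_one_zpow_ne_zero (n : ℤ) : (-1 : ℂ) ^ n ≠ 0 := zpow_ne_zero _ (by norm_num)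

lemma norm_neg_one_zpow (n : ℤ) : ‖(-1 : ℂ) ^ n‖ = 1 := by simp

lemma thetaTerm_ne_zero {x q : ℂ} (hx : x ≠ 0) (h0 : q ≠ 0) (n : ℤ) : thetaTerm x q n ≠ 0 :=
  mul_ne_zero (mul_ne_zero (neg_one_zpow_ne_zero n) (zpow_ne_zero _ h0)) (zpow_ne_zero _ hx)

lemma thetaTerm_add_one {x q : ℂ} (hx : x ≠ 0) (h0 : q ≠ 0) (n : ℤ) :
    thetaTerm x q (n + 1) = -(q ^ n * x) * thetaTerm x q n := by
  simp only [thetaTerm]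
  rw [binom2_add, binom2_one, zpow_add₀ (by norm_num), zpow_add₀ hx, add_zero, mul_one,
    zpow_add₀ h0]
  simp; ring

lemma thetaTerm_neg_add_one {x q : ℂ} (h0 : q ≠ 0) (n : ℤ) :
    thetaTerm x q (-(n + 1)) = thetaTerm (q / x) q (n + 1) := by
  simp only [thetaTerm]
  rw [binom2_neg, zpow_add₀ h0 _ (n + 1), div_zpow, zpow_neg x, zpow_neg, ← inv_zpow]
  norm_num
  ring

lemma summable_norm_thetaTerm_nat {x q : ℂ} (hx : x ≠ 0) (h0 : q ≠ 0) (hq : ‖q‖ < 1) :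
    Summable fun n : ℕ => ‖thetaTerm x q n‖ := by
  refine summable_of_ratio_test_tendsto_lt_one zero_lt_one (Eventually.of_forall fun n => ?_) ?_
  · exact norm_ne_zero_iff.2 (thetaTerm_ne_zero hx h0 n)
  · have h : Tendsto (fun n : ℕ => ‖q‖ ^ n * ‖x‖) atTop (𝓝 (0 * ‖x‖)) :=
      (tendsto_pow_atTop_nhds_zero_of_lt_one (norm_nonneg q) hq).mul_const _
    rw [zero_mul] at h
    refine h.congr fun n => ?_
    have := norm_ne_zero_iff.2 (thetaTerm_ne_zero hx h0 (n : ℤ))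
    push_cast
    simp only [thetaTerm_add_one hx h0, norm_mul, norm_norm, norm_neg, zpow_natCast, norm_pow]
    rw [mul_div_cancel_right₀ _ this]

lemma summable_norm_thetaTerm {x q : ℂ} (hx : x ≠ 0) (h0 : q ≠ 0) (hq : ‖q‖ < 1) :
    Summable fun n : ℤ => ‖thetaTerm x q n‖ := by
  refine Summable.of_nat_of_neg_add_one (summable_norm_thetaTerm_nat hx h0 hq) ?_
  simp_rw [thetaTerm_neg_add_one h0]
  have := (summable_nat_add_iff 1).2 (summable_norm_thetaTerm_nat (div_ne_zero h0 hx) h0 hq)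
  exact_mod_cast this

lemma summable_thetaTerm {x q : ℂ} (hx : x ≠ 0) (h0 : q ≠ 0) (hq : ‖q‖ < 1) :
    Summable (thetaTerm x q) := (summable_norm_thetaTerm hx h0 hq).of_norm

/-- The finite form of the triple product. -/
lemma tsum_finite_triple {x q : ℂ} (hx : x ≠ 0) (h0 : q ≠ 0) (hq : ‖q‖ < 1) (n : ℕ) :
    ∑' r : ℤ, thetaTerm x q r * (qPoch q q (2 * n) * (invPoch q (n - r) * invPoch q (n + r))) =
      qPoch x q n * qPoch (q / x) q n := by
  set c : ℕ → ℤ → ℂ := fun n r => qPoch q q (2 * n) * (invPoch q (n - r) * invPoch q (n + r))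
    with hc
  have hfin : ∀ n, Summable fun r : ℤ => thetaTerm x q r * c n r := by
    intro n
    refine summable_of_ne_finset_zero (s := Finset.Icc (-(n : ℤ)) n) fun r hr => ?_
    simp only [Finset.mem_Icc, not_and_or, not_le] at hr
    simp only [hc]
    rcases hr with h | h
    · rw [invPoch_of_neg _ (show (n + r : ℤ) < 0 by omega)]; ring
    · rw [invPoch_of_neg _ (show (n - r : ℤ) < 0 by omega)]; ring
  change ∑' r : ℤ, thetaTerm x q r * c n r = _
  induction n with
  | zero =>
    rw [tsum_eq_single 0]
    · have h : invPoch q 0 = 1 := by simpa [qPoch] using invPoch_natCast q 0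
      simp [hc, h, thetaTerm, binom2, qPoch]
    · intro r hr
      simp only [hc]
      rcases lt_or_gt_of_ne hr with h | h
      · rw [invPoch_of_neg _ (show ((0 : ℕ) : ℤ) + r < 0 by simpa using h)]; ring
      · rw [invPoch_of_neg _ (show ((0 : ℕ) : ℤ) - r < 0 by simpa using h)]; ring
  | succ n ih =>
    have hs1 : Summable fun r : ℤ => q ^ n * x * (thetaTerm x q (r - 1) * c n (r - 1)) :=
      ((Equiv.subRight (1 : ℤ)).summable_iff.2 (hfin n)).mul_left (q ^ n * x)
    have hs2 : Summable fun r : ℤ => q ^ (n + 1) / x * (thetaTerm x q (r + 1) * c n (r + 1)) :=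
      ((Equiv.addRight (1 : ℤ)).summable_iff.2 (hfin n)).mul_left (q ^ (n + 1) / x)
    have e1 := (Equiv.subRight (1 : ℤ)).tsum_eq fun r => thetaTerm x q r * c n r
    have e2 := (Equiv.addRight (1 : ℤ)).tsum_eq fun r => thetaTerm x q r * c n r
    have hstep : ∀ r : ℤ, thetaTerm x q r * c (n + 1) r =
        (1 + q ^ (2 * n + 1)) * (thetaTerm x q r * c n r)
        - q ^ n * x * (thetaTerm x q (r - 1) * c n (r - 1))
        - q ^ (n + 1) / x * (thetaTerm x q (r + 1) * c n (r + 1)) := by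
      intro r
      have t1 := thetaTerm_add_one hx h0 (r - 1)
      rw [sub_add_cancel] at t1
      rw [thetaTerm_add_one hx h0 r, t1]
      have i1 := invPoch_sub_one hq (n + 1 - r)
      have i2 := invPoch_sub_one hq (n + 1 + r)
      have i3 := invPoch_sub_one hq (n - r)
      have i4 := invPoch_sub_one hq (n + r)
      rw [show (n : ℤ) + 1 - r - 1 = n - r by ring] at i1
      rw [show (n : ℤ) + 1 + r - 1 = n + r by ring] at i2
      simp only [hc]
      push_cast
      rw [show (n : ℤ) - (r - 1) = n + 1 - r by ring, show (n : ℤ) + (r - 1) = n + r - 1 by ring,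
        show (n : ℤ) - (r + 1) = n - r - 1 by ring, show (n : ℤ) + (r + 1) = n + 1 + r by ring,
        i3, i4, i1, i2, mul_add 2, mul_one, qPoch_succ, qPoch_succ]
      have p1 : q ^ ((n : ℤ) + 1 - r) = q ^ n * q * (q ^ r)⁻¹ := by
        rw [zpow_sub₀ h0, zpow_add₀ h0, zpow_natCast, zpow_one, div_eq_mul_inv]
      have p2 : q ^ ((n : ℤ) + 1 + r) = q ^ n * q * q ^ r := by
        rw [zpow_add₀ h0, zpow_add₀ h0, zpow_natCast, zpow_one]
      have p3 : q ^ ((n : ℤ) - r) = q ^ n * (q ^ r)⁻¹ := by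
        rw [zpow_sub₀ h0, zpow_natCast, div_eq_mul_inv]
      have p4 : q ^ ((n : ℤ) + r) = q ^ n * q ^ r := by rw [zpow_add₀ h0, zpow_natCast]
      have p5 : q ^ (r - 1) = q ^ r * q⁻¹ := by rw [zpow_sub_one₀ h0]
      rw [p1, p2, p3, p4, p5]
      have hr : q ^ r ≠ 0 := zpow_ne_zero _ h0
      rw [show q ^ (2 * n + 1) = q ^ n * q ^ n * q by ring,
        show q ^ (2 * n) = q ^ n * q ^ n by ring]
      field_simp
      ring
    simp_rw [hstep]
    rw [Summable.tsum_sub (((hfin n).mul_left _).sub hs1) hs2,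
      Summable.tsum_sub ((hfin n).mul_left _) hs1, tsum_mul_left, tsum_mul_left, tsum_mul_left]
    simp only [Equiv.subRight_apply, Equiv.coe_addRight] at e1 e2
    rw [e1, e2, ih, qPoch_succ, qPoch_succ]
    field_simp
    ring

/-- The Jacobi triple product identity. -/
theorem tsum_thetaTerm {x q : ℂ} (hx : x ≠ 0) (h0 : q ≠ 0) (hq : ‖q‖ < 1) :
    ∑' n, thetaTerm x q n = jTheta x q := by
  obtain ⟨K, hK0, hK⟩ := exists_norm_inv_qPoch_le hq hq
  obtain ⟨M, hM⟩ := exists_norm_qPoch_le hq q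
  have hM0 : 0 ≤ M := (norm_nonneg _).trans (hM 0)
  have hip : ∀ m, ‖invPoch q m‖ ≤ K := by
    intro m
    rcases lt_or_ge m 0 with hm | hm
    · rw [invPoch_of_neg _ hm, norm_zero]; exact hK0
    · lift m to ℕ using hm
      rw [invPoch_natCast]; exact hK m
  have hP := qPochInf_ne_zero_of_norm_lt hq hq
  have hinf : ∀ r : ℤ, Tendsto (fun n : ℕ => invPoch q (n + r)) atTop (𝓝 (qPochInf q q)⁻¹) := by
    intro r
    have h1 : Tendsto (fun n : ℕ => ((n : ℤ) + r).toNat) atTop atTop := by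
      refine tendsto_atTop.2 fun b => ?_
      filter_upwards [eventually_ge_atTop (b + r.natAbs)] with n hn
      omega
    refine (((tendsto_qPoch hq q).inv₀ hP).comp h1).congr' ?_
    filter_upwards [eventually_ge_atTop r.natAbs] with n hn
    have : (0 : ℤ) ≤ n + r := by omega
    simp [invPoch, this]
  have hlim : Tendsto (fun n : ℕ => ∑' r : ℤ, thetaTerm x q r *
      (qPoch q q (2 * n) * (invPoch q (n - r) * invPoch q (n + r)))) atTop
      (𝓝 (∑' r : ℤ, thetaTerm x q r * (qPochInf q q * ((qPochInf q q)⁻¹ * (qPochInf q q)⁻¹)))) := by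
    refine tendsto_tsum_of_dominated_convergence
      (bound := fun r => ‖thetaTerm x q r‖ * (M * (K * K)))
      ((summable_norm_thetaTerm hx h0 hq).mul_right _) (fun r => ?_)
      (Eventually.of_forall fun n r => ?_)
    · refine Tendsto.const_mul _ (Tendsto.mul ?_ (Tendsto.mul ?_ (hinf r)))
      · exact (tendsto_qPoch hq q).comp (tendsto_id.const_mul_atTop' two_pos)
      · simpa only [sub_eq_add_neg] using hinf (-r)
    · rw [norm_mul, norm_mul (qPoch _ _ _), norm_mul (invPoch _ _)]
      gcongr
      exacts [hM _, hip _, hip _]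
  simp_rw [tsum_finite_triple hx h0 hq] at hlim
  have h2 := tendsto_nhds_unique hlim ((tendsto_qPoch hq x).mul (tendsto_qPoch hq (q / x)))
  rw [tsum_mul_right] at h2
  rw [jTheta, ← h2]
  field_simp

lemma hasSum_thetaTerm {x q : ℂ} (hx : x ≠ 0) (h0 : q ≠ 0) (hq : ‖q‖ < 1) :
    HasSum (thetaTerm x q) (jTheta x q) :=
  tsum_thetaTerm hx h0 hq ▸ (summable_thetaTerm hx h0 hq).hasSum

lemma jTheta_div_left {q : ℂ} (h0 : q ≠ 0) (x : ℂ) : jTheta (q / x) q = jTheta x q := by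
  rw [jTheta, jTheta, div_div_cancel₀ h0]; ring

/-- Quasi-periodicity of the theta function. -/
lemma jTheta_zpow_mul {x q : ℂ} (hx : x ≠ 0) (h0 : q ≠ 0) (hq : ‖q‖ < 1) (k : ℤ) :
    jTheta (q ^ k * x) q = (-1) ^ k * q ^ (-binom2 k) * x ^ (-k) * jTheta x q := by
  have hk := zpow_ne_zero k h0
  rw [← tsum_thetaTerm hx h0 hq, ← tsum_thetaTerm (mul_ne_zero hk hx) h0 hq, ← tsum_mul_left,
    ← (Equiv.addRight k).tsum_eq (fun n => _ * thetaTerm x q n)]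
  refine tsum_congr fun n => ?_
  simp only [thetaTerm, Equiv.coe_addRight]
  rw [binom2_add, mul_zpow, zpow_add₀ (by norm_num : (-1 : ℂ) ≠ 0), zpow_add₀ hx,
    zpow_add₀ h0 _ (n * k), zpow_add₀ h0, zpow_neg, zpow_neg, ← zpow_mul, mul_comm k n]
  have h1 : ((-1 : ℂ) ^ k) * (-1) ^ k = 1 := by rw [← mul_zpow]; simp
  have := zpow_ne_zero k hx
  have := zpow_ne_zero (binom2 k) h0
  field_simp
  linear_combination -h1

lemma jTheta_mul_left {x q : ℂ} (hx : x ≠ 0) (h0 : q ≠ 0) (hq : ‖q‖ < 1) :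
    jTheta (q * x) q = -x⁻¹ * jTheta x q := by
  simpa [binom2_one] using jTheta_zpow_mul hx h0 hq 1

lemma jTheta_inv_left {x q : ℂ} (hx : x ≠ 0) (h0 : q ≠ 0) (hq : ‖q‖ < 1) :
    jTheta x⁻¹ q = -x⁻¹ * jTheta x q := by
  have h := jTheta_mul_left (inv_ne_zero hx) h0 hq
  rw [← div_eq_mul_inv, jTheta_div_left h0] at h
  rw [h]; field_simp

lemma jTheta_ne_zero {x q : ℂ} (h0 : q ≠ 0) (hq : ‖q‖ < 1) (h : ∀ k : ℤ, x ≠ q ^ k) :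
    jTheta x q ≠ 0 := by
  refine mul_ne_zero (mul_ne_zero (qPochInf_ne_zero hq fun k hk => ?_)
    (qPochInf_ne_zero hq fun k hk => ?_)) (qPochInf_ne_zero_of_norm_lt hq hq)
  · refine h (-k) ?_
    rw [zpow_neg, zpow_natCast]; exact eq_inv_of_mul_eq_one_left hk
  · refine h (k + 1) ?_
    have hx : x ≠ 0 := by rintro rfl; simp at hk
    rw [zpow_add₀ h0, zpow_one, zpow_natCast]
    field_simp at hk
    linear_combination -hk

lemma jTheta_ne_zero_of_norm {x q : ℂ} (h0 : q ≠ 0) (hq : ‖q‖ < 1) (h1 : ‖q‖ < ‖x‖)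
    (h2 : ‖x‖ < 1) : jTheta x q ≠ 0 := by
  refine jTheta_ne_zero h0 hq fun k hk => ?_
  have hn := congrArg norm hk
  rw [norm_zpow] at hn
  have hqp : 0 < ‖q‖ := norm_pos_iff.2 h0
  rcases lt_or_ge 0 k with h | h
  · have : ‖q‖ ^ k ≤ ‖q‖ ^ (1 : ℤ) := zpow_le_zpow_right_of_le_one₀ hqp hq.le (by omega)
    rw [zpow_one] at this; linarith
  · have : ‖q‖ ^ (0 : ℤ) ≤ ‖q‖ ^ k := zpow_le_zpow_right_of_le_one₀ hqp hq.le h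
    rw [zpow_zero] at this; linarith

lemma jTheta_one (q : ℂ) (hq : ‖q‖ < 1) : jTheta 1 q = 0 := by
  rw [jTheta, qPochInf_eq_mul hq]; ring

/-! ### Sums over cones -/

lemma hasSum_of_eq {ι : Type*} {f g : ι → ℂ} {a b : ℂ} (h : HasSum f a) (hf : ∀ i, g i = f i)
    (ha : b = a) : HasSum g b := by
  rw [ha, funext hf]; exact h

/-- `(sg k + sg l) / 2`: the signed indicator function of the cone `sg k = sg l`. -/
def cone (k l : ℤ) : ℂ := ((sg k + sg l : ℤ) : ℂ) / 2

lemma cone_comm (k l : ℤ) : cone k l = cone l k := by rw [cone, cone, add_comm]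

lemma cone_of_nonneg {k l : ℤ} (hk : 0 ≤ k) (hl : 0 ≤ l) : cone k l = 1 := by
  simp [cone, sg, hk, hl]

lemma cone_of_neg {k l : ℤ} (hk : k < 0) (hl : l < 0) : cone k l = -1 := by
  simp [cone, sg, not_le.2 hk, not_le.2 hl]

lemma cone_of_nonneg_of_neg {k l : ℤ} (hk : 0 ≤ k) (hl : l < 0) : cone k l = 0 := by
  simp [cone, sg, hk, not_le.2 hl]

lemma cone_of_neg_of_nonneg {k l : ℤ} (hk : k < 0) (hl : 0 ≤ l) : cone k l = 0 := by
  rw [cone_comm, cone_of_nonneg_of_neg hl hk]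

lemma norm_cone_mul_le {k l : ℤ} {a : ℂ} {M : ℝ} (hM : 0 ≤ M)
    (h1 : 0 ≤ k → 0 ≤ l → ‖a‖ ≤ M) (h2 : k < 0 → l < 0 → ‖a‖ ≤ M) : ‖cone k l * a‖ ≤ M := by
  rcases le_or_gt 0 k with hk | hk <;> rcases le_or_gt 0 l with hl | hl
  · rw [cone_of_nonneg hk hl, one_mul]; exact h1 hk hl
  · rw [cone_of_nonneg_of_neg hk hl, zero_mul, norm_zero]; exact hM
  · rw [cone_of_neg_of_nonneg hk hl, zero_mul, norm_zero]; exact hM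
  · rw [cone_of_neg hk hl, neg_one_mul, norm_neg]; exact h2 hk hl

lemma summable_pow_natAbs {ρ : ℝ} (h0 : 0 ≤ ρ) (h1 : ρ < 1) :
    Summable fun k : ℤ => ρ ^ k.natAbs := by
  refine Summable.of_nat_of_neg_add_one ?_ ?_
  · simpa using summable_geometric_of_lt_one h0 h1
  · have := (summable_nat_add_iff 1).2 (summable_geometric_of_lt_one h0 h1)
    refine this.congr fun n => ?_
    congr 1

lemma summable_pow_natAbs_add {ρ : ℝ} (h0 : 0 ≤ ρ) (h1 : ρ < 1) :
    Summable fun p : ℤ × ℤ => ρ ^ (p.1.natAbs + p.2.natAbs) := by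
  simp_rw [pow_add]
  exact (summable_pow_natAbs h0 h1).mul_of_nonneg (summable_pow_natAbs h0 h1)
    (fun _ => by positivity) (fun _ => by positivity)

/-- The two geometric series for `1 / (1 - X)`, in one formula. -/
lemma hasSum_cone_mul_zpow {X : ℂ} {T : ℤ} (h1 : 0 ≤ T → ‖X‖ < 1) (h2 : T < 0 → 1 < ‖X‖) :
    HasSum (fun k => cone k T * X ^ k) (1 / (1 - X)) := by
  rcases le_or_gt 0 T with hT | hT
  · have hX := h1 hT
    rw [← add_zero (1 / (1 - X)), one_div]
    refine HasSum.of_nat_of_neg_add_one ?_ ?_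
    · simpa [cone_of_nonneg (Int.natCast_nonneg _) hT] using hasSum_geometric_of_norm_lt_one hX
    · convert hasSum_zero using 2 with n
      rw [cone_of_neg_of_nonneg (by omega) hT, zero_mul]
  · have hX := h2 hT
    have hX0 : X ≠ 0 := by rintro rfl; simp at hX; linarith
    have hX1 : 1 - X ≠ 0 := fun h => by
      rw [← sub_eq_zero.1 h] at hX; simp at hX
    have hi : ‖X⁻¹‖ < 1 := by rw [norm_inv]; exact inv_lt_one_of_one_lt₀ hX
    rw [← zero_add (1 / (1 - X))]
    refine HasSum.of_nat_of_neg_add_one ?_ ?_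
    · convert hasSum_zero using 2 with n
      rw [cone_of_nonneg_of_neg (by omega) hT, zero_mul]
    · refine hasSum_of_eq ((hasSum_geometric_of_norm_lt_one hi).mul_left (-X⁻¹)) ?_ ?_
      · intro n
        rw [cone_of_neg (by omega) hT, zpow_neg, ← inv_zpow, zpow_add₀ (inv_ne_zero hX0)]
        simp; ring
      · have : 1 - X⁻¹ ≠ 0 := fun h => by
          have h3 : X⁻¹ = 1 := by linear_combination -h
          rw [inv_eq_one.1 h3] at hX1; simp at hX1
        have h4 : X - 1 ≠ 0 := fun h => hX1 (by linear_combination -h)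
        field_simp
        ring

/-! ### Appell-Lerch series as double sums -/

lemma norm_zpow_mul_zpow_le {p w : ℂ} (h0 : p ≠ 0) (hp : ‖p‖ < 1) {ρ : ℝ} (h1 : ‖w‖ ≤ ρ)
    (h2 : ‖p‖ / ‖w‖ ≤ ρ) (hw : w ≠ 0) {k T : ℤ} (h : (0 ≤ k ∧ 0 ≤ T) ∨ (k < 0 ∧ T < 0)) :
    ‖(p ^ T * w) ^ k‖ ≤ ρ ^ k.natAbs := by
  have hp0 : 0 < ‖p‖ := norm_pos_iff.2 h0
  have hw0 : 0 < ‖w‖ := norm_pos_iff.2 hw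
  rw [norm_zpow, norm_mul, norm_zpow]
  rcases h with ⟨hk, hT⟩ | ⟨hk, hT⟩
  · lift k to ℕ using hk
    rw [zpow_natCast, Int.natAbs_natCast]
    have : ‖p‖ ^ T ≤ 1 := by
      rw [← zpow_zero ‖p‖]; exact zpow_le_zpow_right_of_le_one₀ hp0 hp.le hT
    gcongr
    nlinarith
  · obtain ⟨m, rfl⟩ : ∃ m : ℕ, k = -(m : ℤ) := ⟨k.natAbs, by omega⟩
    rw [zpow_neg, ← inv_zpow, zpow_natCast, Int.natAbs_neg, Int.natAbs_natCast]
    gcongr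
    have : ‖p‖ ^ (-T) ≤ ‖p‖ ^ (1 : ℤ) := zpow_le_zpow_right_of_le_one₀ hp0 hp.le (by omega)
    rw [zpow_one] at this
    refine le_trans ?_ h2
    rw [mul_inv, ← zpow_neg, div_eq_mul_inv]
    gcongr

/-- The double series of `j(z;p) m(x,p,z)` over a cone. -/
theorem hasSum_appell {x p z : ℂ} (h0 : p ≠ 0) (hp : ‖p‖ < 1) (hz : z ≠ 0) (hj : jTheta z p ≠ 0)
    (h1 : ‖p‖ < ‖x * z‖) (h2 : ‖x * z‖ < 1) :
    HasSum (fun a : ℤ × ℤ => thetaTerm z p (a.1 + 1) * (cone a.2 a.1 * (p ^ a.1 * (x * z)) ^ a.2))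
      (jTheta z p * appellM x p z) ∧ Summable (appellTerm x p z) := by
  have hp0 : 0 < ‖p‖ := norm_pos_iff.2 h0
  have hw0 : 0 < ‖x * z‖ := hp0.trans h1
  have hw : x * z ≠ 0 := norm_pos_iff.1 hw0
  set ρ := max ‖x * z‖ (‖p‖ / ‖x * z‖) with hρ
  have hρ1 : ρ < 1 := max_lt h2 ((div_lt_one hw0).2 h1)
  have hρ0 : 0 ≤ ρ := (norm_nonneg _).trans (le_max_left _ _)
  have hs : Summable (fun a : ℤ × ℤ =>
      thetaTerm z p (a.1 + 1) * (cone a.2 a.1 * (p ^ a.1 * (x * z)) ^ a.2)) := by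
    have hθ := (Equiv.addRight (1 : ℤ)).summable_iff.2 (summable_norm_thetaTerm hz h0 hp)
    refine Summable.of_norm_bounded (hθ.mul_of_nonneg (summable_pow_natAbs hρ0 hρ1)
      (fun _ => norm_nonneg _) (fun _ => by positivity)) fun a => ?_
    rw [norm_mul]
    simp only [Function.comp_apply, Equiv.coe_addRight]
    gcongr
    exact norm_cone_mul_le (by positivity)
      (fun hk hT => norm_zpow_mul_zpow_le h0 hp (le_max_left _ _) (le_max_right _ _) hw
        (Or.inl ⟨hk, hT⟩))
      (fun hk hT => norm_zpow_mul_zpow_le h0 hp (le_max_left _ _) (le_max_right _ _) hw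
        (Or.inr ⟨hk, hT⟩))
  have hin : ∀ T : ℤ, HasSum (fun k => thetaTerm z p (T + 1) *
      (cone k T * (p ^ T * (x * z)) ^ k)) (appellTerm x p z (T + 1)) := by
    intro T
    have := (hasSum_cone_mul_zpow (X := p ^ T * (x * z)) (T := T) (fun hT => ?_)
      (fun hT => ?_)).mul_left (thetaTerm z p (T + 1))
    · refine hasSum_of_eq this (fun _ => rfl) ?_
      rw [appellTerm, thetaTerm, add_sub_cancel_right, mul_one_div, mul_assoc (p ^ T)]
    · rw [norm_mul, norm_zpow]
      have : ‖p‖ ^ T ≤ 1 := by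
        rw [← zpow_zero ‖p‖]; exact zpow_le_zpow_right_of_le_one₀ hp0 hp.le hT
      nlinarith
    · rw [norm_mul, norm_zpow]
      have h3 : ‖p‖ ^ (-T) ≤ ‖p‖ ^ (1 : ℤ) :=
        zpow_le_zpow_right_of_le_one₀ hp0 hp.le (by omega)
      rw [zpow_one] at h3
      have h4 : ‖p‖ ^ T * ‖p‖ ^ (-T) = 1 := by rw [← zpow_add₀ hp0.ne']; simp
      have h5 : 0 < ‖p‖ ^ T := by positivity
      nlinarith
  have hA : Summable fun T : ℤ => appellTerm x p z (T + 1) := by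
    have := hs.prod
    simpa only [(hin _).tsum_eq] using this
  refine ⟨?_, (Equiv.addRight (1 : ℤ)).summable_iff.1 hA⟩
  convert hs.hasSum using 1
  rw [hs.tsum_prod, appellM]
  simp_rw [(hin _).tsum_eq]
  rw [← (Equiv.addRight (1 : ℤ)).tsum_eq (appellTerm x p z)]
  simp only [Equiv.coe_addRight]
  field_simp

/-! ### Kronecker's formula -/

/-- The general term of the Kronecker double series `∑ sg(r) x^r y^s q^{rs}`. -/
def kronTerm (x y q : ℂ) (a : ℤ × ℤ) : ℂ :=
  cone a.1 a.2 * (x ^ a.1 * y ^ a.2 * q ^ (a.1 * a.2))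

lemma summable_norm_kronTerm {x y q : ℂ} (h0 : q ≠ 0) (hq : ‖q‖ < 1) (hx : ‖q‖ < ‖x‖)
    (hx1 : ‖x‖ < 1) (hy : ‖q‖ < ‖y‖) (hy1 : ‖y‖ < 1) : Summable fun a => ‖kronTerm x y q a‖ := by
  have hq0 : 0 < ‖q‖ := norm_pos_iff.2 h0
  have hxn : 0 < ‖x‖ := hq0.trans hx
  have hyn : 0 < ‖y‖ := hq0.trans hy
  set ρ := max (max ‖x‖ (‖q‖ / ‖x‖)) (max ‖y‖ (‖q‖ / ‖y‖)) with hρ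
  have hρ1 : ρ < 1 := max_lt (max_lt hx1 ((div_lt_one hxn).2 hx)) (max_lt hy1 ((div_lt_one hyn).2 hy))
  have e1 : ‖x‖ ≤ ρ := (le_max_left _ _).trans (le_max_left _ _)
  have e2 : ‖q‖ / ‖x‖ ≤ ρ := (le_max_right _ _).trans (le_max_left _ _)
  have e3 : ‖y‖ ≤ ρ := (le_max_left _ _).trans (le_max_right _ _)
  have e4 : ‖q‖ / ‖y‖ ≤ ρ := (le_max_right _ _).trans (le_max_right _ _)
  have hρ0 : 0 ≤ ρ := (norm_nonneg _).trans e1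
  refine Summable.of_nonneg_of_le (fun _ => norm_nonneg _) (fun a => ?_)
    ((summable_pow_natAbs_add hρ0 hρ1).mul_left ‖q‖⁻¹)
  obtain ⟨r, s⟩ := a
  refine norm_cone_mul_le (by positivity) (fun hr hs => ?_) (fun hr hs => ?_)
  · lift r to ℕ using hr
    lift s to ℕ using hs
    rw [norm_mul, norm_mul, norm_zpow, norm_zpow, norm_zpow, zpow_natCast, zpow_natCast,
      ← Int.natCast_mul, zpow_natCast, Int.natAbs_natCast, Int.natAbs_natCast, pow_add]
    have h1 : ‖q‖ ^ (r * s) ≤ 1 := pow_le_one₀ hq0.le hq.le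
    have h2 : 1 ≤ ‖q‖⁻¹ := (one_le_inv₀ hq0).2 hq.le
    calc ‖x‖ ^ r * ‖y‖ ^ s * ‖q‖ ^ (r * s) ≤ ρ ^ r * ρ ^ s * 1 := by gcongr
      _ = 1 * (ρ ^ r * ρ ^ s) := by ring
      _ ≤ _ := by gcongr
  · obtain ⟨m, rfl⟩ : ∃ m : ℕ, r = -((m : ℤ) + 1) := ⟨(-r - 1).toNat, by omega⟩
    obtain ⟨n, rfl⟩ : ∃ n : ℕ, s = -((n : ℤ) + 1) := ⟨(-s - 1).toNat, by omega⟩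
    rw [norm_mul, norm_mul, norm_zpow, norm_zpow, norm_zpow,
      show (-((m : ℤ) + 1) * -((n : ℤ) + 1)) = ((m + 1 : ℕ) : ℤ) + ((n + 1 : ℕ) : ℤ)
        + ((m * n : ℕ) : ℤ) - 1 by push_cast; ring, zpow_sub₀ hq0.ne', zpow_add₀ hq0.ne',
      zpow_add₀ hq0.ne', zpow_one, Int.natAbs_neg, Int.natAbs_neg,
      show ((m : ℤ) + 1) = ((m + 1 : ℕ) : ℤ) by push_cast; ring,
      show ((n : ℤ) + 1) = ((n + 1 : ℕ) : ℤ) by push_cast; ring, zpow_neg, zpow_neg,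
      zpow_natCast, zpow_natCast, zpow_natCast, zpow_natCast, zpow_natCast, Int.natAbs_natCast,
      Int.natAbs_natCast, pow_add]
    have h1 : ‖q‖ ^ (m * n) ≤ 1 := pow_le_one₀ hq0.le hq.le
    calc _ = ‖q‖⁻¹ * ((‖q‖ / ‖x‖) ^ (m + 1) * (‖q‖ / ‖y‖) ^ (n + 1) * ‖q‖ ^ (m * n)) := by
          rw [div_pow, div_pow]; field_simp; ring
      _ ≤ ‖q‖⁻¹ * (ρ ^ (m + 1) * ρ ^ (n + 1) * 1) := by gcongr
      _ = _ := by ring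

/-- The series of partial fractions of `(q;q)_∞³ / j(x;q)`. -/
def lambertSum (x q : ℂ) : ℂ := ∑' s : ℤ, (-1) ^ s * q ^ binom2 (s + 1) * (1 / (1 - x * q ^ s))

lemma jTheta_zpow_eq_zero {q : ℂ} (h0 : q ≠ 0) (hq : ‖q‖ < 1) (k : ℤ) : jTheta (q ^ k) q = 0 := by
  rw [← mul_one (q ^ k), jTheta_zpow_mul one_ne_zero h0 hq, jTheta_one q hq, mul_zero]

/-- Multiplying the Kronecker series by `j(y;q)` and collecting powers of `y`, the coefficients
are those of `j(xy;q)` up to a common factor: passing from one coefficient to the next changes the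
inner sum by a theta series at an integral power of `q`, which vanishes. -/
lemma jTheta_mul_tsum_kronTerm {x y q : ℂ} (h0 : q ≠ 0) (hq : ‖q‖ < 1) (hx : ‖q‖ < ‖x‖)
    (hx1 : ‖x‖ < 1) (hy : ‖q‖ < ‖y‖) (hy1 : ‖y‖ < 1) :
    jTheta y q * ∑' a, kronTerm x y q a = lambertSum x q * jTheta (x * y) q := by
  have hq0 : 0 < ‖q‖ := norm_pos_iff.2 h0
  have hxn : x ≠ 0 := norm_pos_iff.1 (hq0.trans hx)
  have hyn : y ≠ 0 := norm_pos_iff.1 (hq0.trans hy)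
  have hK := summable_norm_kronTerm h0 hq hx hx1 hy hy1
  have hθ := summable_norm_thetaTerm hyn h0 hq
  rw [← tsum_thetaTerm hyn h0 hq, tsum_mul_tsum_of_summable_norm hθ hK]
  have hs := summable_mul_of_summable_norm hθ hK
  let e : ℤ × (ℤ × ℤ) ≃ ℤ × (ℤ × ℤ) :=
    { toFun := fun a => (a.1 - a.2.1, (a.2.2 + a.1, a.2.1))
      invFun := fun b => (b.1 + b.2.2, (b.2.2, b.2.1 - b.1 - b.2.2))
      left_inv := fun a => by ext <;> dsimp <;> ring
      right_inv := fun b => by ext <;> dsimp <;> ring }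
  set G : ℤ × (ℤ × ℤ) → ℂ := fun a => thetaTerm (x * y) q a.1 * ((-1) ^ a.2.1 *
    q ^ binom2 (a.2.1 + 1) * (cone (a.2.2 + a.1) a.2.1 * (x * q ^ a.2.1) ^ a.2.2)) with hG
  have he : ∀ a, thetaTerm y q (e a).1 * kronTerm x y q (e a).2 = G a := by
    rintro ⟨N, s, r⟩
    simp only [e, hG, kronTerm, thetaTerm, Equiv.coe_fn_mk]
    rw [binom2_sub, binom2_add, binom2_one, neg_one_zpow_sub, zpow_add₀ (by norm_num),
      mul_zpow, mul_zpow, ← zpow_mul, zpow_add₀ hxn, zpow_sub₀ hyn]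
    have e1 : q ^ (binom2 N + binom2 s + s - N * s) * q ^ ((r + N) * s) =
        q ^ binom2 N * q ^ (binom2 s + 0 + s * 1) * q ^ (s * r) := by
      rw [← zpow_add₀ h0, ← zpow_add₀ h0, ← zpow_add₀ h0]; congr 1; ring
    have := zpow_ne_zero s hyn
    field_simp
    linear_combination e1 * cone (r + N) s
  have hGs : Summable G := by
    rw [← (funext he : (fun a => thetaTerm y q (e a).1 * kronTerm x y q (e a).2) = G)]
    exact e.summable_iff.2 hs
  rw [← e.tsum_eq, tsum_congr he, hGs.tsum_prod]
  have hX : ∀ s : ℤ, (0 ≤ s → ‖x * q ^ s‖ < 1) ∧ (s < 0 → 1 < ‖x * q ^ s‖) := by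
    intro s
    rw [norm_mul, norm_zpow]
    constructor
    · intro h
      have : ‖q‖ ^ s ≤ 1 := by
        rw [← zpow_zero ‖q‖]; exact zpow_le_zpow_right_of_le_one₀ hq0 hq.le h
      nlinarith [norm_nonneg x]
    · intro h
      have h3 : ‖q‖ ^ (-s) ≤ ‖q‖ ^ (1 : ℤ) :=
        zpow_le_zpow_right_of_le_one₀ hq0 hq.le (by omega)
      rw [zpow_one] at h3
      have h4 : ‖q‖ ^ s * ‖q‖ ^ (-s) = 1 := by rw [← zpow_add₀ hq0.ne']; simp
      have h5 : 0 < ‖q‖ ^ s := by positivity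
      nlinarith
  have hX0 : ∀ s : ℤ, x * q ^ s ≠ 0 := fun s => mul_ne_zero hxn (zpow_ne_zero _ h0)
  have hX1 : ∀ s : ℤ, 1 - x * q ^ s ≠ 0 := by
    intro s h
    have h3 : ‖x * q ^ s‖ = 1 := by rw [← sub_eq_zero.1 h, norm_one]
    rcases le_or_gt 0 s with hs0 | hs0
    · exact absurd ((hX s).1 hs0) (by rw [h3]; exact lt_irrefl 1)
    · exact absurd ((hX s).2 hs0) (by rw [h3]; exact lt_irrefl 1)
  have hin : ∀ N s : ℤ, HasSum (fun r => (-1 : ℂ) ^ s * q ^ binom2 (s + 1) *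
      (cone (r + N) s * (x * q ^ s) ^ r))
      ((-1) ^ s * q ^ binom2 (s + 1) * ((x * q ^ s) ^ (-N) * (1 / (1 - x * q ^ s)))) := by
    intro N s
    refine HasSum.mul_left _ ?_
    have h1 := (hasSum_cone_mul_zpow (hX s).1 (hX s).2).mul_left ((x * q ^ s) ^ (-N))
    rw [← (Equiv.addRight N).hasSum_iff] at h1
    refine hasSum_of_eq h1 (fun r => ?_) rfl
    simp only [Function.comp_apply, Equiv.coe_addRight]
    rw [mul_left_comm, ← zpow_add₀ (hX0 s)]
    congr 2; ring
  set D : ℤ → ℂ := fun N => ∑' s : ℤ, (-1) ^ s * q ^ binom2 (s + 1) *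
    ((x * q ^ s) ^ (-N) * (1 / (1 - x * q ^ s))) with hD
  have hxy : x * y ≠ 0 := mul_ne_zero hxn hyn
  have hDs2 : ∀ N : ℤ, Summable fun a : ℤ × ℤ => (-1 : ℂ) ^ a.1 *
    q ^ binom2 (a.1 + 1) * (cone (a.2 + N) a.1 * (x * q ^ a.1) ^ a.2) := fun N =>
    (summable_mul_left_iff (thetaTerm_ne_zero hxy h0 N)).1 (hGs.prod_factor N)
  have hDs : ∀ N : ℤ, Summable fun s : ℤ => (-1 : ℂ) ^ s * q ^ binom2 (s + 1) *
      ((x * q ^ s) ^ (-N) * (1 / (1 - x * q ^ s))) := by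
    intro N
    simpa only [(hin N _).tsum_eq] using (hDs2 N).prod
  have hsuc : ∀ N, D (N + 1) = D N := by
    intro N
    rw [← sub_eq_zero]
    simp only [hD]
    rw [← (hDs (N + 1)).tsum_sub (hDs N)]
    have h1 : ∀ s : ℤ, (-1 : ℂ) ^ s * q ^ binom2 (s + 1) *
        ((x * q ^ s) ^ (-(N + 1)) * (1 / (1 - x * q ^ s))) - (-1) ^ s * q ^ binom2 (s + 1) *
        ((x * q ^ s) ^ (-N) * (1 / (1 - x * q ^ s))) = x ^ (-(N + 1)) * thetaTerm (q ^ (-N)) q s := by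
      intro s
      have h2 : (x * q ^ s) ^ (-N) = (x * q ^ s) ^ (-(N + 1)) * (x * q ^ s) := by
        rw [← zpow_add_one₀ (hX0 s)]; congr 1; ring
      have h3 : q ^ binom2 (s + 1) * (q ^ s) ^ (-(N + 1)) = q ^ binom2 s * (q ^ (-N)) ^ s := by
        rw [binom2_add, binom2_one, ← zpow_mul, ← zpow_mul, ← zpow_add₀ h0, ← zpow_add₀ h0]
        congr 1; ring
      have h4 : 1 / (1 - x * q ^ s) * (1 - x * q ^ s) = 1 := one_div_mul_cancel (hX1 s)
      rw [h2, thetaTerm]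
      calc _ = (-1) ^ s * q ^ binom2 (s + 1) * (x * q ^ s) ^ (-(N + 1)) *
            (1 / (1 - x * q ^ s) * (1 - x * q ^ s)) := by ring
        _ = _ := by rw [h4, mul_zpow]; linear_combination (-1) ^ s * x ^ (-(N + 1)) * h3
    rw [tsum_congr h1, tsum_mul_left, tsum_thetaTerm (zpow_ne_zero _ h0) h0 hq,
      jTheta_zpow_eq_zero h0 hq, mul_zero]
  have hD0 : ∀ N, D N = D 0 := by
    intro N
    induction N using Int.induction_on with
    | zero => rfl
    | succ i ih => rw [hsuc, ih]
    | pred i ih => rw [← hsuc, sub_add_cancel, ih]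
  have h2 : ∀ N, ∑' a : ℤ × ℤ, G (N, a) = thetaTerm (x * y) q N * D 0 := by
    intro N
    simp only [hG]
    rw [tsum_mul_left, ← hD0 N, (hDs2 N).tsum_prod]
    simp_rw [(hin N _).tsum_eq]
    rfl
  rw [tsum_congr h2, tsum_mul_right, tsum_thetaTerm hxy h0 hq, mul_comm]
  congr 1
  simp [hD, lambertSum]

lemma tsum_kronTerm_comm (x y q : ℂ) : ∑' a, kronTerm x y q a = ∑' a, kronTerm y x q a := by
  rw [← (Equiv.prodComm ℤ ℤ).tsum_eq]
  refine tsum_congr fun a => ?_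
  simp only [kronTerm, Equiv.prodComm_apply, Prod.fst_swap, Prod.snd_swap]
  rw [cone_comm, mul_comm a.2 a.1]; ring

/-- The residue of the partial fraction series at `x = 1`. -/
lemma tendsto_lambertSum_mul {q : ℂ} (h0 : q ≠ 0) (hq : ‖q‖ < 1) :
    Tendsto (fun y : ℝ => (1 - (y : ℂ)) * lambertSum y q) (𝓝[<] 1) (𝓝 1) := by
  have hq0 : 0 < ‖q‖ := norm_pos_iff.2 h0
  obtain ⟨c, hc, hc1⟩ := exists_between hq
  set δ := min (1 - ‖q‖) (c / ‖q‖ - 1) with hδ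
  have hδ0 : 0 < δ := lt_min (by linarith) (by rw [sub_pos, one_lt_div hq0]; exact hc)
  have hev : ∀ᶠ y : ℝ in 𝓝[<] 1, c < y ∧ y < 1 :=
    (eventually_nhdsWithin_of_eventually_nhds (lt_mem_nhds hc1)).and self_mem_nhdsWithin
  have hlow : ∀ y : ℝ, c < y → y < 1 → ∀ s : ℤ, s ≠ 0 → δ ≤ ‖1 - (y : ℂ) * q ^ s‖ := by
    intro y hy hy1 s hs
    have hy0 : 0 < y := hq0.trans (hc.trans hy)
    have hn : ‖(y : ℂ) * q ^ s‖ = y * ‖q‖ ^ s := by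
      rw [norm_mul, norm_zpow, Complex.norm_real, Real.norm_of_nonneg hy0.le]
    rcases lt_or_gt_of_ne hs with h | h
    · have h1 : ‖q‖ ^ (-1 : ℤ) ≤ ‖q‖ ^ s := zpow_le_zpow_right_of_le_one₀ hq0 hq.le (by omega)
      rw [zpow_neg_one] at h1
      have h2 := norm_sub_norm_le ((y : ℂ) * q ^ s) 1
      rw [norm_sub_rev, norm_one, hn] at h2
      refine (min_le_right _ _).trans (le_trans ?_ h2)
      rw [div_eq_mul_inv]
      gcongr
    · have h1 : ‖q‖ ^ s ≤ ‖q‖ ^ (1 : ℤ) := zpow_le_zpow_right_of_le_one₀ hq0 hq.le (by omega)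
      rw [zpow_one] at h1
      have h2 := norm_sub_norm_le 1 ((y : ℂ) * q ^ s)
      rw [norm_one, hn] at h2
      refine (min_le_left _ _).trans (le_trans ?_ h2)
      have : 0 < ‖q‖ ^ s := zpow_pos hq0 s
      nlinarith
  have hθ := (Equiv.addRight (1 : ℤ)).summable_iff.2 (summable_norm_thetaTerm one_ne_zero h0 hq)
  have key := tendsto_tsum_of_dominated_convergence (𝓕 := 𝓝[<] (1 : ℝ))
    (f := fun (y : ℝ) (s : ℤ) => (1 - (y : ℂ)) * ((-1) ^ s * q ^ binom2 (s + 1) *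
      (1 / (1 - y * q ^ s))))
    (g := fun s => if s = 0 then 1 else 0)
    (bound := fun s => ‖thetaTerm 1 q (s + 1)‖ * (1 + 1 / δ)) (hθ.mul_right _) ?_ ?_
  · simpa [lambertSum, tsum_mul_left] using key
  · intro s
    rcases eq_or_ne s 0 with rfl | hs
    · rw [if_pos rfl]
      refine tendsto_const_nhds.congr' ?_
      filter_upwards [hev] with y hy
      have : (1 - (y : ℂ)) ≠ 0 := by
        rw [sub_ne_zero]; exact_mod_cast hy.2.ne'
      simp [binom2_one, this]
    · rw [if_neg hs]
      have h1 : Tendsto (fun y : ℝ => (1 - y) * (‖q ^ binom2 (s + 1)‖ * (1 / δ))) (𝓝[<] 1)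
          (𝓝 ((1 - 1) * (‖q ^ binom2 (s + 1)‖ * (1 / δ)))) :=
        (Continuous.tendsto (by fun_prop) 1).mono_left nhdsWithin_le_nhds
      rw [sub_self, zero_mul] at h1
      refine squeeze_zero_norm' ?_ h1
      filter_upwards [hev] with y hy
      have hpos := hδ0.trans_le (hlow y hy.1 hy.2 s hs)
      rw [norm_mul, norm_mul, norm_mul, norm_neg_one_zpow, one_mul, norm_div, norm_one]
      have h3 : ‖1 - (y : ℂ)‖ = 1 - y := by
        rw [← Complex.ofReal_one, ← Complex.ofReal_sub, Complex.norm_real,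
          Real.norm_of_nonneg (by linarith [hy.2])]
      rw [h3]
      have : 0 ≤ 1 - y := by linarith [hy.2]
      gcongr
      exact hlow y hy.1 hy.2 s hs
  · filter_upwards [hev] with y hy s
    have hy0 : 0 < y := hq0.trans (hc.trans hy.1)
    have h3 : ‖1 - (y : ℂ)‖ = 1 - y := by
      rw [← Complex.ofReal_one, ← Complex.ofReal_sub, Complex.norm_real,
        Real.norm_of_nonneg (by linarith [hy.2])]
    rw [thetaTerm, one_zpow, mul_one, norm_mul, norm_mul, norm_mul, norm_mul, norm_neg_one_zpow,
      norm_neg_one_zpow, one_mul, norm_div, norm_one, mul_left_comm, h3]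
    have h4 : 0 ≤ 1 - y := by linarith [hy.2]
    gcongr
    rcases eq_or_ne s 0 with rfl | hs
    · rw [zpow_zero, mul_one, h3, mul_one_div_cancel (by linarith [hy.2])]
      have := one_div_pos.2 hδ0
      linarith
    · have h5 := hlow y hy.1 hy.2 s hs
      calc (1 - y) * (1 / ‖1 - (y : ℂ) * q ^ s‖) ≤ 1 * (1 / δ) := by
            gcongr
            linarith
        _ ≤ _ := by linarith

/-- The partial fraction expansion of the reciprocal theta function. -/
lemma lambertSum_mul_jTheta {x q : ℂ} (h0 : q ≠ 0) (hq : ‖q‖ < 1) (hx : ‖q‖ < ‖x‖)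
    (hx1 : ‖x‖ < 1) : lambertSum x q * jTheta x q = qPochInf q q ^ 3 := by
  have hq0 : 0 < ‖q‖ := norm_pos_iff.2 h0
  have hxn : 0 < ‖x‖ := hq0.trans hx
  -- `lambertSum y q * jTheta y q` does not depend on `y`; let `y → 1`
  have hconst : ∀ᶠ y : ℝ in 𝓝[<] 1,
      lambertSum y q * jTheta y q = lambertSum x q * jTheta x q := by
    have h1 : ‖q‖ / ‖x‖ < 1 := (div_lt_one hxn).2 hx
    filter_upwards [eventually_nhdsWithin_of_eventually_nhds (lt_mem_nhds h1),
      eventually_nhdsWithin_of_eventually_nhds (lt_mem_nhds hq), self_mem_nhdsWithin]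
      with y hy1 hy2 hy3
    have hy0 : 0 < y := hq0.trans hy2
    have hyn : ‖(y : ℂ)‖ = y := by rw [Complex.norm_real, Real.norm_of_nonneg hy0.le]
    have e1 := jTheta_mul_tsum_kronTerm h0 hq hx hx1 (by rwa [hyn]) (by rwa [hyn])
    have e2 := jTheta_mul_tsum_kronTerm h0 hq (x := (y : ℂ)) (by rwa [hyn]) (by rwa [hyn]) hx hx1
    rw [tsum_kronTerm_comm, mul_comm (y : ℂ)] at e2
    have hj : jTheta (x * y) q ≠ 0 := by
      refine jTheta_ne_zero_of_norm h0 hq ?_ ?_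
      · rw [norm_mul, hyn, mul_comm]; exact (div_lt_iff₀ hxn).1 hy1
      · rw [norm_mul, hyn]; simp only [Set.mem_Iio] at hy3; nlinarith
    refine mul_right_cancel₀ hj ?_
    linear_combination jTheta x q * e1 - jTheta y q * e2
  have hlim : Tendsto (fun y : ℝ => lambertSum y q * jTheta y q) (𝓝[<] 1)
      (𝓝 (1 * (qPochInf (1 * q) q * qPochInf (q / 1) q * qPochInf q q))) := by
    have hc : ContinuousAt (fun y : ℝ => qPochInf (y * q) q * qPochInf (q / y) q * qPochInf q q)
        1 := by
      have c1 := continuous_qPochInf hq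
      refine ContinuousAt.mul (ContinuousAt.mul ?_ ?_) continuousAt_const
      · exact (c1.comp (Complex.continuous_ofReal.mul continuous_const)).continuousAt
      · refine c1.continuousAt.comp (ContinuousAt.div continuousAt_const
          Complex.continuous_ofReal.continuousAt (by simp))
    have := (tendsto_lambertSum_mul h0 hq).mul (hc.tendsto.mono_left nhdsWithin_le_nhds)
    simp only [Complex.ofReal_one] at this
    refine this.congr fun y => ?_
    rw [jTheta, qPochInf_eq_mul hq (y : ℂ)]; ring
  have := tendsto_nhds_unique (tendsto_const_nhds.congr' (hconst.mono fun _ h => h.symm)) hlim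
  rw [this, one_mul, div_one]; ring_nf

/-- Kronecker's formula. -/
theorem hasSum_kronTerm {x y q : ℂ} (h0 : q ≠ 0) (hq : ‖q‖ < 1) (hx : ‖q‖ < ‖x‖)
    (hx1 : ‖x‖ < 1) (hy : ‖q‖ < ‖y‖) (hy1 : ‖y‖ < 1) :
    HasSum (kronTerm x y q)
      (qPochInf q q ^ 3 * jTheta (x * y) q / (jTheta x q * jTheta y q)) := by
  have hs := (summable_norm_kronTerm h0 hq hx hx1 hy hy1).of_norm
  refine hasSum_of_eq hs.hasSum (fun _ => rfl) ?_
  have h1 := jTheta_ne_zero_of_norm h0 hq hx hx1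
  have h2 := jTheta_ne_zero_of_norm h0 hq hy hy1
  rw [div_eq_iff (mul_ne_zero h1 h2), ← lambertSum_mul_jTheta h0 hq hx hx1]
  linear_combination -jTheta x q * jTheta_mul_tsum_kronTerm h0 hq hx hx1 hy hy1

/-! ### Decompositions of sums -/

/-- Splitting a sum along a partition of the index set into finitely many copies of `β`. -/
lemma tsum_eq_sum_tsum_of_bijective {α β ι : Type*} [Fintype ι] {f : α → ℂ} (hf : Summable f)
    (e : ι × β → α) (he : Function.Bijective e) :
    ∑' a, f a = ∑ i, ∑' b, f (e (i, b)) := by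
  have hs : Summable fun p => f (e p) := (Equiv.ofBijective e he).summable_iff.2 hf
  rw [← (Equiv.ofBijective e he).tsum_eq, ← tsum_fintype (L := .unconditional _), ← hs.tsum_prod]
  rfl

/-- A product of two theta functions as a combination of theta functions in base `q²`. -/
theorem jTheta_mul_jTheta {x y q : ℂ} (hx : x ≠ 0) (hy : y ≠ 0) (h0 : q ≠ 0) (hq : ‖q‖ < 1) :
    jTheta x q * jTheta y q = jTheta (-(x * y)) (q ^ 2) * jTheta (-(q * y / x)) (q ^ 2) -
      x * jTheta (-(q * x * y)) (q ^ 2) * jTheta (-(y / x)) (q ^ 2) := by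
  have hQ := norm_pow_lt_one hq two_ne_zero
  have hQ0 : q ^ 2 ≠ 0 := pow_ne_zero 2 h0
  have h1 : -(x * y) ≠ 0 := neg_ne_zero.2 (mul_ne_zero hx hy)
  have h2 : -(q * y / x) ≠ 0 := neg_ne_zero.2 (div_ne_zero (mul_ne_zero h0 hy) hx)
  have h3 : -(q * x * y) ≠ 0 := neg_ne_zero.2 (mul_ne_zero (mul_ne_zero h0 hx) hy)
  have h4 : -(y / x) ≠ 0 := neg_ne_zero.2 (div_ne_zero hy hx)
  have n := @summable_norm_thetaTerm
  rw [mul_assoc x]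
  rw [← tsum_thetaTerm hx h0 hq, ← tsum_thetaTerm hy h0 hq, ← tsum_thetaTerm h1 hQ0 hQ,
    ← tsum_thetaTerm h2 hQ0 hQ, ← tsum_thetaTerm h3 hQ0 hQ, ← tsum_thetaTerm h4 hQ0 hQ,
    tsum_mul_tsum_of_summable_norm (n hx h0 hq) (n hy h0 hq),
    tsum_mul_tsum_of_summable_norm (n h1 hQ0 hQ) (n h2 hQ0 hQ),
    tsum_mul_tsum_of_summable_norm (n h3 hQ0 hQ) (n h4 hQ0 hQ), ← tsum_mul_left]
  have hs := summable_mul_of_summable_norm (n hx h0 hq) (n hy h0 hq)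
  rw [tsum_eq_sum_tsum_of_bijective hs
    (fun p : Fin 2 × (ℤ × ℤ) => (p.2.1 - p.2.2 + (p.1 : ℤ), p.2.1 + p.2.2)), Fin.sum_univ_two,
    sub_eq_add_neg, ← tsum_neg]
  · have hb : ∀ a : ℤ, (q ^ 2) ^ binom2 a = q ^ (2 * binom2 a) := fun a => by
      rw [zpow_mul]; norm_cast
    congr 1 <;> refine tsum_congr fun p => ?_ <;> obtain ⟨a, b⟩ := p
    · simp only [thetaTerm, Fin.val_zero, Nat.cast_zero, add_zero]
      have e : q ^ binom2 (a - b) * q ^ binom2 (a + b) = q ^ (2 * binom2 a) *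
          (q ^ (2 * binom2 b) * q ^ b) := by
        rw [← zpow_add₀ h0, ← zpow_add₀ h0, ← zpow_add₀ h0, binom2_sub, binom2_add]; congr 1; ring
      rw [hb, hb, neg_one_zpow_sub, zpow_sub₀ hx, zpow_add₀ hy, neg_eq_neg_one_mul (x * y),
        neg_eq_neg_one_mul (q * y / x), mul_zpow (-1 : ℂ), mul_zpow (-1 : ℂ), mul_zpow x,
        div_zpow, mul_zpow q, zpow_add₀ (by norm_num)]
      linear_combination ((-1) ^ a * (-1) ^ b) ^ 2 * (x ^ a / x ^ b * y ^ a * y ^ b) * e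
    · simp only [thetaTerm, Fin.val_one, Nat.cast_one]
      have e : q ^ binom2 (a - b + 1) * q ^ binom2 (a + b) = q ^ (2 * binom2 a) * q ^ a *
          q ^ (2 * binom2 b) := by
        rw [← zpow_add₀ h0, ← zpow_add₀ h0, ← zpow_add₀ h0, binom2_add (a - b), binom2_one,
          binom2_sub, binom2_add]; congr 1; ring
      rw [hb, hb, zpow_add₀ (by norm_num) (a - b), neg_one_zpow_sub, zpow_add₀ hx, zpow_sub₀ hx,
        zpow_add₀ hy, neg_eq_neg_one_mul (q * x * y),
        neg_eq_neg_one_mul (y / x), mul_zpow (-1 : ℂ), mul_zpow (-1 : ℂ), mul_zpow _ y,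
        div_zpow, mul_zpow q, zpow_add₀ (by norm_num), zpow_one, zpow_one]
      linear_combination -((-1) ^ a * (-1) ^ b) ^ 2 * (x ^ a / x ^ b * y ^ a * y ^ b) * x * e
  · constructor
    · rintro ⟨i, a, b⟩ ⟨i', a', b'⟩ h
      simp only [Prod.mk.injEq] at h
      have := i.2; have := i'.2
      simp only [Prod.mk.injEq, Fin.ext_iff]; omega
    · rintro ⟨m, k⟩
      refine ⟨(⟨((m + k) % 2).toNat, by omega⟩, ((m + k) / 2, k - (m + k) / 2)), ?_⟩
      simp only [Prod.mk.injEq]; omega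

/-- The identity of sign functions behind the splitting of the triple sums. -/
lemma cone_split (k l t a : ℤ) :
    cone k l = cone k (t - k - a) + cone l (-t - l) + cone (k - t + a - 1) (l + t - 1) := by
  have h : ∀ m : ℤ, (sg (-m - 1) : ℂ) = -(sg m : ℂ) := by
    intro m
    rcases le_or_gt 0 m with hm | hm
    · rw [sg, sg, if_neg (by omega), if_pos hm]; norm_num
    · rw [sg, sg, if_pos (by omega), if_neg (by omega)]; norm_num
  have h1 := h (t - k - a)
  have h2 := h (-t - l)
  rw [show -(t - k - a) - 1 = k - t + a - 1 by ring] at h1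
  rw [show -(-t - l) - 1 = l + t - 1 by ring] at h2
  simp only [cone, Int.cast_add]
  rw [h1, h2]; ring

/-! ### Hecke-type double sums -/

lemma summable_norm_cone {α : Type*} {q : ℂ} (h0 : q ≠ 0) (hq : ‖q‖ < 1) (k l E : α → ℤ)
    (ε : α → ℂ) (C : ℤ) (hinj : Function.Injective fun a => (k a, l a)) (hε : ∀ a, ‖ε a‖ = 1)
    (h1 : ∀ a, 0 ≤ k a → 0 ≤ l a → k a + l a ≤ E a + C)
    (h2 : ∀ a, k a < 0 → l a < 0 → -k a - l a ≤ E a + C) :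
    Summable fun a => ‖cone (k a) (l a) * (ε a * q ^ E a)‖ := by
  have hq0 : 0 < ‖q‖ := norm_pos_iff.2 h0
  have hs := ((summable_pow_natAbs_add hq0.le hq).comp_injective hinj).mul_left (‖q‖ ^ (-C))
  refine Summable.of_nonneg_of_le (fun _ => norm_nonneg _) (fun a => ?_) hs
  simp only [Function.comp_apply]
  have key : ((k a).natAbs + (l a).natAbs : ℤ) ≤ E a + C →
      ‖ε a * q ^ E a‖ ≤ ‖q‖ ^ (-C) * ‖q‖ ^ ((k a).natAbs + (l a).natAbs) := by
    intro h
    rw [norm_mul, hε, one_mul, norm_zpow, ← zpow_natCast, ← zpow_add₀ hq0.ne']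
    exact zpow_le_zpow_right_of_le_one₀ hq0 hq.le (by omega)
  refine norm_cone_mul_le (by positivity) (fun hk hl => key ?_) (fun hk hl => key ?_)
  · have := h1 a hk hl; omega
  · have := h2 a hk hl; omega

lemma heckeTerm_eq (a b c : ℤ) (x y q : ℂ) (p : ℤ × ℤ) :
    heckeTerm a b c x y q p = cone p.1 p.2 * ((-1) ^ (p.1 + p.2) * x ^ p.1 * y ^ p.2 *
      q ^ (a * binom2 p.1 + b * p.1 * p.2 + c * binom2 p.2)) := by
  rw [heckeTerm, cone]
  split_ifs with h
  · rw [← h]; push_cast; ring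
  · have : sg p.1 + sg p.2 = 0 := by
      unfold sg at *; split_ifs at * <;> simp_all
    rw [this]; simp

lemma heckeBarTerm_eq (a b c : ℤ) (x y q : ℂ) (p : ℤ × ℤ) :
    heckeBarTerm a b c x y q p = cone p.1 p.2 * ((sg p.1 : ℂ) * ((-1) ^ (p.1 + p.2) * x ^ p.1 *
      y ^ p.2 * q ^ (a * binom2 p.1 + b * p.1 * p.2 + c * binom2 p.2))) := by
  rw [heckeBarTerm, cone]
  split_ifs with h
  · rw [← h]
    have : (sg p.1 : ℂ) * sg p.1 = 1 := by unfold sg; split_ifs <;> norm_num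
    push_cast
    linear_combination -((-1) ^ (p.1 + p.2) * x ^ p.1 * y ^ p.2 *
      q ^ (a * binom2 p.1 + b * p.1 * p.2 + c * binom2 p.2)) * this
  · have : sg p.1 + sg p.2 = 0 := by
      unfold sg at *; split_ifs at * <;> simp_all
    rw [this]; simp

/-- The exponent of `q` in `f_{1,b,1}(q^x, q^y, q^{2m})`. -/
lemma zpow_hecke_exponent {q : ℂ} (h0 : q ≠ 0) (x y m : ℕ) (b r s : ℤ) :
    (q ^ x) ^ r * (q ^ y) ^ s * (q ^ (2 * m)) ^ (1 * binom2 r + b * r * s + 1 * binom2 s) =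
      q ^ (m * (r * r + 2 * b * r * s + s * s - r - s) + x * r + y * s) := by
  rw [← zpow_natCast, ← zpow_natCast, ← zpow_natCast, ← zpow_mul, ← zpow_mul, ← zpow_mul,
    ← zpow_add₀ h0, ← zpow_add₀ h0]
  congr 1
  push_cast
  linear_combination (m : ℤ) * two_mul_binom2 r + m * two_mul_binom2 s

lemma heckeTerm_pow {q : ℂ} (h0 : q ≠ 0) (x y m : ℕ) (b : ℤ) (p : ℤ × ℤ) :
    heckeTerm 1 b 1 (q ^ x) (q ^ y) (q ^ (2 * m)) p = cone p.1 p.2 * ((-1) ^ (p.1 + p.2) *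
      q ^ (m * (p.1 * p.1 + 2 * b * p.1 * p.2 + p.2 * p.2 - p.1 - p.2) + x * p.1 + y * p.2)) := by
  rw [heckeTerm_eq, ← zpow_hecke_exponent h0]; ring

lemma heckeBarTerm_pow {q : ℂ} (h0 : q ≠ 0) (x y m : ℕ) (b : ℤ) (p : ℤ × ℤ) :
    heckeBarTerm 1 b 1 (-q ^ x) (-q ^ y) (q ^ (2 * m)) p = cone p.1 p.2 * ((sg p.1 : ℂ) *
      q ^ (m * (p.1 * p.1 + 2 * b * p.1 * p.2 + p.2 * p.2 - p.1 - p.2) + x * p.1 + y * p.2)) := by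
  have h : (-1 : ℂ) ^ (p.1 + p.2) * (-1) ^ (p.1 + p.2) = 1 := by rw [← mul_zpow]; simp
  have h' : (-1 : ℂ) ^ (p.1 + p.2) = (-1) ^ p.1 * (-1) ^ p.2 := zpow_add₀ (by norm_num) _ _
  rw [heckeBarTerm_eq, ← zpow_hecke_exponent h0, neg_eq_neg_one_mul (q ^ x),
    neg_eq_neg_one_mul (q ^ y), mul_zpow (-1 : ℂ), mul_zpow (-1 : ℂ)]
  rw [h'] at h ⊢
  linear_combination cone p.1 p.2 * sg p.1 * ((q ^ x) ^ p.1 * (q ^ y) ^ p.2 *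
    (q ^ (2 * m)) ^ (1 * binom2 p.1 + b * p.1 * p.2 + 1 * binom2 p.2)) * h

/-- For `3 ≤ b`, `1 ≤ m` the quadratic part of the exponent dominates every linear form on the
cone. -/
lemma hecke_exponent_bound {m : ℕ} {b : ℤ} (hm : 1 ≤ m) (hb : 3 ≤ b) (x y : ℕ) {r s : ℤ}
    (h : (0 ≤ r ∧ 0 ≤ s) ∨ (r < 0 ∧ s < 0)) :
    |r| + |s| ≤ m * (r * r + 2 * b * r * s + s * s - r - s) + x * r + y * s +
      ((x : ℤ) + 2) ^ 2 + ((y : ℤ) + 2) ^ 2 := by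
  have hrs : 0 ≤ r * s := by
    rcases h with h | h
    · exact mul_nonneg h.1 h.2
    · exact (mul_pos_of_neg_of_neg h.1 h.2).le
  have hm' : (1 : ℤ) ≤ m := by exact_mod_cast hm
  have hsq : ∀ t : ℤ, 0 ≤ t * t - t := fun t => by
    have := two_mul_binom2 t
    rcases le_or_gt t 0 with h | h
    · nlinarith
    · nlinarith
  have h1 : (r * r - r) + (s * s - s) + 6 * (r * s) ≤
      m * (r * r + 2 * b * r * s + s * s - r - s) := by
    nlinarith [hsq r, hsq s, mul_nonneg (sub_nonneg.2 hb) hrs, mul_nonneg (sub_nonneg.2 hm')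
      (add_nonneg (add_nonneg (hsq r) (hsq s)) (mul_nonneg (by linarith : 0 ≤ 2 * b) hrs))]
  have h2 : ∀ (t : ℤ) (z : ℕ), |t| ≤ t * t - t + z * t + ((z : ℤ) + 2) ^ 2 := by
    intro t z
    have hz : (0 : ℤ) ≤ z := Int.natCast_nonneg z
    rcases abs_cases t with ⟨h, _⟩ | ⟨h, _⟩ <;> rw [h]
    · nlinarith [sq_nonneg (t - 1)]
    · nlinarith [sq_nonneg (2 * t + z)]
  have h3 := h2 r x
  have h4 := h2 s y
  nlinarith

lemma summable_heckeTerm_pow {q : ℂ} (h0 : q ≠ 0) (hq : ‖q‖ < 1) {m : ℕ} {b : ℤ} (hm : 1 ≤ m)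
    (hb : 3 ≤ b) (x y : ℕ) :
    Summable fun p => ‖heckeTerm 1 b 1 (q ^ x) (q ^ y) (q ^ (2 * m)) p‖ := by
  simp_rw [heckeTerm_pow h0]
  refine summable_norm_cone h0 hq (fun p : ℤ × ℤ => p.1) (fun p => p.2) _ _
    (((x : ℤ) + 2) ^ 2 + ((y : ℤ) + 2) ^ 2) (fun _ _ h => h) (fun p => norm_neg_one_zpow _)
    (fun p h1 h2 => ?_) (fun p h1 h2 => ?_)
  · have := hecke_exponent_bound hm hb x y (Or.inl ⟨h1, h2⟩)
    rw [abs_of_nonneg h1, abs_of_nonneg h2] at this; linarith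
  · have := hecke_exponent_bound hm hb x y (Or.inr ⟨h1, h2⟩)
    rw [abs_of_neg h1, abs_of_neg h2] at this; linarith

lemma norm_sg (k : ℤ) : ‖(sg k : ℂ)‖ = 1 := by unfold sg; split_ifs <;> simp

lemma summable_heckeBarTerm_pow {q : ℂ} (h0 : q ≠ 0) (hq : ‖q‖ < 1) {m : ℕ} {b : ℤ} (hm : 1 ≤ m)
    (hb : 3 ≤ b) (x y : ℕ) :
    Summable fun p => ‖heckeBarTerm 1 b 1 (-q ^ x) (-q ^ y) (q ^ (2 * m)) p‖ := by
  simp_rw [heckeBarTerm_pow h0]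
  refine summable_norm_cone h0 hq (fun p : ℤ × ℤ => p.1) (fun p => p.2) _ _
    (((x : ℤ) + 2) ^ 2 + ((y : ℤ) + 2) ^ 2) (fun _ _ h => h) (fun p => norm_sg _)
    (fun p h1 h2 => ?_) (fun p h1 h2 => ?_)
  · have := hecke_exponent_bound hm hb x y (Or.inl ⟨h1, h2⟩)
    rw [abs_of_nonneg h1, abs_of_nonneg h2] at this; linarith
  · have := hecke_exponent_bound hm hb x y (Or.inr ⟨h1, h2⟩)
    rw [abs_of_neg h1, abs_of_neg h2] at this; linarith

/-- Summation over the cone `|j| ≤ n` and its negative, along rows. -/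
lemma hasSum_nat_of_cone {g : ℤ → ℤ → ℂ}
    (hs : Summable fun p : ℤ × ℤ => cone (p.1 + p.2) (p.1 - p.2) * g p.1 p.2) :
    HasSum (fun m : ℕ => ∑ j ∈ Finset.Icc (-(m : ℤ)) m, (g m j - g (-m - 1) j))
      (∑' p : ℤ × ℤ, cone (p.1 + p.2) (p.1 - p.2) * g p.1 p.2) := by
  have h := hs.prod.hasSum.nat_add_neg_add_one
  rw [← hs.tsum_prod] at h
  refine hasSum_of_eq h (fun m => ?_) rfl
  rw [Finset.sum_sub_distrib, sub_eq_add_neg, ← Finset.sum_neg_distrib]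
  congr 1
  · rw [tsum_eq_sum (s := Finset.Icc (-(m : ℤ)) m)]
    · refine Finset.sum_congr rfl fun j hj => ?_
      rw [Finset.mem_Icc] at hj
      rw [cone_of_nonneg (by omega) (by omega), one_mul]
    · intro j hj
      simp only [Finset.mem_Icc, not_and_or, not_le] at hj
      rcases hj with hj | hj
      · rw [cone_of_neg_of_nonneg (by omega) (by omega), zero_mul]
      · rw [cone_of_nonneg_of_neg (by omega) (by omega), zero_mul]
  · rw [tsum_eq_sum (s := Finset.Icc (-(m : ℤ)) m)]
    · refine Finset.sum_congr rfl fun j hj => ?_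
      rw [Finset.mem_Icc] at hj
      rw [cone_of_neg (by omega) (by omega), neg_one_mul, neg_add']
    · intro j hj
      simp only [Finset.mem_Icc, not_and_or, not_le] at hj
      rcases hj with hj | hj
      · rw [cone_of_neg_of_nonneg (by omega) (by omega), zero_mul]
      · rw [cone_of_nonneg_of_neg (by omega) (by omega), zero_mul]

/-- The cone sum over all `(n,j)`, split according to the parity of `n + j`. -/
lemma tsum_cone_parity {g : ℤ → ℤ → ℂ}
    (hs : Summable fun p : ℤ × ℤ => cone (p.1 + p.2) (p.1 - p.2) * g p.1 p.2) :
    ∑' p : ℤ × ℤ, cone (p.1 + p.2) (p.1 - p.2) * g p.1 p.2 =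
      ∑' p : ℤ × ℤ, cone p.1 p.2 * g (p.1 + p.2) (p.1 - p.2) +
      ∑' p : ℤ × ℤ, cone p.1 p.2 * g (p.1 + p.2 + 1) (p.1 - p.2) := by
  rw [tsum_eq_sum_tsum_of_bijective hs
    (fun p : Fin 2 × (ℤ × ℤ) => (p.2.1 + p.2.2 + (p.1 : ℤ), p.2.1 - p.2.2)), Fin.sum_univ_two]
  · have hc : ∀ r s r' s' : ℤ, (0 ≤ r ↔ 0 ≤ r') → (0 ≤ s ↔ 0 ≤ s') → cone r s = cone r' s' := by
      intro r s r' s' h1 h2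
      simp only [cone, sg, h1, h2]
    congr 1 <;> refine tsum_congr fun p => ?_
    · simp only [Fin.val_zero, Nat.cast_zero, add_zero]
      rw [hc _ _ p.1 p.2 (by omega) (by omega)]
    · simp only [Fin.val_one, Nat.cast_one]
      rw [hc _ _ p.1 p.2 (by omega) (by omega)]
  · constructor
    · rintro ⟨i, a, b⟩ ⟨i', a', b'⟩ h
      simp only [Prod.mk.injEq] at h
      have := i.2; have := i'.2
      simp only [Prod.mk.injEq, Fin.ext_iff]; omega
    · rintro ⟨m, k⟩
      refine ⟨(⟨((m + k) % 2).toNat, by omega⟩, ((m + k) / 2, (m + k) / 2 - k)), ?_⟩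
      simp only [Prod.mk.injEq]; omega

/-- Absolute convergence of the double sums over `|j| ≤ n`. -/
lemma summable_norm_cone_sub {q : ℂ} (h0 : q ≠ 0) (hq : ‖q‖ < 1) {a b : ℤ} (ha : 3 ≤ a)
    (hb : 3 ≤ b) (ε : ℤ × ℤ → ℂ) (hε : ∀ p, ‖ε p‖ = 1) :
    Summable fun p : ℤ × ℤ => ‖cone (p.1 + p.2) (p.1 - p.2) *
      (ε p * q ^ (a * p.1 ^ 2 + b * p.1 - 2 * p.2 ^ 2 - p.2))‖ := by
  refine summable_norm_cone h0 hq (fun p : ℤ × ℤ => p.1 + p.2) (fun p => p.1 - p.2) _ ε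
    (b ^ 2 + 4) (fun p p' h => ?_) hε (fun p h1 h2 => ?_) (fun p h1 h2 => ?_)
  · simp only [Prod.mk.injEq] at h; ext <;> omega
  · nlinarith [mul_nonneg h1 h2, mul_nonneg (sub_nonneg.2 ha) (sq_nonneg p.1),
      mul_nonneg (sub_nonneg.2 hb) (by linarith : 0 ≤ p.1), sq_nonneg p.1]
  · have h3 : p.1 < 0 := by linarith
    nlinarith [mul_pos_of_neg_of_neg h1 h2, mul_nonneg (sub_nonneg.2 ha) (sq_nonneg p.1),
      sq_nonneg (2 * p.1 + b), sq_nonneg (p.1 + b)]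

lemma neg_one_zpow_congr {a b : ℤ} (m : ℤ) (h : a = b + 2 * m) : (-1 : ℂ) ^ a = (-1) ^ b := by
  rw [h, zpow_add₀ (by norm_num), zpow_mul]; norm_num

lemma neg_one_zpow_succ_congr {a b : ℤ} (m : ℤ) (h : a = b + 1 + 2 * m) :
    (-1 : ℂ) ^ a = -(-1) ^ b := by
  rw [neg_one_zpow_congr m h, zpow_add₀ (by norm_num)]; simp

lemma cone_mul_congr {r s : ℤ} {u v : ℂ} (h1 : 0 ≤ r → 0 ≤ s → u = v) (h2 : r < 0 → s < 0 → u = v) :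
    cone r s * u = cone r s * v := by
  rcases le_or_gt 0 r with hr | hr <;> rcases le_or_gt 0 s with hs | hs
  · rw [h1 hr hs]
  · rw [cone_of_nonneg_of_neg hr hs, zero_mul, zero_mul]
  · rw [cone_of_neg_of_nonneg hr hs, zero_mul, zero_mul]
  · rw [h2 hr hs]

lemma cone_neg_sub (r s : ℤ) : cone (-1 - s) (-1 - r) = -cone r s := by
  rcases le_or_gt 0 r with hr | hr <;> rcases le_or_gt 0 s with hs | hs
  · rw [cone_of_nonneg hr hs, cone_of_neg (by omega) (by omega)]
  · rw [cone_of_nonneg_of_neg hr hs, cone_of_nonneg_of_neg (by omega) (by omega), neg_zero]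
  · rw [cone_of_neg_of_nonneg hr hs, cone_of_neg_of_nonneg (by omega) (by omega), neg_zero]
  · rw [cone_of_neg hr hs, cone_of_nonneg (by omega) (by omega), neg_neg]

/-- The reflection `(r,s) ↦ (-1-s,-1-r)` of a Hecke-type double sum. -/
lemma heckeF_reflect {q : ℂ} (h0 : q ≠ 0) {x y x' y' c m : ℕ} {b : ℤ}
    (hx : (x' : ℤ) = m * (4 + 2 * b) - y) (hy : (y' : ℤ) = m * (4 + 2 * b) - x)
    (hc : (c : ℤ) = m * (4 + 2 * b) - x - y) :
    heckeF 1 b 1 (q ^ x) (q ^ y) (q ^ (2 * m)) =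
      -(q ^ c * heckeF 1 b 1 (q ^ x') (q ^ y') (q ^ (2 * m))) := by
  let e : ℤ × ℤ ≃ ℤ × ℤ :=
    { toFun := fun a => (-1 - a.2, -1 - a.1)
      invFun := fun a => (-1 - a.2, -1 - a.1)
      left_inv := fun a => by ext <;> dsimp <;> ring
      right_inv := fun a => by ext <;> dsimp <;> ring }
  rw [heckeF, heckeF, ← e.tsum_eq, ← tsum_mul_left, ← tsum_neg]
  refine tsum_congr fun p => ?_
  rw [heckeTerm_pow h0, heckeTerm_pow h0]
  simp only [e, Equiv.coe_fn_mk]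
  rw [cone_neg_sub, neg_one_zpow_congr (b := p.1 + p.2) (-1 - p.1 - p.2) (by ring),
    mul_left_comm (q ^ c), mul_left_comm (q ^ c), ← zpow_natCast q c, ← zpow_add₀ h0, neg_mul]
  congr 4
  rw [hx, hy, hc]; ring

/-- The double sum of `T_1^{(8)}(-q)`. -/
lemma tsum_cone_T {q : ℂ} (h0 : q ≠ 0) (hq : ‖q‖ < 1) :
    ∑' p : ℤ × ℤ, cone (p.1 + p.2) (p.1 - p.2) *
      ((-1) ^ p.1 * q ^ (4 * p.1 ^ 2 + 3 * p.1 - 2 * p.2 ^ 2 - p.2)) =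
    heckeF 1 3 1 (q ^ 4) (q ^ 6) (q ^ 4) - q ^ 7 * heckeF 1 3 1 (q ^ 12) (q ^ 14) (q ^ 4) := by
  have hs := summable_norm_cone_sub h0 hq (a := 4) (b := 3) (by norm_num) (by norm_num)
    (fun p => (-1) ^ p.1) (fun p => norm_neg_one_zpow _)
  rw [tsum_cone_parity (g := fun n j => (-1) ^ n * q ^ (4 * n ^ 2 + 3 * n - 2 * j ^ 2 - j))
    hs.of_norm, heckeF, heckeF, ← tsum_mul_left, sub_eq_add_neg, ← tsum_neg]
  congr 1 <;> refine tsum_congr fun p => ?_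
  · rw [show (4 : ℕ) = 2 * 2 by rfl, heckeTerm_pow h0]
    congr 3
    push_cast; ring
  · rw [show (q ^ 4 : ℂ) = q ^ (2 * 2) by rfl, heckeTerm_pow h0,
      neg_one_zpow_succ_congr (b := p.1 + p.2) 0 (by ring), mul_left_comm (q ^ 7),
      mul_left_comm (q ^ 7), ← zpow_natCast q 7, ← zpow_add₀ h0, neg_mul, mul_neg]
    congr 4
    push_cast; ring

/-- The double sum of `ψ_-^{(6)}`. -/
lemma tsum_cone_psi {q : ℂ} (h0 : q ≠ 0) (hq : ‖q‖ < 1) :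
    ∑' p : ℤ × ℤ, cone (p.1 + p.2) (p.1 - p.2) *
      ((-1) ^ p.1 * q ^ (3 * p.1 ^ 2 + 3 * p.1 - 2 * p.2 ^ 2 - p.2)) =
    heckeF 1 5 1 (q ^ 3) (q ^ 5) (q ^ 2) - q ^ 6 * heckeF 1 5 1 (q ^ 9) (q ^ 11) (q ^ 2) := by
  have hs := summable_norm_cone_sub h0 hq (a := 3) (b := 3) (by norm_num) (by norm_num)
    (fun p => (-1) ^ p.1) (fun p => norm_neg_one_zpow _)
  rw [tsum_cone_parity (g := fun n j => (-1) ^ n * q ^ (3 * n ^ 2 + 3 * n - 2 * j ^ 2 - j))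
    hs.of_norm, heckeF, heckeF, ← tsum_mul_left, sub_eq_add_neg, ← tsum_neg]
  congr 1 <;> refine tsum_congr fun p => ?_
  · rw [show (q ^ 2 : ℂ) = q ^ (2 * 1) by rfl, heckeTerm_pow h0]
    congr 3
    push_cast; ring
  · rw [show (q ^ 2 : ℂ) = q ^ (2 * 1) by rfl, heckeTerm_pow h0,
      neg_one_zpow_succ_congr (b := p.1 + p.2) 0 (by ring), mul_left_comm (q ^ 6),
      mul_left_comm (q ^ 6), ← zpow_natCast q 6, ← zpow_add₀ h0, neg_mul, mul_neg]
    congr 4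
    push_cast; ring

/-- The double sum of `V_1^{(8)}`. -/
lemma tsum_cone_V {q : ℂ} (h0 : q ≠ 0) (hq : ‖q‖ < 1) :
    ∑' p : ℤ × ℤ, cone (p.1 + p.2) (p.1 - p.2) *
      ((-1) ^ p.1 * q ^ (4 * p.1 ^ 2 + 4 * p.1 - 2 * p.2 ^ 2 - p.2)) =
    heckeF 1 3 1 (q ^ 5) (q ^ 7) (q ^ 4) - q ^ 8 * heckeF 1 3 1 (q ^ 13) (q ^ 15) (q ^ 4) := by
  have hs := summable_norm_cone_sub h0 hq (a := 4) (b := 4) (by norm_num) (by norm_num)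
    (fun p => (-1) ^ p.1) (fun p => norm_neg_one_zpow _)
  rw [tsum_cone_parity (g := fun n j => (-1) ^ n * q ^ (4 * n ^ 2 + 4 * n - 2 * j ^ 2 - j))
    hs.of_norm, heckeF, heckeF, ← tsum_mul_left, sub_eq_add_neg, ← tsum_neg]
  congr 1 <;> refine tsum_congr fun p => ?_
  · rw [show (q ^ 4 : ℂ) = q ^ (2 * 2) by rfl, heckeTerm_pow h0]
    congr 3
    push_cast; ring
  · rw [show (q ^ 4 : ℂ) = q ^ (2 * 2) by rfl, heckeTerm_pow h0,
      neg_one_zpow_succ_congr (b := p.1 + p.2) 0 (by ring), mul_left_comm (q ^ 8),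
      mul_left_comm (q ^ 8), ← zpow_natCast q 8, ← zpow_add₀ h0, neg_mul, mul_neg]
    congr 4
    push_cast; ring

/-- The terms with `n < 0` give the summand `q^{2n+1}` of the factor `1 + q^{2n+1}`. -/
lemma hasSum_T_of_cone {q : ℂ} (h0 : q ≠ 0) (hq : ‖q‖ < 1) :
    HasSum (fun n : ℕ => (1 + q ^ (2 * n + 1)) * (-1) ^ n *
        ∑ j ∈ Finset.Icc (-(n : ℤ)) n, q ^ (4 * (n : ℤ) ^ 2 + 3 * n - 2 * j ^ 2 - j))
      (heckeF 1 3 1 (q ^ 4) (q ^ 6) (q ^ 4) - q ^ 7 * heckeF 1 3 1 (q ^ 12) (q ^ 14) (q ^ 4)) := by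
  have hs := summable_norm_cone_sub h0 hq (a := 4) (b := 3) (by norm_num) (by norm_num)
    (fun p => (-1) ^ p.1) (fun p => norm_neg_one_zpow _)
  refine hasSum_of_eq (hasSum_nat_of_cone
    (g := fun n j => (-1) ^ n * q ^ (4 * n ^ 2 + 3 * n - 2 * j ^ 2 - j)) hs.of_norm)
    (fun n => ?_) (tsum_cone_T h0 hq).symm
  rw [Finset.mul_sum]
  refine Finset.sum_congr rfl fun j _ => ?_
  rw [neg_one_zpow_succ_congr (a := -(n : ℤ) - 1) (b := n) (-n - 1) (by ring),
    show 4 * (-(n : ℤ) - 1) ^ 2 + 3 * (-(n : ℤ) - 1) - 2 * j ^ 2 - j =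
      ((2 * n + 1 : ℕ) : ℤ) + (4 * n ^ 2 + 3 * n - 2 * j ^ 2 - j) by push_cast; ring,
    zpow_add₀ h0 ((2 * n + 1 : ℕ) : ℤ), zpow_natCast, zpow_natCast]
  ring

/-- The terms with `n < 0` repeat those with `n ≥ 0`, whence the factor `1/2`. -/
lemma hasSum_psi_of_cone {q : ℂ} (h0 : q ≠ 0) (hq : ‖q‖ < 1) :
    HasSum (fun n : ℕ => (-1) ^ n *
        ∑ j ∈ Finset.Icc (-(n : ℤ)) n, q ^ (3 * (n : ℤ) ^ 2 + 3 * n - 2 * j ^ 2 - j))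
      (1 / 2 * (heckeF 1 5 1 (q ^ 3) (q ^ 5) (q ^ 2) -
        q ^ 6 * heckeF 1 5 1 (q ^ 9) (q ^ 11) (q ^ 2))) := by
  have hs := summable_norm_cone_sub h0 hq (a := 3) (b := 3) (by norm_num) (by norm_num)
    (fun p => (-1) ^ p.1) (fun p => norm_neg_one_zpow _)
  refine hasSum_of_eq ((hasSum_nat_of_cone
    (g := fun n j => (-1) ^ n * q ^ (3 * n ^ 2 + 3 * n - 2 * j ^ 2 - j)) hs.of_norm).mul_left _)
    (fun n => ?_) (by rw [tsum_cone_psi h0 hq])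
  rw [Finset.mul_sum, Finset.mul_sum]
  refine Finset.sum_congr rfl fun j _ => ?_
  rw [neg_one_zpow_succ_congr (a := -(n : ℤ) - 1) (b := n) (-n - 1) (by ring),
    show 3 * (-(n : ℤ) - 1) ^ 2 + 3 * (-(n : ℤ) - 1) - 2 * j ^ 2 - j =
      3 * n ^ 2 + 3 * n - 2 * j ^ 2 - j by ring, zpow_natCast]
  ring

/-- The terms with `n < 0` repeat those with `n ≥ 0`, whence the factor `1/2`. -/
lemma hasSum_V_of_cone {q : ℂ} (h0 : q ≠ 0) (hq : ‖q‖ < 1) :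
    HasSum (fun n : ℕ => (-1) ^ n *
        ∑ j ∈ Finset.Icc (-(n : ℤ)) n, q ^ (4 * (n : ℤ) ^ 2 + 4 * n - 2 * j ^ 2 - j))
      (1 / 2 * (heckeF 1 3 1 (q ^ 5) (q ^ 7) (q ^ 4) -
        q ^ 8 * heckeF 1 3 1 (q ^ 13) (q ^ 15) (q ^ 4))) := by
  have hs := summable_norm_cone_sub h0 hq (a := 4) (b := 4) (by norm_num) (by norm_num)
    (fun p => (-1) ^ p.1) (fun p => norm_neg_one_zpow _)
  refine hasSum_of_eq ((hasSum_nat_of_cone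
    (g := fun n j => (-1) ^ n * q ^ (4 * n ^ 2 + 4 * n - 2 * j ^ 2 - j)) hs.of_norm).mul_left _)
    (fun n => ?_) (by rw [tsum_cone_V h0 hq])
  rw [Finset.mul_sum, Finset.mul_sum]
  refine Finset.sum_congr rfl fun j _ => ?_
  rw [neg_one_zpow_succ_congr (a := -(n : ℤ) - 1) (b := n) (-n - 1) (by ring),
    show 4 * (-(n : ℤ) - 1) ^ 2 + 4 * (-(n : ℤ) - 1) - 2 * j ^ 2 - j =
      4 * n ^ 2 + 4 * n - 2 * j ^ 2 - j by ring, zpow_natCast]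
  ring

/-- Here the terms with `n < 0` enter with the same sign as those with `n ≥ 0`: the sign of `cone`
is cancelled by a factor `sg n`. -/
lemma hasSum_alt_of_cone {q : ℂ} (h0 : q ≠ 0) (hq : ‖q‖ < 1) :
    HasSum (fun n : ℕ => ∑ j ∈ Finset.Icc (-(n : ℤ)) n,
        (1 + q ^ (2 * n + 1)) * q ^ (4 * (n : ℤ) ^ 2 + 3 * n - 2 * j ^ 2 - j))
      (heckeFbar 1 3 1 (-q ^ 4) (-q ^ 6) (q ^ 4) +
        q ^ 7 * heckeFbar 1 3 1 (-q ^ 12) (-q ^ 14) (q ^ 4)) := by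
  have hs := (summable_norm_cone_sub h0 hq (a := 4) (b := 3) (by norm_num) (by norm_num)
    (fun p => (sg p.1 : ℂ)) (fun p => norm_sg _)).of_norm
  refine hasSum_of_eq (hasSum_nat_of_cone
    (g := fun n j => (sg n : ℂ) * q ^ (4 * n ^ 2 + 3 * n - 2 * j ^ 2 - j)) hs)
    (fun n => ?_) ?_
  · refine Finset.sum_congr rfl fun j _ => ?_
    rw [sg, sg, if_pos (by omega), if_neg (by omega),
      show 4 * (-(n : ℤ) - 1) ^ 2 + 3 * (-(n : ℤ) - 1) - 2 * j ^ 2 - j =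
        ((2 * n + 1 : ℕ) : ℤ) + (4 * n ^ 2 + 3 * n - 2 * j ^ 2 - j) by push_cast; ring,
      zpow_add₀ h0 ((2 * n + 1 : ℕ) : ℤ), zpow_natCast]
    push_cast
    ring
  · rw [tsum_cone_parity (g := fun n j => (sg n : ℂ) * q ^ (4 * n ^ 2 + 3 * n - 2 * j ^ 2 - j)) hs,
      heckeFbar, heckeFbar, ← tsum_mul_left]
    congr 1 <;> refine tsum_congr fun p => ?_
    · rw [show (q ^ 4 : ℂ) = q ^ (2 * 2) by rfl, heckeBarTerm_pow h0]
      have e : 4 * (p.1 + p.2) ^ 2 + 3 * (p.1 + p.2) - 2 * (p.1 - p.2) ^ 2 - (p.1 - p.2) =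
        ((2 : ℕ) : ℤ) * (p.1 * p.1 + 2 * 3 * p.1 * p.2 + p.2 * p.2 - p.1 - p.2) +
          ((2 * 2 : ℕ) : ℤ) * p.1 + ((6 : ℕ) : ℤ) * p.2 := by push_cast; ring
      rw [e]
      refine cone_mul_congr (fun h1 h2 => ?_) (fun h1 h2 => ?_)
      · rw [sg, sg, if_pos (by omega), if_pos (by omega)]
      · rw [sg, sg, if_neg (by omega), if_neg (by omega)]
    · rw [show (q ^ 4 : ℂ) = q ^ (2 * 2) by rfl, heckeBarTerm_pow h0]
      have e : 4 * (p.1 + p.2 + 1) ^ 2 + 3 * (p.1 + p.2 + 1) - 2 * (p.1 - p.2) ^ 2 -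
          (p.1 - p.2) = ((7 : ℕ) : ℤ) +
        (((2 : ℕ) : ℤ) * (p.1 * p.1 + 2 * 3 * p.1 * p.2 + p.2 * p.2 - p.1 - p.2) +
          ((12 : ℕ) : ℤ) * p.1 + ((14 : ℕ) : ℤ) * p.2) := by push_cast; ring
      rw [e, zpow_add₀ h0 ((7 : ℕ) : ℤ), zpow_natCast, mul_left_comm (q ^ 7), mul_left_comm (q ^ 7)]
      refine cone_mul_congr (fun h1 h2 => ?_) (fun h1 h2 => ?_)
      · rw [sg, sg, if_pos (by omega), if_pos (by omega)]
      · rw [sg, sg, if_neg (by omega), if_neg (by omega)]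

/-! ### Infinite products -/

lemma etaJ_ne_zero {q : ℂ} (hq : ‖q‖ < 1) {m : ℕ} (hm : m ≠ 0) : etaJ m q ≠ 0 :=
  qPochInf_ne_zero_of_norm_lt (norm_pow_lt_one hq hm) (norm_pow_lt_one hq hm)

/-- `(-q;q)_∞ (q;q)_∞ = (q²;q²)_∞`. -/
lemma qPochInf_neg_mul {q : ℂ} (hq : ‖q‖ < 1) : qPochInf (-q) q * etaJ 1 q = etaJ 2 q := by
  rw [etaJ, etaJ, pow_one, mul_comm, qPochInf_mul_neg hq]

lemma qPochInf_odd_mul {q : ℂ} (hq : ‖q‖ < 1) : qPochInf q (q ^ 2) * etaJ 2 q = etaJ 1 q := by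
  rw [etaJ, etaJ, pow_one, qPochInf_dissect hq q two_ne_zero]
  simp [Finset.prod_range_succ, pow_two]

lemma etaJ_pow (a b : ℕ) (q : ℂ) : etaJ a (q ^ b) = etaJ (b * a) q := by
  rw [etaJ, etaJ, pow_mul]

/-- `(-q;q²)_∞` as a quotient of eta products. -/
lemma qPochInf_neg_odd_mul {q : ℂ} (hq : ‖q‖ < 1) :
    qPochInf (-q) (q ^ 2) * (etaJ 1 q * etaJ 4 q) = etaJ 2 q ^ 2 := by
  have h1 := qPochInf_mul_neg (norm_pow_lt_one hq two_ne_zero) q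
  have h2 := qPochInf_odd_mul hq
  have h3 := qPochInf_odd_mul (norm_pow_lt_one hq two_ne_zero)
  rw [etaJ_pow, etaJ_pow] at h3
  norm_num at h3
  rw [← h2]
  linear_combination etaJ 2 q * etaJ 4 q * h1 + etaJ 2 q * h3

/-! ### Signed powers of a fixed base -/

/-- The signed power `(-1)^ε u^a`; all arguments of theta functions below are of this form. -/
def signedPow (u : ℂ) (ε a : ℤ) : ℂ := (-1) ^ ε * u ^ a

lemma signedPow_mul {u : ℂ} (h0 : u ≠ 0) (ε a ε' a' : ℤ) :
    signedPow u ε a * signedPow u ε' a' = signedPow u (ε + ε') (a + a') := by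
  rw [signedPow, signedPow, signedPow, zpow_add₀ (by norm_num), zpow_add₀ h0]; ring

lemma signedPow_zpow (u : ℂ) (ε a k : ℤ) : signedPow u ε a ^ k = signedPow u (ε * k) (a * k) := by
  rw [signedPow, signedPow, mul_zpow, ← zpow_mul, ← zpow_mul]

lemma signedPow_congr {u : ℂ} {ε a ε' a' : ℤ} (m : ℤ) (h : ε = ε' + 2 * m) (ha : a = a') :
    signedPow u ε a = signedPow u ε' a' := by
  rw [signedPow, signedPow, neg_one_zpow_congr m h, ha]

lemma signedPow_ne_zero {u : ℂ} (h0 : u ≠ 0) (ε a : ℤ) : signedPow u ε a ≠ 0 :=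
  mul_ne_zero (neg_one_zpow_ne_zero _) (zpow_ne_zero _ h0)

lemma norm_signedPow (u : ℂ) (ε a : ℤ) : ‖signedPow u ε a‖ = ‖u‖ ^ a := by
  rw [signedPow, norm_mul, norm_neg_one_zpow, one_mul, norm_zpow]

lemma norm_signedPow_lt_one {u : ℂ} (h0 : u ≠ 0) (hu : ‖u‖ < 1) (ε : ℤ) {a : ℤ} (ha : 0 < a) :
    ‖signedPow u ε a‖ < 1 := by
  rw [norm_signedPow]
  rw [← zpow_zero ‖u‖]
  exact zpow_lt_zpow_right_of_lt_one₀ (norm_pos_iff.2 h0) hu ha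

lemma norm_pow_lt_norm_signedPow {u : ℂ} (h0 : u ≠ 0) (hu : ‖u‖ < 1) (ε : ℤ) {a : ℤ} {m : ℕ}
    (ha : a < m) : ‖u ^ m‖ < ‖signedPow u ε a‖ := by
  rw [norm_signedPow, norm_pow, ← zpow_natCast]
  exact zpow_lt_zpow_right_of_lt_one₀ (norm_pos_iff.2 h0) hu ha

lemma thetaTerm_signedPow {u : ℂ} (h0 : u ≠ 0) (ε a : ℤ) (m : ℕ) (n : ℤ) :
    thetaTerm (signedPow u ε a) (u ^ (2 * m)) n =
      signedPow u (n + ε * n) (m * (n * n - n) + a * n) := by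
  rw [thetaTerm, pow_two_mul_zpow_binom2, signedPow_zpow, signedPow, signedPow,
    zpow_add₀ (by norm_num), zpow_add₀ h0]
  ring

lemma kronTerm_signedPow {u : ℂ} (h0 : u ≠ 0) (ε a ε' b : ℤ) (m : ℕ) (p : ℤ × ℤ) :
    kronTerm (signedPow u ε a) (signedPow u ε' b) (u ^ m) p =
      cone p.1 p.2 * signedPow u (ε * p.1 + ε' * p.2) (a * p.1 + b * p.2 + m * (p.1 * p.2)) := by
  rw [kronTerm, signedPow_zpow, signedPow_zpow, signedPow_mul h0, ← zpow_natCast, ← zpow_mul,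
    signedPow, signedPow, zpow_add₀ h0 _ ((m : ℤ) * _)]
  ring

lemma jTheta_signedPow_ne_zero {u : ℂ} (h0 : u ≠ 0) (hu : ‖u‖ < 1) (ε : ℤ) {a : ℤ} {m : ℕ}
    (hm : m ≠ 0) (h : ¬ (m : ℤ) ∣ a) : jTheta (signedPow u ε a) (u ^ m) ≠ 0 := by
  refine jTheta_ne_zero (pow_ne_zero _ h0) (norm_pow_lt_one hu hm) fun k hk => h ?_
  have := congrArg norm hk
  rw [norm_signedPow, ← zpow_natCast, ← zpow_mul, norm_zpow] at this
  exact ⟨k, zpow_right_injective₀ (norm_pos_iff.2 h0) hu.ne this⟩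

/-- Products of convergent series. -/
lemma hasSum_mul_prod {α β : Type*} {f : α → ℂ} {g : β → ℂ} {a b : ℂ} (hf : HasSum f a)
    (hg : HasSum g b) : HasSum (fun p : α × β => f p.1 * g p.2) (a * b) :=
  hf.mul hg (summable_mul_of_summable_norm hf.summable.norm hg.summable.norm)

lemma hasSum_theta_signedPow {u : ℂ} (h0 : u ≠ 0) (hu : ‖u‖ < 1) (ε a : ℤ) {m : ℕ} (hm : m ≠ 0)
    {P : ℂ} (hP : P = u ^ (2 * m)) :
    HasSum (fun n => signedPow u (n + ε * n) (m * (n * n - n) + a * n))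
      (jTheta (signedPow u ε a) P) := by
  subst hP
  exact hasSum_of_eq (hasSum_thetaTerm (signedPow_ne_zero h0 ε a) (pow_ne_zero _ h0)
    (norm_pow_lt_one hu (by omega))) (fun n => (thetaTerm_signedPow h0 ε a m n).symm) rfl

/-- The double series of an Appell-Lerch series whose parameters are signed powers. -/
lemma hasSum_appell_signedPow {u x z : ℂ} (h0 : u ≠ 0) (hu : ‖u‖ < 1) {ε a δ b : ℤ} {m : ℕ}
    {P : ℂ} (hP : P = u ^ (2 * m))
    (hz : z = signedPow u ε a) (hj : jTheta z P ≠ 0) (hx : x * z = signedPow u δ b)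
    (hb : 0 < b) (hbm : b < 2 * m) :
    HasSum (fun p : ℤ × ℤ => cone p.2 p.1 * signedPow u (p.1 + 1 + ε * (p.1 + 1) + δ * p.2)
        (m * (p.1 * p.1 + p.1) + a * (p.1 + 1) + (2 * m * p.1 + b) * p.2))
      (jTheta z P * appellM x P z) ∧
    Summable (appellTerm x P z) := by
  subst hP
  have h := hasSum_appell (pow_ne_zero (2 * m) h0) (norm_pow_lt_one hu (by omega : 2 * m ≠ 0))
    (hz ▸ signedPow_ne_zero h0 ε a) hj (x := x)
    (by rw [hx]; exact norm_pow_lt_norm_signedPow h0 hu δ (by push_cast; omega))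
    (by rw [hx]; exact norm_signedPow_lt_one h0 hu δ hb)
  refine ⟨hasSum_of_eq h.1 (fun p => ?_) rfl, h.2⟩
  rw [hx, hz, thetaTerm_signedPow h0, mul_zpow, signedPow_zpow, ← zpow_natCast, ← zpow_mul,
    ← zpow_mul, signedPow, signedPow, signedPow, zpow_add₀ (by norm_num) _ (δ * p.2),
    show (m : ℤ) * (p.1 * p.1 + p.1) + a * (p.1 + 1) + (2 * m * p.1 + b) * p.2 =
      (m * ((p.1 + 1) * (p.1 + 1) - (p.1 + 1)) + a * (p.1 + 1)) +
        (((2 * m : ℕ) : ℤ) * p.1 * p.2 + b * p.2) by push_cast; ring, zpow_add₀ h0,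
    zpow_add₀ h0 (((2 * m : ℕ) : ℤ) * p.1 * p.2)]
  ring_nf

/-- Kronecker's formula for signed powers. -/
lemma hasSum_kron_signedPow {u : ℂ} (h0 : u ≠ 0) (hu : ‖u‖ < 1) (ε ε' : ℤ) {a b : ℤ} {m : ℕ}
    (ha : 0 < a) (ham : a < m) (hb : 0 < b) (hbm : b < m) :
    HasSum (fun p : ℤ × ℤ => cone p.1 p.2 *
        signedPow u (ε * p.1 + ε' * p.2) (a * p.1 + b * p.2 + m * (p.1 * p.2)))
      (etaJ m u ^ 3 * jTheta (signedPow u (ε + ε') (a + b)) (u ^ m) /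
        (jTheta (signedPow u ε a) (u ^ m) * jTheta (signedPow u ε' b) (u ^ m))) := by
  have h := hasSum_kronTerm (pow_ne_zero m h0) (norm_pow_lt_one hu (by omega : m ≠ 0))
    (norm_pow_lt_norm_signedPow h0 hu ε ham) (norm_signedPow_lt_one h0 hu ε ha)
    (norm_pow_lt_norm_signedPow h0 hu ε' hbm) (norm_signedPow_lt_one h0 hu ε' hb)
  refine hasSum_of_eq h (fun p => (kronTerm_signedPow h0 ε a ε' b m p).symm) ?_
  rw [signedPow_mul h0, etaJ]

lemma cone_congr {k l k' l' : ℤ} (hk : 0 ≤ k ↔ 0 ≤ k') (hl : 0 ≤ l ↔ 0 ≤ l') :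
    cone k l = cone k' l' := by
  simp only [cone, sg, hk, hl]

/-- The three sums arising from `cone_split`. -/
lemma hasSum_cone_split {α : Type*} {k l t : α → ℤ} {W : α → ℂ} (a : ℤ) {L A B : ℂ}
    (hL : HasSum (fun p => cone (k p) (l p) * W p) L)
    (hA : HasSum (fun p => cone (k p) (t p - k p - a) * W p) A)
    (hB : HasSum (fun p => cone (l p) (-t p - l p) * W p) B) :
    HasSum (fun p => cone (k p - t p + a - 1) (l p + t p - 1) * W p) (L - A - B) := by
  refine hasSum_of_eq ((hL.sub hA).sub hB) (fun p => ?_) rfl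
  rw [cone_split (k p) (l p) (t p) a]; ring

lemma cone_neg_one_sub (r s : ℤ) : cone (-1 - r) (-1 - s) = -cone r s := by
  rw [cone_neg_sub, cone_comm]

/-- Reindexing along an explicit bijection. It is applied to the integral linear substitutions
that separate the variables of the triple sums. -/
lemma hasSum_of_hasSum_comp {α β : Type*} {f : α → ℂ} {a : ℂ} (e : β → α) (e' : α → β)
    (h1 : ∀ b, e' (e b) = b) (h2 : ∀ a, e (e' a) = a) (h : HasSum (fun b => f (e b)) a) :
    HasSum f a :=
  (Equiv.hasSum_iff (⟨e, e', h1, h2⟩ : β ≃ α)).1 h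

/-! ### The Appell-Lerch expression of `ψ_-^{(6)}` -/

/-- The general term of the triple sum for `ψ_-^{(6)}`. -/
def psiTriple (q : ℂ) (p : (ℤ × ℤ) × ℤ) : ℂ :=
  signedPow q (p.1.1 + p.2)
    (3 * p.1.1 ^ 2 + 3 * p.1.1 - 2 * p.1.2 ^ 2 - p.1.2 + 6 * p.2 ^ 2 - 7 * p.2)

/-- The full triple sum, with multiplier `j(q⁻¹;q¹²)`. -/
lemma hasSum_psiTriple {q : ℂ} (h0 : q ≠ 0) (hq : ‖q‖ < 1) :
    HasSum (fun p : (ℤ × ℤ) × ℤ => cone (p.1.1 + p.1.2) (p.1.1 - p.1.2) * psiTriple q p)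
      ((heckeF 1 5 1 (q ^ 3) (q ^ 5) (q ^ 2) - q ^ 6 * heckeF 1 5 1 (q ^ 9) (q ^ 11) (q ^ 2)) *
        jTheta (signedPow q 0 (-1)) (q ^ 12)) := by
  have h1 := (summable_norm_cone_sub h0 hq (a := 3) (b := 3) (by norm_num) (by norm_num)
    (fun p => (-1) ^ p.1) (fun p => norm_neg_one_zpow _)).of_norm.hasSum
  rw [tsum_cone_psi h0 hq] at h1
  refine hasSum_of_eq (hasSum_mul_prod h1 (hasSum_theta_signedPow h0 hq 0 (-1) (m := 6)
    (by norm_num) (by norm_num))) (fun p => ?_) rfl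
  rw [← signedPow, mul_assoc, signedPow_mul h0, psiTriple]
  congr 1
  exact signedPow_congr 0 (by ring) (by push_cast; ring)

/-- A part of the triple sum that is a product of a theta series and an Appell-Lerch series. -/
lemma hasSum_psiTriple_right {q : ℂ} (h0 : q ≠ 0) (hq : ‖q‖ < 1) :
    HasSum (fun p : (ℤ × ℤ) × ℤ => cone (p.1.1 - p.1.2) (-p.2 - (p.1.1 - p.1.2)) * psiTriple q p)
      (signedPow q 1 (-1) * (jTheta (signedPow q 0 3) (q ^ 2) *
        (jTheta q (q ^ 12) * appellM (-q ^ 3) (q ^ 12) q))) ∧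
    Summable (appellTerm (-q ^ 3) (q ^ 12) q) := by
  have hz : q = signedPow q 0 1 := by simp [signedPow]
  have hj := jTheta_signedPow_ne_zero h0 hq 0 (a := 1) (m := 12) (by norm_num) (by norm_num)
  rw [← hz] at hj
  have h2 := hasSum_appell_signedPow h0 hq (x := -q ^ 3) (P := q ^ 12) (m := 6) (δ := 1) (b := 4)
    (by norm_num) hz
    hj (by rw [signedPow, zpow_one, show (4 : ℤ) = ((4 : ℕ) : ℤ) by rfl, zpow_natCast]; ring)
    (by norm_num) (by norm_num)
  refine ⟨hasSum_of_hasSum_comp (fun p : ℤ × (ℤ × ℤ) =>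
    ((p.1 - 2 * p.2.2, p.1 - 3 * p.2.2), -p.2.1 - p.2.2))
    (fun p => (3 * p.1.1 - 2 * p.1.2, (-p.2 - p.1.1 + p.1.2, p.1.1 - p.1.2)))
    (fun p => by ext <;> dsimp <;> ring) (fun p => by ext <;> dsimp <;> ring) ?_, h2.2⟩
  refine hasSum_of_eq ((hasSum_mul_prod (hasSum_theta_signedPow h0 hq 0 3 (m := 1)
    (by norm_num) (by norm_num)) h2.1).mul_left (signedPow q 1 (-1))) (fun p => ?_) rfl
  obtain ⟨J, T, k⟩ := p
  dsimp only
  rw [mul_left_comm (signedPow q _ _) (cone _ _), signedPow_mul h0,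
    mul_left_comm (signedPow q _ _) (cone _ _), signedPow_mul h0, psiTriple]
  rw [cone_congr (k' := k) (l' := T) (by omega) (by omega)]
  congr 1
  exact signedPow_congr (-T - 2 * k - 1) (by ring) (by push_cast; ring)

/-- The substitution `n ↦ -1 - n` carries this part of the triple sum to the preceding one. -/
lemma hasSum_psiTriple_left {q : ℂ} (h0 : q ≠ 0) (hq : ‖q‖ < 1) :
    HasSum (fun p : (ℤ × ℤ) × ℤ =>
        cone (p.1.1 + p.1.2) (p.2 - (p.1.1 + p.1.2) - 2) * psiTriple q p)
      (signedPow q 1 (-1) * (jTheta (signedPow q 0 3) (q ^ 2) *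
        (jTheta q (q ^ 12) * appellM (-q ^ 3) (q ^ 12) q))) := by
  refine hasSum_of_hasSum_comp (fun p : (ℤ × ℤ) × ℤ => ((-1 - p.1.1, p.1.2), p.2))
    (fun p => ((-1 - p.1.1, p.1.2), p.2))
    (fun p => by ext <;> dsimp; ring) (fun p => by ext <;> dsimp; ring) ?_
  refine hasSum_of_eq (hasSum_psiTriple_right h0 hq).1 (fun p => ?_) rfl
  obtain ⟨⟨n, j⟩, t⟩ := p
  dsimp only
  rw [show -1 - n + j = -1 - (n - j) by ring,
    show t - (-1 - (n - j)) - 2 = -1 - (-t - (n - j)) by ring, cone_neg_one_sub, psiTriple,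
    psiTriple]
  dsimp only
  rw [signedPow_congr (ε' := n + t + 1) (-1 - n) (by ring) (show _ = 3 * n ^ 2 + 3 * n - 2 * j ^ 2
    - j + 6 * t ^ 2 - 7 * t by ring), signedPow, signedPow, zpow_add₀ (by norm_num) _ (1 : ℤ)]
  simp

/-- The remaining part of the triple sum. The parity of `j - t` is fixed first; the even part splits
further into four residue classes, each a theta series times a Kronecker series. -/
lemma hasSum_psiTriple_rest {q : ℂ} (h0 : q ≠ 0) (hq : ‖q‖ < 1) {v : ℂ}
    (hv : HasSum (fun p : (ℤ × ℤ) × ℤ =>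
        cone (p.1.1 + p.1.2 - p.2 + 2 - 1) (p.1.1 - p.1.2 + p.2 - 1) * psiTriple q p) v) :
    v = jTheta (signedPow q 0 (-4)) (q ^ 8) * ∑ i : Fin 2 × Fin 2,
      signedPow q ((i.1 : ℤ) + i.2) (3 * (i.1 + 2 * i.2) * (2 + i.1 - 2 * i.2) +
          2 * (i.1 + 2 * i.2) + (2 + i.1 - 2 * i.2) + 2) *
        (etaJ 48 q ^ 3 * jTheta (signedPow q (1 + 1) ((12 * (2 + i.1 - 2 * i.2) + 8) +
            (12 * (i.1 + 2 * i.2) + 4))) (q ^ 48) /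
          (jTheta (signedPow q 1 (12 * (2 + i.1 - 2 * i.2) + 8)) (q ^ 48) *
            jTheta (signedPow q 1 (12 * (i.1 + 2 * i.2) + 4)) (q ^ 48))) := by
  have hbij : Function.Bijective fun p : Fin 2 × ((ℤ × ℤ) × ℤ) =>
      ((p.2.1.1, 2 * p.2.1.2 + (p.1 : ℤ) + p.2.2), p.2.2) := by
    constructor
    · rintro ⟨i, ⟨n, d⟩, t⟩ ⟨i', ⟨n', d'⟩, t'⟩ h
      simp only [Prod.mk.injEq] at h
      have := i.2; have := i'.2
      simp only [Prod.mk.injEq, Fin.ext_iff]; omega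
    · rintro ⟨⟨n, j⟩, t⟩
      refine ⟨(⟨((j - t) % 2).toNat, by omega⟩, ((n, (j - t) / 2), t)), ?_⟩
      simp only [Prod.mk.injEq, true_and, and_true]; omega
  rw [← hv.tsum_eq, tsum_eq_sum_tsum_of_bijective hv.summable _ hbij, Fin.sum_univ_two,
    Finset.mul_sum]
  -- the terms with `j - t` odd cancel in pairs
  have hodd : ∀ X : ℂ, X = ∑' b : (ℤ × ℤ) × ℤ,
      cone (b.1.1 + (2 * b.1.2 + ((1 : Fin 2) : ℤ) + b.2) - b.2 + 2 - 1)
        (b.1.1 - (2 * b.1.2 + ((1 : Fin 2) : ℤ) + b.2) + b.2 - 1) * psiTriple q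
        ((b.1.1, 2 * b.1.2 + ((1 : Fin 2) : ℤ) + b.2), b.2) → X = 0 := by
    intro X hX
    let e : (ℤ × ℤ) × ℤ ≃ (ℤ × ℤ) × ℤ :=
      { toFun := fun p => (p.1, 2 * p.1.2 + 3 - p.2)
        invFun := fun p => (p.1, 2 * p.1.2 + 3 - p.2)
        left_inv := fun p => by ext <;> dsimp; ring
        right_inv := fun p => by ext <;> dsimp; ring }
    have h : X = -X := by
      conv_lhs => rw [hX, ← e.tsum_eq]
      rw [hX, ← tsum_neg]
      refine tsum_congr fun p => ?_
      obtain ⟨⟨n, d⟩, t⟩ := p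
      simp only [e, Equiv.coe_fn_mk, psiTriple, Fin.val_one, Nat.cast_one]
      rw [← mul_neg, cone_congr (k' := n + (2 * d + 1 + t) - t + 2 - 1)
        (l' := n - (2 * d + 1 + t) + t - 1) (by omega) (by omega)]
      congr 1
      rw [signedPow_congr (ε' := n + t + 1) (d + 1 - t) (by ring)
        (show _ = 3 * n ^ 2 + 3 * n - 2 * (2 * d + 1 + t) ^ 2 - (2 * d + 1 + t) + 6 * t ^ 2 - 7 * t
          by ring), signedPow, signedPow, zpow_add₀ (by norm_num) _ (1 : ℤ)]
      simp
    exact self_eq_neg.1 h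
  rw [hodd _ rfl, add_zero]
  have hs := hv.summable.comp_injective
    (hbij.injective.comp (Prod.mk_right_injective (0 : Fin 2)))
  refine (tsum_eq_sum_tsum_of_bijective hs (fun p : (Fin 2 × Fin 2) × ((ℤ × ℤ) × ℤ) =>
    ((2 * (p.2.1.1 + p.2.1.2) + 1 + (p.1.1 : ℤ), p.2.1.1 - p.2.1.2 - 1 + (p.1.2 : ℤ)),
      p.2.2 + (p.2.1.1 - p.2.1.2 - 1 + (p.1.2 : ℤ)))) ?_).trans ?_
  · constructor
    · rintro ⟨⟨i, k⟩, ⟨n, d⟩, t⟩ ⟨⟨i', k'⟩, ⟨n', d'⟩, t'⟩ h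
      simp only [Prod.mk.injEq] at h
      have := i.2; have := i'.2; have := k.2; have := k'.2
      simp only [Prod.mk.injEq, Fin.ext_iff]; omega
    · rintro ⟨⟨n, d⟩, t⟩
      refine ⟨((⟨((n - 1) % 2).toNat, by omega⟩, ⟨((d + 1 - (n - 1) / 2) % 2).toNat, by omega⟩),
        (((n - 1) / 2 - ((n - 1) / 2 - (d + 1 - (d + 1 - (n - 1) / 2) % 2)) / 2,
          ((n - 1) / 2 - (d + 1 - (d + 1 - (n - 1) / 2) % 2)) / 2), t - d)), ?_⟩
      simp only [Prod.mk.injEq]; omega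
  · refine Finset.sum_congr rfl fun i _ => ?_
    obtain ⟨⟨i, hi⟩, ⟨k, hk⟩⟩ := i
    refine HasSum.tsum_eq ?_
    have hK := hasSum_kron_signedPow h0 hq 1 1 (a := 12 * (2 + i - 2 * k) + 8)
      (b := 12 * (i + 2 * k) + 4) (m := 48) (by omega) (by omega) (by omega) (by omega)
    refine hasSum_of_eq ((hasSum_mul_prod hK (hasSum_theta_signedPow h0 hq 0 (-4) (m := 4)
      (P := q ^ 8) (by norm_num) (by norm_num))).mul_left (signedPow q (i + k)
        (3 * (i + 2 * k) * (2 + i - 2 * k) + 2 * (i + 2 * k) + (2 + i - 2 * k) + 2)))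
      (fun p => ?_) (by ring)
    obtain ⟨⟨r, s⟩, t⟩ := p
    simp only [Function.comp_apply, psiTriple, Fin.val_zero, Nat.cast_zero, add_zero]
    rw [mul_assoc (cone r s), signedPow_mul h0, mul_left_comm (signedPow q _ _) (cone _ _),
      signedPow_mul h0,
      cone_congr (k' := r) (l' := s) (by omega) (by omega)]
    congr 1
    exact signedPow_congr r (by ring) (by push_cast; ring)

/-! ### Theta functions at powers of `q` -/

/-- `j(x;q)` in terms of theta functions in base `q²`: the factors with even and with odd exponents
are separated. -/
lemma jTheta_dissect_two {x q : ℂ} (hx : x ≠ 0) (h0 : q ≠ 0) (hq : ‖q‖ < 1) :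
    jTheta x q * qPochInf (q ^ 2) (q ^ 2) ^ 2 =
      jTheta x (q ^ 2) * jTheta (x * q) (q ^ 2) * qPochInf q q := by
  have h1 := qPochInf_dissect hq x two_ne_zero
  have h2 := qPochInf_dissect hq (q / x) two_ne_zero
  simp only [Finset.prod_range_succ, Finset.prod_range_zero, one_mul, pow_zero, mul_one,
    pow_one] at h1 h2
  rw [jTheta, jTheta, jTheta, h1, h2, show q ^ 2 / (x * q) = q / x by field_simp,
    show q ^ 2 / x = q / x * q by ring]
  ring

/-- `j(x;q) j(-x;q)` in terms of `j(x²;q²)`. -/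
lemma jTheta_mul_neg {x q : ℂ} (hq : ‖q‖ < 1) :
    jTheta x q * jTheta (-x) q * qPochInf (q ^ 2) (q ^ 2) =
      jTheta (x ^ 2) (q ^ 2) * qPochInf q q ^ 2 := by
  have h1 := qPochInf_mul_neg hq x
  have h2 := qPochInf_mul_neg hq (q / x)
  rw [jTheta, jTheta, jTheta, ← h1, ← div_pow, ← h2, div_neg]
  ring

section
variable {q : ℂ}

lemma thetaJ_reflect (h0 : q ≠ 0) {a b m : ℕ} (h : a + b = m) : thetaJ a m q = thetaJ b m q := by
  rw [thetaJ, thetaJ, ← jTheta_div_left (pow_ne_zero _ h0), ← h, pow_add,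
    mul_div_cancel_left₀ _ (pow_ne_zero _ h0)]

lemma thetaJ_dissect (h0 : q ≠ 0) (hq : ‖q‖ < 1) {a b m n : ℕ} (hm : m ≠ 0) (hn : n = 2 * m)
    (hb : b = a + m) :
    thetaJ a m q * etaJ n q ^ 2 = thetaJ a n q * thetaJ b n q * etaJ m q := by
  subst hn hb
  have h := jTheta_dissect_two (pow_ne_zero a h0) (pow_ne_zero m h0) (norm_pow_lt_one hq hm)
  rw [← pow_mul, mul_comm m, ← pow_add] at h
  exact h

/-- `j(-q^a; q^m)`. -/
def thetaNeg (a m : ℕ) (q : ℂ) : ℂ := jTheta (-q ^ a) (q ^ m)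

lemma thetaNeg_reflect (h0 : q ≠ 0) {a b m : ℕ} (h : a + b = m) :
    thetaNeg a m q = thetaNeg b m q := by
  rw [thetaNeg, thetaNeg, ← jTheta_div_left (pow_ne_zero _ h0), ← h, pow_add, div_neg,
    mul_div_cancel_left₀ _ (pow_ne_zero _ h0)]

lemma thetaNeg_dissect (h0 : q ≠ 0) (hq : ‖q‖ < 1) {a b m n : ℕ} (hm : m ≠ 0) (hn : n = 2 * m)
    (hb : b = a + m) :
    thetaNeg a m q * etaJ n q ^ 2 = thetaNeg a n q * thetaNeg b n q * etaJ m q := by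
  subst hn hb
  have h := jTheta_dissect_two (neg_ne_zero.2 (pow_ne_zero a h0)) (pow_ne_zero m h0)
    (norm_pow_lt_one hq hm)
  rw [← pow_mul, mul_comm m, neg_mul, ← pow_add] at h
  exact h

lemma thetaJ_mul_thetaNeg (hq : ‖q‖ < 1) {a b m n : ℕ} (hm : m ≠ 0) (hn : n = 2 * m)
    (hb : b = 2 * a) :
    thetaJ a m q * thetaNeg a m q * etaJ n q = thetaJ b n q * etaJ m q ^ 2 := by
  subst hn hb
  have h := jTheta_mul_neg (x := q ^ a) (norm_pow_lt_one hq hm)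
  rw [← pow_mul, ← pow_mul, mul_comm m, mul_comm a] at h
  exact h

lemma thetaJ_ne_zero (h0 : q ≠ 0) (hq : ‖q‖ < 1) {a m : ℕ} (ha : a ≠ 0) (hm : a < m) :
    thetaJ a m q ≠ 0 := by
  have h := jTheta_signedPow_ne_zero h0 hq 0 (a := a) (m := m) (by omega)
    (fun h => by have := Int.le_of_dvd (by omega) h; omega)
  rw [signedPow, zpow_zero, one_mul, zpow_natCast] at h
  exact h

lemma thetaNeg_ne_zero (h0 : q ≠ 0) (hq : ‖q‖ < 1) {a m : ℕ} (ha : a ≠ 0) (hm : a < m) :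
    thetaNeg a m q ≠ 0 := by
  have h := jTheta_signedPow_ne_zero h0 hq 1 (a := a) (m := m) (by omega)
    (fun h => by have := Int.le_of_dvd (by omega) h; omega)
  rw [signedPow, zpow_one, neg_one_mul, zpow_natCast] at h
  exact h

lemma thetaJ_two_mul (h0 : q ≠ 0) (hq : ‖q‖ < 1) {m n : ℕ} (hm : m ≠ 0) (hn : n = 2 * m) :
    thetaJ m n q * etaJ n q = etaJ m q ^ 2 := by
  have h := qPochInf_dissect (norm_pow_lt_one hq hm) (q ^ m) two_ne_zero
  simp only [Finset.prod_range_succ, Finset.prod_range_zero, one_mul, pow_zero, mul_one,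
    pow_one] at h
  subst hn
  rw [thetaJ, etaJ, etaJ, jTheta, h, ← pow_mul, mul_comm m, two_mul m, pow_add,
    mul_div_cancel_right₀ _ (pow_ne_zero m h0)]
  ring

lemma thetaJ_three_mul (h0 : q ≠ 0) (hq : ‖q‖ < 1) {m n : ℕ} (hm : m ≠ 0) (hn : n = 3 * m) :
    thetaJ m n q = etaJ m q := by
  have h := qPochInf_dissect (norm_pow_lt_one hq hm) (q ^ m) three_ne_zero
  simp only [Finset.prod_range_succ, Finset.prod_range_zero, one_mul, pow_zero, mul_one,
    pow_one] at h
  subst hn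
  rw [thetaJ, etaJ, jTheta, h, ← pow_mul, mul_comm m, show q ^ (3 * m) / q ^ m = q ^ m * q ^ m by
    rw [div_eq_iff (pow_ne_zero m h0)]; ring, show q ^ (3 * m) = q ^ m * (q ^ m) ^ 2 by ring]

lemma thetaJ_four_mul (h0 : q ≠ 0) (hq : ‖q‖ < 1) {m n k : ℕ} (hm : m ≠ 0) (hn : n = 4 * m)
    (hk : k = 2 * m) : thetaJ m n q * etaJ k q = etaJ m q * etaJ n q := by
  have h := qPochInf_dissect (norm_pow_lt_one hq hm) (q ^ m) (m := 4) (by norm_num)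
  have h' := qPochInf_dissect (norm_pow_lt_one hq (m := 2 * m) (by omega)) (q ^ (2 * m))
    two_ne_zero
  simp only [Finset.prod_range_succ, Finset.prod_range_zero, one_mul, pow_zero, mul_one,
    pow_one] at h h'
  subst hn hk
  rw [thetaJ, etaJ, etaJ, etaJ, jTheta, h, h', ← pow_mul, ← pow_mul, mul_comm m,
    show q ^ (4 * m) / q ^ m = q ^ m * (q ^ m) ^ 2 by
      rw [div_eq_iff (pow_ne_zero m h0)]; ring,
    show 2 * m * 2 = 4 * m by ring, show q ^ (2 * m) * q ^ (2 * m) = q ^ (4 * m) by ring,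
    show q ^ m * q ^ m = q ^ (2 * m) by ring, show q ^ m * (q ^ m) ^ 3 = q ^ (4 * m) by ring]
  ring

/-- Theta functions of signed powers with exponents outside the fundamental range. -/
lemma jTheta_signedPow_add (h0 : q ≠ 0) (hq : ‖q‖ < 1) (ε a : ℤ) {b : ℤ} {m : ℕ} (hm : m ≠ 0)
    (hb : b = a + m) : jTheta (signedPow q ε b) (q ^ m) =
      signedPow q (ε + 1) (-a) * jTheta (signedPow q ε a) (q ^ m) := by
  subst hb
  have h := jTheta_zpow_mul (signedPow_ne_zero h0 ε a) (pow_ne_zero m h0) (norm_pow_lt_one hq hm) 1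
  rw [binom2_one, neg_zero, zpow_zero, zpow_one, mul_one, zpow_one,
    show q ^ m * signedPow q ε a = signedPow q ε (a + m) by
      rw [signedPow, signedPow, zpow_add₀ h0, zpow_natCast]; ring, zpow_neg_one] at h
  rw [h]
  congr 1
  have h2 := signedPow_mul h0 ε a (ε + 1) (-a)
  rw [signedPow_congr (ε' := 1) ε (show _ by ring) (add_neg_cancel a),
    show signedPow q 1 0 = -1 by simp [signedPow]] at h2
  have h3 := signedPow_ne_zero h0 ε a
  field_simp
  rw [h2]

lemma jTheta_signedPow_neg (h0 : q ≠ 0) (ε a : ℤ) {m : ℕ} :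
    jTheta (signedPow q ε (m - a)) (q ^ m) = jTheta (signedPow q ε a) (q ^ m) := by
  rw [← jTheta_div_left (pow_ne_zero m h0)]
  congr 1
  rw [div_eq_iff (signedPow_ne_zero h0 _ _), signedPow_mul h0, signedPow_congr (ε' := 0) ε
    (show _ by ring) (show _ = (m : ℤ) by ring), signedPow, zpow_natCast]
  simp

lemma jTheta_signedPow_neg_exp (h0 : q ≠ 0) (hq : ‖q‖ < 1) (ε a : ℤ) {m : ℕ} (hm : m ≠ 0) :
    jTheta (signedPow q ε (-a)) (q ^ m) =
      signedPow q (ε + 1) (-a) * jTheta (signedPow q ε a) (q ^ m) := by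
  rw [← jTheta_signedPow_neg h0, sub_neg_eq_add, jTheta_signedPow_add h0 hq ε a hm (add_comm _ _)]

lemma signedPow_two (a : ℤ) : signedPow q 2 a = signedPow q 0 a :=
  signedPow_congr 1 (by norm_num) rfl

lemma jTheta_signedPow_zero (a m : ℕ) : jTheta (signedPow q 0 a) (q ^ m) = thetaJ a m q := by
  rw [signedPow, zpow_zero, one_mul, zpow_natCast, thetaJ]

lemma jTheta_signedPow_one (a m : ℕ) : jTheta (signedPow q 1 a) (q ^ m) = thetaNeg a m q := by
  rw [signedPow, zpow_one, neg_one_mul, zpow_natCast, thetaNeg]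

end

/-- The theta quotient of `ψ_-^{(6)}`, as it comes out of Kronecker's formula. -/
lemma psi_theta_quotient {q : ℂ} (h0 : q ≠ 0) (hq : ‖q‖ < 1) :
    thetaJ 4 8 q * etaJ 48 q ^ 3 * thetaJ 12 48 q *
      (1 / (thetaNeg 4 48 q * thetaNeg 16 48 q) -
        q ^ 2 / (thetaNeg 8 48 q * thetaNeg 20 48 q)) / (thetaJ 1 2 q * thetaJ 1 12 q) =
    etaJ 2 q ^ 2 * etaJ 12 q * etaJ 24 q * thetaJ 4 24 q ^ 2 /
              (etaJ 1 q ^ 2 * thetaJ 1 24 q * thetaJ 10 24 q * thetaJ 11 24 q) := by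
  have hE : ∀ m : ℕ, m ≠ 0 → etaJ m q ≠ 0 := fun m hm => etaJ_ne_zero hq hm
  have e1 := hE 1 (by norm_num); have e2 := hE 2 (by norm_num); have e4 := hE 4 (by norm_num)
  have e8 := hE 8 (by norm_num); have e6 := hE 6 (by norm_num); have e12 := hE 12 (by norm_num)
  have e24 := hE 24 (by norm_num); have e48 := hE 48 (by norm_num)
  have hT : ∀ a m : ℕ, a ≠ 0 → a < m → thetaJ a m q ≠ 0 := fun a m => thetaJ_ne_zero h0 hq
  have hN : ∀ a m : ℕ, a ≠ 0 → a < m → thetaNeg a m q ≠ 0 := fun a m => thetaNeg_ne_zero h0 hq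
  have n4 := hN 4 48 (by norm_num) (by norm_num)
  have n8 := hN 8 48 (by norm_num) (by norm_num)
  have n16 := hN 16 48 (by norm_num) (by norm_num)
  have n20 := hN 20 48 (by norm_num) (by norm_num)
  have t2 := hT 2 24 (by norm_num) (by norm_num)
  have t4 := hT 4 24 (by norm_num) (by norm_num)
  have t1 := hT 1 24 (by norm_num) (by norm_num)
  have t11 := hT 11 24 (by norm_num) (by norm_num)
  have t10 := hT 10 24 (by norm_num) (by norm_num)
  have t8 := hT 8 24 (by norm_num) (by norm_num)
  have c1 := hT 1 12 (by norm_num) (by norm_num)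
  -- the sum of the two Kronecker terms is a product
  have hbr : thetaNeg 8 48 q * thetaNeg 20 48 q - q ^ 2 * (thetaNeg 4 48 q * thetaNeg 16 48 q) =
      thetaJ 6 24 q * thetaJ 2 24 q := by
    have h := jTheta_mul_jTheta (x := q ^ 6) (y := q ^ 2) (pow_ne_zero _ h0) (pow_ne_zero _ h0)
      (pow_ne_zero 24 h0) (norm_pow_lt_one hq (by norm_num))
    rw [show -(q ^ 6 * q ^ 2) = -q ^ 8 by ring, show -(q ^ 24 * q ^ 2 / q ^ 6) = -q ^ 20 by
      field_simp, show -(q ^ 24 * q ^ 6 * q ^ 2) = -q ^ 32 by ring,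
      show -(q ^ 2 / q ^ 6) = (-q ^ 4)⁻¹ by field_simp, ← pow_mul,
      jTheta_inv_left (neg_ne_zero.2 (pow_ne_zero 4 h0)) (pow_ne_zero _ h0)
        (norm_pow_lt_one hq (by norm_num))] at h
    change thetaJ 6 24 q * thetaJ 2 24 q = thetaNeg 8 48 q * thetaNeg 20 48 q -
      q ^ 6 * thetaNeg 32 48 q * (-(-q ^ 4)⁻¹ * thetaNeg 4 48 q) at h
    rw [h, thetaNeg_reflect h0 (show 32 + 16 = 48 by norm_num)]
    field_simp
  have d1 : thetaJ 1 24 q * thetaJ 11 24 q = thetaJ 1 12 q * etaJ 24 q ^ 2 / etaJ 12 q := by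
    rw [thetaJ_dissect h0 hq (show 12 ≠ 0 by norm_num) (show 24 = 2 * 12 by norm_num)
      (show 13 = 1 + 12 by norm_num), thetaJ_reflect h0 (show 13 + 11 = 24 by norm_num)]
    field_simp
  have d2 : thetaJ 2 24 q * thetaJ 10 24 q =
      etaJ 2 q * etaJ 12 q ^ 2 / (etaJ 4 q * etaJ 6 q) * etaJ 24 q ^ 2 / etaJ 12 q := by
    have h1 := thetaJ_dissect h0 hq (show 12 ≠ 0 by norm_num) (show 24 = 2 * 12 by norm_num)
      (show 14 = 2 + 12 by norm_num)
    rw [thetaJ_reflect h0 (show 14 + 10 = 24 by norm_num)] at h1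
    have h2 := thetaJ_dissect h0 hq (show 6 ≠ 0 by norm_num) (show 12 = 2 * 6 by norm_num)
      (show 8 = 2 + 6 by norm_num)
    rw [thetaJ_reflect h0 (show 8 + 4 = 12 by norm_num), thetaJ_three_mul h0 hq (m := 4)
      (by norm_num) (by norm_num), thetaJ_three_mul h0 hq (m := 2)
      (by norm_num) (by norm_num)] at h2
    have h3 : thetaJ 2 12 q = etaJ 2 q * etaJ 12 q ^ 2 / (etaJ 4 q * etaJ 6 q) := by
      field_simp; linear_combination -h2
    rw [← h3, h1]; field_simp
  have d3 : thetaJ 4 24 q = etaJ 4 q * etaJ 24 q ^ 2 / (etaJ 8 q * etaJ 12 q) := by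
    have h2 := thetaJ_dissect h0 hq (show 12 ≠ 0 by norm_num) (show 24 = 2 * 12 by norm_num)
      (show 16 = 4 + 12 by norm_num)
    rw [thetaJ_reflect h0 (show 16 + 8 = 24 by norm_num), thetaJ_three_mul h0 hq (m := 8)
      (by norm_num) (by norm_num), thetaJ_three_mul h0 hq (m := 4)
      (by norm_num) (by norm_num)] at h2
    field_simp; linear_combination -h2
  have d4 : thetaNeg 4 48 q * thetaNeg 16 48 q * (thetaNeg 8 48 q * thetaNeg 20 48 q) =
      etaJ 24 q * etaJ 48 q ^ 4 / thetaJ 4 24 q := by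
    have h1 := thetaNeg_dissect h0 hq (show 24 ≠ 0 by norm_num) (show 48 = 2 * 24 by norm_num)
      (show 28 = 4 + 24 by norm_num)
    rw [thetaNeg_reflect h0 (show 28 + 20 = 48 by norm_num)] at h1
    have h2 := thetaNeg_dissect h0 hq (show 24 ≠ 0 by norm_num) (show 48 = 2 * 24 by norm_num)
      (show 32 = 8 + 24 by norm_num)
    rw [thetaNeg_reflect h0 (show 32 + 16 = 48 by norm_num)] at h2
    have h3 := thetaJ_mul_thetaNeg hq (show 24 ≠ 0 by norm_num) (show 48 = 2 * 24 by norm_num)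
      (show 8 = 2 * 4 by norm_num)
    have h4 := thetaJ_mul_thetaNeg hq (show 24 ≠ 0 by norm_num) (show 48 = 2 * 24 by norm_num)
      (show 16 = 2 * 8 by norm_num)
    have h5 := thetaJ_dissect h0 hq (show 24 ≠ 0 by norm_num) (show 48 = 2 * 24 by norm_num)
      (show 32 = 8 + 24 by norm_num)
    rw [thetaJ_reflect h0 (show 32 + 16 = 48 by norm_num)] at h5
    have m4 : thetaNeg 4 24 q = thetaJ 8 48 q * etaJ 24 q ^ 2 / (thetaJ 4 24 q * etaJ 48 q) := by
      field_simp; linear_combination h3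
    have m8 : thetaNeg 8 24 q = thetaJ 16 48 q * etaJ 24 q ^ 2 / (thetaJ 8 24 q * etaJ 48 q) := by
      field_simp; linear_combination h4
    have k1 : thetaNeg 4 48 q * thetaNeg 20 48 q = thetaNeg 4 24 q * etaJ 48 q ^ 2 / etaJ 24 q := by
      rw [h1]; field_simp
    have k2 : thetaNeg 8 48 q * thetaNeg 16 48 q = thetaNeg 8 24 q * etaJ 48 q ^ 2 / etaJ 24 q := by
      rw [h2]; field_simp
    have k3 : thetaJ 8 48 q * thetaJ 16 48 q = thetaJ 8 24 q * etaJ 48 q ^ 2 / etaJ 24 q := by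
      rw [h5]; field_simp
    calc _ = (thetaNeg 4 48 q * thetaNeg 20 48 q) * (thetaNeg 8 48 q * thetaNeg 16 48 q) := by ring
      _ = (thetaJ 8 48 q * thetaJ 16 48 q) * (etaJ 24 q ^ 2 * etaJ 48 q ^ 2 /
          (thetaJ 4 24 q * thetaJ 8 24 q)) := by
        rw [k1, k2, m4, m8]; field_simp
      _ = _ := by rw [k3]; field_simp
  have d5 : thetaJ 4 8 q = etaJ 4 q ^ 2 / etaJ 8 q :=
    eq_div_of_mul_eq e8 (thetaJ_two_mul h0 hq (by norm_num) (by norm_num))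
  have d6 : thetaJ 12 48 q = etaJ 12 q * etaJ 48 q / etaJ 24 q :=
    eq_div_of_mul_eq e24 (thetaJ_four_mul h0 hq (by norm_num) (by norm_num) (by norm_num))
  have d7 : thetaJ 6 24 q = etaJ 6 q * etaJ 24 q / etaJ 12 q :=
    eq_div_of_mul_eq e12 (thetaJ_four_mul h0 hq (by norm_num) (by norm_num) (by norm_num))
  have d8 : thetaJ 1 2 q = etaJ 1 q ^ 2 / etaJ 2 q :=
    eq_div_of_mul_eq e2 (thetaJ_two_mul h0 hq (by norm_num) (by norm_num))
  have hsum : 1 / (thetaNeg 4 48 q * thetaNeg 16 48 q) -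
      q ^ 2 / (thetaNeg 8 48 q * thetaNeg 20 48 q) =
      thetaJ 6 24 q * thetaJ 2 24 q * thetaJ 4 24 q / (etaJ 24 q * etaJ 48 q ^ 4) := by
    rw [← hbr]
    have : etaJ 24 q * etaJ 48 q ^ 4 = thetaJ 4 24 q *
        (thetaNeg 4 48 q * thetaNeg 16 48 q * (thetaNeg 8 48 q * thetaNeg 20 48 q)) := by
      rw [d4]; field_simp
    rw [this]; field_simp
  have d2' : thetaJ 2 24 q = etaJ 2 q * etaJ 12 q ^ 2 / (etaJ 4 q * etaJ 6 q) * etaJ 24 q ^ 2 /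
      etaJ 12 q / thetaJ 10 24 q := by rw [← d2]; field_simp
  rw [hsum, d2', d5, d6, d7, d8, show etaJ 1 q ^ 2 * thetaJ 1 24 q * thetaJ 10 24 q *
    thetaJ 11 24 q = etaJ 1 q ^ 2 * (thetaJ 1 24 q * thetaJ 11 24 q) * thetaJ 10 24 q by ring, d1,
    d3]
  field_simp

/-- The identity of triple sums for `ψ_-^{(6)}` in closed form. -/
lemma psi_double_sum_eq {q : ℂ} (h0 : q ≠ 0) (hq : ‖q‖ < 1) :
    q * (1 / 2 * (heckeF 1 5 1 (q ^ 3) (q ^ 5) (q ^ 2) -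
        q ^ 6 * heckeF 1 5 1 (q ^ 9) (q ^ 11) (q ^ 2))) / thetaJ 1 2 q =
      -appellM (-q ^ 3) (q ^ 12) q + q ^ 2 * (thetaJ 4 8 q * etaJ 48 q ^ 3 * thetaJ 12 48 q *
      (1 / (thetaNeg 4 48 q * thetaNeg 16 48 q) -
        q ^ 2 / (thetaNeg 8 48 q * thetaNeg 20 48 q)) / (thetaJ 1 2 q * thetaJ 1 12 q)) := by
  have h := hasSum_psiTriple_rest h0 hq (hasSum_cone_split 2 (hasSum_psiTriple h0 hq)
    (hasSum_psiTriple_left h0 hq) (hasSum_psiTriple_right h0 hq).1)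
  rw [Fintype.sum_prod_type, Fin.sum_univ_two, Fin.sum_univ_two, Fin.sum_univ_two] at h
  simp only [Fin.val_zero, Fin.val_one, Nat.cast_zero, Nat.cast_one] at h
  norm_num only at h
  have r1 : jTheta (signedPow q 0 (-1)) (q ^ 12) = signedPow q 1 (-1) * thetaJ 1 12 q := by
    rw [jTheta_signedPow_neg_exp h0 hq 0 1 (by norm_num)]
    exact congrArg _ (jTheta_signedPow_zero 1 12)
  have r2 : jTheta (signedPow q 0 (-4)) (q ^ 8) = signedPow q 1 (-4) * thetaJ 4 8 q := by
    rw [jTheta_signedPow_neg_exp h0 hq 0 4 (by norm_num)]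
    exact congrArg _ (jTheta_signedPow_zero 4 8)
  have r3 : jTheta (signedPow q 0 3) (q ^ 2) = signedPow q 1 (-1) * thetaJ 1 2 q := by
    rw [← jTheta_signedPow_zero, jTheta_signedPow_add h0 hq 0 1 (by norm_num) (by norm_num)]
    rfl
  have r4 : jTheta q (q ^ 12) = thetaJ 1 12 q := by rw [thetaJ, pow_one]
  have r5 : jTheta (signedPow q 2 36) (q ^ 48) = thetaJ 12 48 q := by
    rw [signedPow_two, ← thetaJ_reflect h0 (show 36 + 12 = 48 by norm_num)]
    exact jTheta_signedPow_zero 36 48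
  have r6 : jTheta (signedPow q 2 60) (q ^ 48) = signedPow q 1 (-12) * thetaJ 12 48 q := by
    rw [signedPow_two, ← jTheta_signedPow_zero,
      jTheta_signedPow_add h0 hq 0 12 (by norm_num) (by norm_num)]
    rfl
  have r7 : ∀ a b : ℕ, a + b = 48 → jTheta (signedPow q 1 a) (q ^ 48) = thetaNeg b 48 q := by
    intro a b hab
    rw [← thetaNeg_reflect h0 hab, jTheta_signedPow_one]
  have r32 := r7 32 16 rfl
  have r4' := r7 44 4 rfl
  have r28 := r7 28 20 rfl
  have r40 := r7 40 8 rfl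
  have r4'' : jTheta (signedPow q 1 4) (q ^ 48) = thetaNeg 4 48 q := jTheta_signedPow_one 4 48
  have r8 : jTheta (signedPow q 1 8) (q ^ 48) = thetaNeg 8 48 q := jTheta_signedPow_one 8 48
  have r16 : jTheta (signedPow q 1 16) (q ^ 48) = thetaNeg 16 48 q := jTheta_signedPow_one 16 48
  have r20 : jTheta (signedPow q 1 20) (q ^ 48) = thetaNeg 20 48 q := jTheta_signedPow_one 20 48
  push_cast at r32 r4' r28 r40
  rw [r1, r2, r3, r4, r5, r6, r32, r4', r28, r40, r4'', r8, r16, r20] at h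
  have hT1 := thetaJ_ne_zero h0 hq (show 1 ≠ 0 by norm_num) (show 1 < 12 by norm_num)
  have hT2 := thetaJ_ne_zero h0 hq (show 1 ≠ 0 by norm_num) (show 1 < 2 by norm_num)
  have n4 := thetaNeg_ne_zero h0 hq (show 4 ≠ 0 by norm_num) (show 4 < 48 by norm_num)
  have n8 := thetaNeg_ne_zero h0 hq (show 8 ≠ 0 by norm_num) (show 8 < 48 by norm_num)
  have n16 := thetaNeg_ne_zero h0 hq (show 16 ≠ 0 by norm_num) (show 16 < 48 by norm_num)
  have n20 := thetaNeg_ne_zero h0 hq (show 20 ≠ 0 by norm_num) (show 20 < 48 by norm_num)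
  have p : ∀ a : ℕ, signedPow q 1 (-a) = -(q ^ a)⁻¹ := fun a => by simp [signedPow]
  have p' : ∀ (ε : ℤ) (a : ℕ), signedPow q ε a = (-1) ^ ε * q ^ a := fun ε a => by simp [signedPow]
  have p1 := p 1
  have p4 := p 4
  have p12 := p 12
  have p04 := p' 0 4
  have p16 := p' 1 6
  have p116 := p' 1 16
  have p218 := p' 2 18
  push_cast at p1 p4 p12 p04 p16 p116 p218
  rw [p1, p4, p12, p04, p16, p116, p218] at h
  generalize heckeF 1 5 1 (q ^ 3) (q ^ 5) (q ^ 2) -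
    q ^ 6 * heckeF 1 5 1 (q ^ 9) (q ^ 11) (q ^ 2) = F at h ⊢
  generalize appellM (-q ^ 3) (q ^ 12) q = M at h ⊢
  have hF : F * thetaJ 1 12 q = -(2 * q⁻¹) * (thetaJ 1 2 q * (thetaJ 1 12 q * M)) +
      2 * q * (thetaJ 4 8 q * etaJ 48 q ^ 3 * thetaJ 12 48 q *
      (1 / (thetaNeg 4 48 q * thetaNeg 16 48 q) -
        q ^ 2 / (thetaNeg 8 48 q * thetaNeg 20 48 q))) := by
    norm_num at h
    field_simp at h ⊢
    linear_combination -h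
  have hF' : F = (-(2 * q⁻¹) * (thetaJ 1 2 q * (thetaJ 1 12 q * M)) +
      2 * q * (thetaJ 4 8 q * etaJ 48 q ^ 3 * thetaJ 12 48 q *
      (1 / (thetaNeg 4 48 q * thetaNeg 16 48 q) -
        q ^ 2 / (thetaNeg 8 48 q * thetaNeg 20 48 q)))) / thetaJ 1 12 q :=
    eq_div_of_mul_eq hT1 hF
  rw [hF']
  field_simp

/-! ### The Appell-Lerch expressions of `V_1^{(8)}` and `T_1^{(8)}` -/

/-- The general term of the triple sums for `V_1^{(8)}` (`β = 0`) and `T_1^{(8)}(-q)` (`β = 1`),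
where `q = s²`. -/
def eighthTriple (s : ℂ) (β : ℤ) (p : (ℤ × ℤ) × ℤ) : ℂ :=
  signedPow s (p.1.1 + p.2) (8 * p.1.1 ^ 2 + (8 + 2 * β) * p.1.1 + 2 * β - 4 * p.1.2 ^ 2 -
    2 * p.1.2 + 8 * p.2 ^ 2 - 7 * p.2)

lemma signedPow_sq (s : ℂ) (ε a : ℤ) : signedPow (s ^ 2) ε a = signedPow s ε (2 * a) := by
  rw [signedPow, signedPow, zpow_mul]; norm_cast

/-- The full triple sum, with multiplier `j(s;s¹⁶)`. -/
lemma hasSum_eighthTriple {s : ℂ} (h0 : s ≠ 0) (hs : ‖s‖ < 1) {β : ℤ} {F : ℂ}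
    (h1 : HasSum (fun p : ℤ × ℤ => cone (p.1 + p.2) (p.1 - p.2) * signedPow s p.1
      (8 * p.1 ^ 2 + (8 + 2 * β) * p.1 + 2 * β - 4 * p.2 ^ 2 - 2 * p.2)) F) :
    HasSum (fun p : (ℤ × ℤ) × ℤ => cone (p.1.1 + p.1.2) (p.1.1 - p.1.2) * eighthTriple s β p)
      (F * jTheta (signedPow s 0 1) (s ^ 16)) := by
  refine hasSum_of_eq (hasSum_mul_prod h1 (hasSum_theta_signedPow h0 hs 0 1 (m := 8)
    (by norm_num) (by norm_num))) (fun p => ?_) rfl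
  rw [mul_assoc, signedPow_mul h0, eighthTriple]
  congr 1
  exact signedPow_congr 0 (by ring) (by push_cast; ring)

/-- A part of the triple sum that is a product of a theta series and an Appell-Lerch series. -/
lemma hasSum_eighthTriple_right {s x : ℂ} (h0 : s ≠ 0) (hs : ‖s‖ < 1) {β : ℤ} (hβ : 0 ≤ β)
    (hβ1 : β ≤ 1) (hx : x = signedPow s 0 (4 - 2 * β)) :
    HasSum (fun p : (ℤ × ℤ) × ℤ =>
        cone (p.1.1 - p.1.2) (-p.2 - (p.1.1 - p.1.2)) * eighthTriple s β p)
      (signedPow s 1 (1 + 2 * β) * (jTheta (signedPow s 0 (10 + 2 * β)) (s ^ 8) *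
        (jTheta s⁻¹ (s ^ 16) * appellM x (s ^ 16) s⁻¹))) ∧
    Summable (appellTerm x (s ^ 16) s⁻¹) := by
  have hz : s⁻¹ = signedPow s 0 (-1) := by simp [signedPow]
  have hj := jTheta_signedPow_ne_zero h0 hs 0 (a := -1) (m := 16) (by norm_num) (by norm_num)
  rw [← hz] at hj
  have h2 := hasSum_appell_signedPow h0 hs (x := x) (P := s ^ 16) (m := 8) (δ := 0)
    (b := 3 - 2 * β) (by norm_num) hz hj
    (by rw [hx, hz, signedPow_mul h0]; exact signedPow_congr 0 (by ring) (by ring))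
    (by omega) (by push_cast; omega)
  refine ⟨hasSum_of_hasSum_comp (fun p : ℤ × (ℤ × ℤ) =>
    ((p.1 - p.2.2, p.1 - 2 * p.2.2), -p.2.1 - p.2.2))
    (fun p => (2 * p.1.1 - p.1.2, (-p.2 - p.1.1 + p.1.2, p.1.1 - p.1.2)))
    (fun p => by ext <;> dsimp <;> ring) (fun p => by ext <;> dsimp <;> ring) ?_, h2.2⟩
  refine hasSum_of_eq ((hasSum_mul_prod (hasSum_theta_signedPow h0 hs 0 (10 + 2 * β) (m := 4)
    (P := s ^ 8) (by norm_num) (by norm_num)) h2.1).mul_left (signedPow s 1 (1 + 2 * β)))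
    (fun p => ?_) rfl
  obtain ⟨J, T, k⟩ := p
  dsimp only
  rw [mul_left_comm (signedPow s _ _) (cone _ _), signedPow_mul h0,
    mul_left_comm (signedPow s _ _) (cone _ _), signedPow_mul h0, eighthTriple]
  rw [cone_congr (k' := k) (l' := T) (by omega) (by omega)]
  congr 1
  exact signedPow_congr (-T - k - 1) (by ring) (by push_cast; ring)

/-- For `β = 0` the substitution `n ↦ -1 - n` carries this part of the triple sum to the preceding
one. -/
lemma hasSum_eighthTriple_left_zero {s x : ℂ} (h0 : s ≠ 0) (hs : ‖s‖ < 1)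
    (hx : x = signedPow s 0 4) :
    HasSum (fun p : (ℤ × ℤ) × ℤ =>
        cone (p.1.1 + p.1.2) (p.2 - (p.1.1 + p.1.2) - 2) * eighthTriple s 0 p)
      (signedPow s 1 (1 + 2 * 0) * (jTheta (signedPow s 0 (10 + 2 * 0)) (s ^ 8) *
        (jTheta s⁻¹ (s ^ 16) * appellM x (s ^ 16) s⁻¹))) := by
  refine hasSum_of_hasSum_comp (fun p : (ℤ × ℤ) × ℤ => ((-1 - p.1.1, p.1.2), p.2))
    (fun p => ((-1 - p.1.1, p.1.2), p.2))
    (fun p => by ext <;> dsimp; ring) (fun p => by ext <;> dsimp; ring) ?_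
  refine hasSum_of_eq (hasSum_eighthTriple_right h0 hs le_rfl zero_le_one (by rw [hx]; rfl)).1
    (fun p => ?_) rfl
  obtain ⟨⟨n, j⟩, t⟩ := p
  dsimp only
  rw [show -1 - n + j = -1 - (n - j) by ring,
    show t - (-1 - (n - j)) - 2 = -1 - (-t - (n - j)) by ring, cone_neg_one_sub, eighthTriple,
    eighthTriple]
  dsimp only
  rw [signedPow_congr (ε' := n + t + 1) (-1 - n) (by ring) (show _ = 8 * n ^ 2 + (8 + 2 * 0) * n +
    2 * 0 - 4 * j ^ 2 - 2 * j + 8 * t ^ 2 - 7 * t by ring), signedPow, signedPow,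
    zpow_add₀ (by norm_num) _ (1 : ℤ)]
  simp

/-- For `β = 1` this part of the triple sum vanishes, since the theta series that splits off does. -/
lemma hasSum_eighthTriple_left_one {s : ℂ} (h0 : s ≠ 0) (hs : ‖s‖ < 1) :
    HasSum (fun p : (ℤ × ℤ) × ℤ =>
        cone (p.1.1 + p.1.2) (p.2 - (p.1.1 + p.1.2) - 2) * eighthTriple s 1 p) 0 := by
  have hj := jTheta_signedPow_ne_zero h0 hs 0 (a := 17) (m := 16) (by norm_num) (by norm_num)
  have h2 := hasSum_appell_signedPow h0 hs (x := signedPow s 0 (-6)) (P := s ^ 16) (m := 8) (δ := 0)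
    (b := 11) (by norm_num) rfl hj
    (by rw [signedPow_mul h0]; exact signedPow_congr 0 (by ring) (by ring))
    (by norm_num) (by norm_num)
  -- it is taken at an integral power of its base
  have hz : jTheta (signedPow s 0 16) (s ^ 8) = 0 := by
    have := jTheta_zpow_eq_zero (pow_ne_zero 8 h0) (norm_pow_lt_one hs (by norm_num)) 2
    rw [signedPow, zpow_zero, one_mul, ← this]
    congr 1
    rw [← zpow_natCast, ← zpow_mul]; norm_num
  refine hasSum_of_hasSum_comp (fun p : ℤ × (ℤ × ℤ) =>
    ((p.1 - p.2.2, 2 * p.2.2 - p.1), p.2.1 + p.2.2 + 2))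
    (fun p => (2 * p.1.1 + p.1.2, (p.2 - p.1.1 - p.1.2 - 2, p.1.1 + p.1.2)))
    (fun p => by ext <;> dsimp <;> ring) (fun p => by ext <;> dsimp <;> ring) ?_
  refine hasSum_of_eq ((hasSum_mul_prod (hasSum_theta_signedPow h0 hs 0 16 (m := 4)
    (P := s ^ 8) (by norm_num) (by norm_num)) h2.1).mul_left (signedPow s 1 3))
    (fun p => ?_) (by rw [hz]; ring)
  obtain ⟨J, T, k⟩ := p
  dsimp only
  rw [mul_left_comm (signedPow s _ _) (cone _ _), signedPow_mul h0,
    mul_left_comm (signedPow s _ _) (cone _ _), signedPow_mul h0, eighthTriple]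
  rw [cone_congr (k' := k) (l' := T) (by omega) (by omega)]
  congr 1
  exact signedPow_congr 0 (by ring) (by push_cast; ring)

/-- The remaining part of the triple sum splits into two residue classes, each a theta series times
a Kronecker series. -/
lemma hasSum_eighthTriple_rest {s : ℂ} (h0 : s ≠ 0) (hs : ‖s‖ < 1) {β : ℤ} (hβ : 0 ≤ β)
    (hβ1 : β ≤ 1) {v : ℂ} (hv : HasSum (fun p : (ℤ × ℤ) × ℤ =>
        cone (p.1.1 + p.1.2 - p.2 + 2 - 1) (p.1.1 - p.1.2 + p.2 - 1) * eighthTriple s β p) v) :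
    v = jTheta (signedPow s 0 (-5)) (s ^ 8) * ∑ i : Fin 2,
      signedPow s (1 + i) (8 * i ^ 2 + (8 + 2 * β) * i + 3 + 2 * β) *
        (etaJ 32 s ^ 3 * jTheta (signedPow s (0 + 0) ((16 * i + 13 + 2 * β) +
            (16 * i + 3 + 2 * β))) (s ^ 32) /
          (jTheta (signedPow s 0 (16 * i + 13 + 2 * β)) (s ^ 32) *
            jTheta (signedPow s 0 (16 * i + 3 + 2 * β)) (s ^ 32))) := by
  have hbij : Function.Bijective fun p : Fin 2 × ((ℤ × ℤ) × ℤ) =>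
      ((p.2.1.1 + p.2.1.2 + (p.1 : ℤ), 2 * (p.2.1.1 - p.2.1.2 - 1) + p.2.2),
        p.2.2 + (p.2.1.1 - p.2.1.2 - 1)) := by
    constructor
    · rintro ⟨i, ⟨n, d⟩, t⟩ ⟨i', ⟨n', d'⟩, t'⟩ h
      simp only [Prod.mk.injEq] at h
      have := i.2; have := i'.2
      simp only [Prod.mk.injEq, Fin.ext_iff]; omega
    · rintro ⟨⟨n, j⟩, t⟩
      refine ⟨(⟨((n + (j - t + 1)) % 2).toNat, by omega⟩,
        (((n + (j - t + 1)) / 2, (n + (j - t + 1)) / 2 - (j - t + 1)), 2 * t - j)), ?_⟩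
      simp only [Prod.mk.injEq]; omega
  rw [← hv.tsum_eq, tsum_eq_sum_tsum_of_bijective hv.summable _ hbij, Finset.mul_sum]
  refine Finset.sum_congr rfl fun i _ => ?_
  obtain ⟨i, hi⟩ := i
  refine HasSum.tsum_eq ?_
  have hK := hasSum_kron_signedPow h0 hs 0 0 (a := 16 * i + 13 + 2 * β)
    (b := 16 * i + 3 + 2 * β) (m := 32) (by omega) (by omega) (by omega) (by omega)
  refine hasSum_of_eq ((hasSum_mul_prod hK (hasSum_theta_signedPow h0 hs 0 (-5) (m := 4)
    (P := s ^ 8) (by norm_num) (by norm_num))).mul_left (signedPow s (1 + i)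
      (8 * i ^ 2 + (8 + 2 * β) * i + 3 + 2 * β))) (fun p => ?_) (by ring)
  obtain ⟨⟨r, l⟩, t⟩ := p
  simp only [eighthTriple]
  rw [mul_assoc (cone r l), signedPow_mul h0, mul_left_comm (signedPow s _ _) (cone _ _),
    signedPow_mul h0, cone_congr (k' := r) (l' := l) (by omega) (by omega)]
  congr 1
  exact signedPow_congr (r - 1) (by ring) (by push_cast; ring)

lemma thetaJ_pow (a m b : ℕ) (q : ℂ) : thetaJ a m (q ^ b) = thetaJ (b * a) (b * m) q := by
  rw [thetaJ, thetaJ, pow_mul, pow_mul]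

/-- The theta quotient of `V_1^{(8)}`, as it comes out of Kronecker's formula. -/
lemma V_theta_quotient {s : ℂ} (h0 : s ≠ 0) (hs : ‖s‖ < 1) :
    thetaJ 3 8 s * etaJ 32 s ^ 3 * thetaJ 16 32 s /
      (thetaJ 13 32 s * thetaJ 3 32 s * thetaJ 2 8 s * thetaJ 1 16 s) =
    thetaJ 5 16 s * etaJ 16 s ^ 3 / (thetaJ 1 16 s * thetaJ 2 16 s * thetaJ 6 16 s) := by
  have hE : ∀ m : ℕ, m ≠ 0 → etaJ m s ≠ 0 := fun m hm => etaJ_ne_zero hs hm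
  have e8 := hE 8 (by norm_num); have e16 := hE 16 (by norm_num)
  have e32 := hE 32 (by norm_num)
  have hT : ∀ a m : ℕ, a ≠ 0 → a < m → thetaJ a m s ≠ 0 := fun a m => thetaJ_ne_zero h0 hs
  have t13 := hT 13 32 (by norm_num) (by norm_num)
  have t3 := hT 3 32 (by norm_num) (by norm_num)
  have t28 := hT 2 8 (by norm_num) (by norm_num)
  have t1 := hT 1 16 (by norm_num) (by norm_num)
  have t2 := hT 2 16 (by norm_num) (by norm_num)
  have t6 := hT 6 16 (by norm_num) (by norm_num)
  have h1 := thetaJ_dissect h0 hs (show 8 ≠ 0 by norm_num) (show 16 = 2 * 8 by norm_num)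
    (show 11 = 3 + 8 by norm_num)
  rw [thetaJ_reflect h0 (show 11 + 5 = 16 by norm_num)] at h1
  have h2 := thetaJ_dissect h0 hs (show 16 ≠ 0 by norm_num) (show 32 = 2 * 16 by norm_num)
    (show 19 = 3 + 16 by norm_num)
  rw [thetaJ_reflect h0 (show 19 + 13 = 32 by norm_num)] at h2
  have h3 := thetaJ_dissect h0 hs (show 8 ≠ 0 by norm_num) (show 16 = 2 * 8 by norm_num)
    (show 10 = 2 + 8 by norm_num)
  rw [thetaJ_reflect h0 (show 10 + 6 = 16 by norm_num)] at h3
  have h4 := thetaJ_two_mul h0 hs (show 16 ≠ 0 by norm_num) (show 32 = 2 * 16 by norm_num)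
  have d1 : thetaJ 3 8 s = thetaJ 3 16 s * thetaJ 5 16 s * etaJ 8 s / etaJ 16 s ^ 2 := by
    field_simp; exact h1
  have d2 : thetaJ 3 16 s = thetaJ 3 32 s * thetaJ 13 32 s * etaJ 16 s / etaJ 32 s ^ 2 := by
    field_simp; exact h2
  have d3 : thetaJ 2 8 s = thetaJ 2 16 s * thetaJ 6 16 s * etaJ 8 s / etaJ 16 s ^ 2 := by
    field_simp; exact h3
  have d4 : thetaJ 16 32 s = etaJ 16 s ^ 2 / etaJ 32 s := by field_simp; exact h4
  rw [d1, d2, d3, d4]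
  field_simp

/-- The theta quotient of `T_1^{(8)}`, as it comes out of Kronecker's formula. -/
lemma T_theta_quotient {s : ℂ} (h0 : s ≠ 0) (hs : ‖s‖ < 1) :
    thetaJ 3 8 s * etaJ 32 s ^ 3 * thetaJ 12 32 s *
      (1 / (thetaJ 1 32 s * thetaJ 11 32 s) + s ^ 2 / (thetaJ 15 32 s * thetaJ 5 32 s)) /
      (thetaJ 4 8 s * thetaJ 1 16 s) =
    thetaJ 3 16 s ^ 2 * etaJ 16 s ^ 3 /
      (thetaJ 1 16 s ^ 2 * thetaJ 2 16 s * thetaJ 4 16 s) := by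
  have hE : ∀ m : ℕ, m ≠ 0 → etaJ m s ≠ 0 := fun m hm => etaJ_ne_zero hs hm
  have e8 := hE 8 (by norm_num); have e16 := hE 16 (by norm_num)
  have e32 := hE 32 (by norm_num)
  have hT : ∀ a m : ℕ, a ≠ 0 → a < m → thetaJ a m s ≠ 0 := fun a m => thetaJ_ne_zero h0 hs
  have t1' := hT 1 32 (by norm_num) (by norm_num)
  have t11 := hT 11 32 (by norm_num) (by norm_num)
  have t15 := hT 15 32 (by norm_num) (by norm_num)
  have t5' := hT 5 32 (by norm_num) (by norm_num)
  have t5 := hT 5 16 (by norm_num) (by norm_num)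
  have t1 := hT 1 16 (by norm_num) (by norm_num)
  have t2 := hT 2 16 (by norm_num) (by norm_num)
  have t4 := hT 4 16 (by norm_num) (by norm_num)
  have t48 := hT 4 8 (by norm_num) (by norm_num)
  have t4' := hT 4 32 (by norm_num) (by norm_num)
  -- the sum of the two Kronecker terms is a product
  have hbr : thetaJ 5 32 s * thetaJ 15 32 s + s ^ 2 * (thetaJ 1 32 s * thetaJ 11 32 s) =
      thetaJ 3 16 s * thetaNeg 2 16 s := by
    have h := jTheta_mul_jTheta (x := s ^ 3) (y := -s ^ 2) (pow_ne_zero _ h0)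
      (neg_ne_zero.2 (pow_ne_zero _ h0)) (pow_ne_zero 16 h0) (norm_pow_lt_one hs (by norm_num))
    rw [show -(s ^ 3 * -s ^ 2) = s ^ 5 by ring, show -(s ^ 16 * -s ^ 2 / s ^ 3) = s ^ 15 by
      field_simp, show -(s ^ 16 * s ^ 3 * -s ^ 2) = s ^ 21 by ring,
      show -(-s ^ 2 / s ^ 3) = (s ^ 1)⁻¹ by field_simp, ← pow_mul,
      jTheta_inv_left (pow_ne_zero 1 h0) (pow_ne_zero _ h0)
        (norm_pow_lt_one hs (by norm_num))] at h
    change thetaJ 3 16 s * thetaNeg 2 16 s = thetaJ 5 32 s * thetaJ 15 32 s -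
      s ^ 3 * thetaJ 21 32 s * (-(s ^ 1)⁻¹ * thetaJ 1 32 s) at h
    rw [h, thetaJ_reflect h0 (show 21 + 11 = 32 by norm_num)]
    field_simp
    ring
  have h1 := thetaJ_dissect h0 hs (show 8 ≠ 0 by norm_num) (show 16 = 2 * 8 by norm_num)
    (show 11 = 3 + 8 by norm_num)
  rw [thetaJ_reflect h0 (show 11 + 5 = 16 by norm_num)] at h1
  have h2 := thetaJ_dissect h0 hs (show 16 ≠ 0 by norm_num) (show 32 = 2 * 16 by norm_num)
    (show 17 = 1 + 16 by norm_num)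
  rw [thetaJ_reflect h0 (show 17 + 15 = 32 by norm_num)] at h2
  have h3 := thetaJ_dissect h0 hs (show 16 ≠ 0 by norm_num) (show 32 = 2 * 16 by norm_num)
    (show 21 = 5 + 16 by norm_num)
  rw [thetaJ_reflect h0 (show 21 + 11 = 32 by norm_num)] at h3
  have h4 := thetaJ_dissect h0 hs (show 8 ≠ 0 by norm_num) (show 16 = 2 * 8 by norm_num)
    (show 12 = 4 + 8 by norm_num)
  rw [thetaJ_reflect h0 (show 12 + 4 = 16 by norm_num)] at h4
  have h5 := thetaJ_mul_thetaNeg hs (show 16 ≠ 0 by norm_num) (show 32 = 2 * 16 by norm_num)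
    (show 4 = 2 * 2 by norm_num)
  have h6 := thetaJ_dissect h0 hs (show 16 ≠ 0 by norm_num) (show 32 = 2 * 16 by norm_num)
    (show 20 = 4 + 16 by norm_num)
  rw [thetaJ_reflect h0 (show 20 + 12 = 32 by norm_num)] at h6
  have d1 : thetaJ 3 8 s = thetaJ 3 16 s * thetaJ 5 16 s * etaJ 8 s / etaJ 16 s ^ 2 := by
    field_simp; exact h1
  have d2 : thetaJ 1 32 s = thetaJ 1 16 s * etaJ 32 s ^ 2 / etaJ 16 s / thetaJ 15 32 s := by
    field_simp; linear_combination -h2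
  have d3 : thetaJ 5 32 s = thetaJ 5 16 s * etaJ 32 s ^ 2 / etaJ 16 s / thetaJ 11 32 s := by
    field_simp; linear_combination -h3
  have d4 : thetaJ 4 8 s = thetaJ 4 16 s * thetaJ 4 16 s * etaJ 8 s / etaJ 16 s ^ 2 := by
    field_simp; linear_combination h4
  have d5 : thetaNeg 2 16 s = thetaJ 4 32 s * etaJ 16 s ^ 2 / (thetaJ 2 16 s * etaJ 32 s) := by
    field_simp; linear_combination h5
  have d6 : thetaJ 12 32 s = thetaJ 4 16 s * etaJ 32 s ^ 2 / etaJ 16 s / thetaJ 4 32 s := by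
    field_simp; linear_combination -h6
  have hsum : 1 / (thetaJ 1 32 s * thetaJ 11 32 s) + s ^ 2 / (thetaJ 15 32 s * thetaJ 5 32 s) =
      thetaJ 3 16 s * thetaNeg 2 16 s /
        (thetaJ 1 32 s * thetaJ 11 32 s * (thetaJ 15 32 s * thetaJ 5 32 s)) := by
    rw [← hbr]; field_simp
  rw [hsum, d1, d2, d3, d4, d5, d6]
  field_simp

lemma jTheta_inv_pow {s : ℂ} (h0 : s ≠ 0) (hs : ‖s‖ < 1) :
    jTheta s⁻¹ (s ^ 16) = -s⁻¹ * thetaJ 1 16 s := by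
  rw [jTheta_inv_left h0 (pow_ne_zero _ h0) (norm_pow_lt_one hs (by norm_num)), thetaJ, pow_one]

/-- The identity of triple sums for `V_1^{(8)}`, in closed form, where `q = s²`. -/
lemma V_double_sum_eq {s : ℂ} (h0 : s ≠ 0) (hs : ‖s‖ < 1) {F : ℂ}
    (h1 : HasSum (fun p : ℤ × ℤ => cone (p.1 + p.2) (p.1 - p.2) * signedPow s p.1
      (8 * p.1 ^ 2 + (8 + 2 * 0) * p.1 + 2 * 0 - 4 * p.2 ^ 2 - 2 * p.2)) F) :
    s ^ 2 * (1 / 2 * F) / thetaJ 2 8 s = -appellM (s ^ 4) (s ^ 16) s⁻¹ +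
      thetaJ 5 16 s * etaJ 16 s ^ 3 / (thetaJ 1 16 s * thetaJ 2 16 s * thetaJ 6 16 s) := by
  have hx : s ^ 4 = signedPow s 0 4 := by simp [signedPow, zpow_ofNat]
  have h := hasSum_eighthTriple_rest h0 hs le_rfl zero_le_one (hasSum_cone_split 2
    (hasSum_eighthTriple h0 hs h1) (hasSum_eighthTriple_left_zero h0 hs hx)
    (hasSum_eighthTriple_right h0 hs le_rfl zero_le_one (x := s ^ 4) (by rw [hx]; rfl)).1)
  rw [Fin.sum_univ_two] at h
  simp only [Fin.val_zero, Fin.val_one, Nat.cast_zero, Nat.cast_one] at h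
  norm_num only at h
  rw [← V_theta_quotient h0 hs]
  have r : ∀ (b : ℤ) (a c m : ℕ), b = a → a + c = m →
      jTheta (signedPow s 0 b) (s ^ m) = thetaJ c m s := by
    rintro b a c m rfl hm
    rw [jTheta_signedPow_zero, thetaJ_reflect h0 hm]
  have hp : ∀ (ε a : ℤ) (b : ℕ), a = b → signedPow s ε a = (-1) ^ ε * s ^ b := by
    rintro ε a b rfl; simp [signedPow]
  have hn : ∀ (a : ℤ) (b : ℕ), a = -b → signedPow s (0 + 1) a = -(s ^ b)⁻¹ := by
    rintro a b rfl; simp [signedPow]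
  have r5 : jTheta (signedPow s 0 (-5)) (s ^ 8) = -(s ^ 5)⁻¹ * thetaJ 3 8 s := by
    rw [jTheta_signedPow_neg_exp h0 hs 0 5 (by norm_num), hn (-5) 5 rfl, r 5 5 3 8 rfl rfl]
  have r10 : jTheta (signedPow s 0 10) (s ^ 8) = -(s ^ 2)⁻¹ * thetaJ 2 8 s := by
    rw [jTheta_signedPow_add h0 hs 0 2 (by norm_num) (by norm_num), hn (-2) 2 rfl,
      r 2 2 6 8 rfl rfl, thetaJ_reflect h0 (show 6 + 2 = 8 by norm_num)]
  have r48 : jTheta (signedPow s 0 48) (s ^ 32) = -(s ^ 16)⁻¹ * thetaJ 16 32 s := by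
    rw [jTheta_signedPow_add h0 hs 0 16 (by norm_num) (by norm_num), hn (-16) 16 rfl,
      r 16 16 16 32 rfl rfl]
  rw [r5, r10, r48, r 1 1 15 16 rfl rfl, thetaJ_reflect h0 (show 15 + 1 = 16 by norm_num),
    jTheta_inv_pow h0 hs, r 16 16 16 32 rfl rfl, r 13 13 19 32 rfl rfl, r 3 3 29 32 rfl rfl,
    r 29 29 3 32 rfl rfl, r 19 19 13 32 rfl rfl,
    thetaJ_reflect h0 (show 19 + 13 = 32 by norm_num),
    thetaJ_reflect h0 (show 29 + 3 = 32 by norm_num), hp 1 1 1 rfl, hp 1 3 3 rfl,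
    hp 2 19 19 rfl] at h
  have t13 := thetaJ_ne_zero h0 hs (show 13 ≠ 0 by norm_num) (show 13 < 32 by norm_num)
  have t3 := thetaJ_ne_zero h0 hs (show 3 ≠ 0 by norm_num) (show 3 < 32 by norm_num)
  have t28 := thetaJ_ne_zero h0 hs (show 2 ≠ 0 by norm_num) (show 2 < 8 by norm_num)
  have t1 := thetaJ_ne_zero h0 hs (show 1 ≠ 0 by norm_num) (show 1 < 16 by norm_num)
  generalize appellM (s ^ 4) (s ^ 16) s⁻¹ = M at h ⊢
  have hF : F * thetaJ 1 16 s = -(2 * (s ^ 2)⁻¹) * (thetaJ 2 8 s * (thetaJ 1 16 s * M)) +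
      2 * (s ^ 2)⁻¹ * (thetaJ 3 8 s * etaJ 32 s ^ 3 * thetaJ 16 32 s /
        (thetaJ 13 32 s * thetaJ 3 32 s)) := by
    norm_num at h
    field_simp at h ⊢
    linear_combination h
  rw [eq_div_of_mul_eq t1 hF]
  field_simp

/-- The identity of triple sums for `T_1^{(8)}(-q)`, in closed form, where `q = s²`. -/
lemma T_double_sum_eq {s : ℂ} (h0 : s ≠ 0) (hs : ‖s‖ < 1) {F : ℂ}
    (h1 : HasSum (fun p : ℤ × ℤ => cone (p.1 + p.2) (p.1 - p.2) * signedPow s p.1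
      (8 * p.1 ^ 2 + (8 + 2 * 1) * p.1 + 2 * 1 - 4 * p.2 ^ 2 - 2 * p.2)) F) :
    F / thetaJ 4 8 s = -(s ^ 2)⁻¹ * appellM (s ^ 2) (s ^ 16) s⁻¹ +
      (s ^ 2)⁻¹ * (thetaJ 3 16 s ^ 2 * etaJ 16 s ^ 3 /
        (thetaJ 1 16 s ^ 2 * thetaJ 2 16 s * thetaJ 4 16 s)) := by
  have hx : s ^ 2 = signedPow s 0 (4 - 2 * 1) := by simp [signedPow, zpow_ofNat]
  have h := hasSum_eighthTriple_rest h0 hs zero_le_one le_rfl (hasSum_cone_split 2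
    (hasSum_eighthTriple h0 hs h1) (hasSum_eighthTriple_left_one h0 hs)
    (hasSum_eighthTriple_right h0 hs zero_le_one le_rfl (x := s ^ 2) hx).1)
  rw [Fin.sum_univ_two] at h
  simp only [Fin.val_zero, Fin.val_one, Nat.cast_zero, Nat.cast_one] at h
  norm_num only at h
  rw [← T_theta_quotient h0 hs]
  have r : ∀ (b : ℤ) (a c m : ℕ), b = a → a + c = m →
      jTheta (signedPow s 0 b) (s ^ m) = thetaJ c m s := by
    rintro b a c m rfl hm
    rw [jTheta_signedPow_zero, thetaJ_reflect h0 hm]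
  have hp : ∀ (ε a : ℤ) (b : ℕ), a = b → signedPow s ε a = (-1) ^ ε * s ^ b := by
    rintro ε a b rfl; simp [signedPow]
  have hn : ∀ (a : ℤ) (b : ℕ), a = -b → signedPow s (0 + 1) a = -(s ^ b)⁻¹ := by
    rintro a b rfl; simp [signedPow]
  have r5 : jTheta (signedPow s 0 (-5)) (s ^ 8) = -(s ^ 5)⁻¹ * thetaJ 3 8 s := by
    rw [jTheta_signedPow_neg_exp h0 hs 0 5 (by norm_num), hn (-5) 5 rfl, r 5 5 3 8 rfl rfl]
  have r12 : jTheta (signedPow s 0 12) (s ^ 8) = -(s ^ 4)⁻¹ * thetaJ 4 8 s := by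
    rw [jTheta_signedPow_add h0 hs 0 4 (by norm_num) (by norm_num), hn (-4) 4 rfl,
      r 4 4 4 8 rfl rfl]
  have r52 : jTheta (signedPow s 0 52) (s ^ 32) = -(s ^ 20)⁻¹ * thetaJ 12 32 s := by
    rw [jTheta_signedPow_add h0 hs 0 20 (by norm_num) (by norm_num), hn (-20) 20 rfl,
      r 20 20 12 32 rfl rfl]
  rw [r5, r12, r52, r 1 1 15 16 rfl rfl, thetaJ_reflect h0 (show 15 + 1 = 16 by norm_num),
    jTheta_inv_pow h0 hs, r 20 20 12 32 rfl rfl, r 15 15 17 32 rfl rfl, r 5 5 27 32 rfl rfl,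
    r 31 31 1 32 rfl rfl, r 21 21 11 32 rfl rfl,
    thetaJ_reflect h0 (show 17 + 15 = 32 by norm_num),
    thetaJ_reflect h0 (show 27 + 5 = 32 by norm_num), hp 1 3 3 rfl, hp 1 5 5 rfl,
    hp 2 23 23 rfl] at h
  have t15 := thetaJ_ne_zero h0 hs (show 15 ≠ 0 by norm_num) (show 15 < 32 by norm_num)
  have t5 := thetaJ_ne_zero h0 hs (show 5 ≠ 0 by norm_num) (show 5 < 32 by norm_num)
  have t11 := thetaJ_ne_zero h0 hs (show 11 ≠ 0 by norm_num) (show 11 < 32 by norm_num)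
  have t1' := thetaJ_ne_zero h0 hs (show 1 ≠ 0 by norm_num) (show 1 < 32 by norm_num)
  have t48 := thetaJ_ne_zero h0 hs (show 4 ≠ 0 by norm_num) (show 4 < 8 by norm_num)
  have t1 := thetaJ_ne_zero h0 hs (show 1 ≠ 0 by norm_num) (show 1 < 16 by norm_num)
  generalize appellM (s ^ 2) (s ^ 16) s⁻¹ = M at h ⊢
  have hF : F * thetaJ 1 16 s = -(s ^ 2)⁻¹ * (thetaJ 4 8 s * (thetaJ 1 16 s * M)) +
      (s ^ 2)⁻¹ * (thetaJ 3 8 s * etaJ 32 s ^ 3 * thetaJ 12 32 s *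
        (1 / (thetaJ 1 32 s * thetaJ 11 32 s) + s ^ 2 / (thetaJ 15 32 s * thetaJ 5 32 s))) := by
    norm_num at h
    field_simp at h ⊢
    linear_combination h
  rw [eq_div_of_mul_eq t1 hF]
  field_simp

/-! ### The function `Φ_{1,4}` -/

/-- The general term of the triple sum for `f_{1,5,1}(q³,q⁵,q²)`. -/
def heckeTriple (q : ℂ) (p : (ℤ × ℤ) × ℤ) : ℂ :=
  signedPow q (p.1.1 + p.1.2) (p.1.1 ^ 2 + 10 * p.1.1 * p.1.2 + p.1.2 ^ 2 + 2 * p.1.1 +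
    4 * p.1.2 + 24 * p.2 ^ 2 - 24 * p.2)

/-- The full triple sum, with multiplier `j(-1;q⁴⁸)`. -/
lemma hasSum_heckeTriple {q : ℂ} (h0 : q ≠ 0) (hq : ‖q‖ < 1) :
    HasSum (fun p : (ℤ × ℤ) × ℤ => cone p.1.1 p.1.2 * heckeTriple q p)
      (heckeF 1 5 1 (q ^ 3) (q ^ 5) (q ^ 2) * jTheta (signedPow q 1 0) (q ^ 48)) := by
  have h1 := (summable_heckeTerm_pow h0 hq (m := 1) (b := 5) le_rfl (by norm_num) 3 5).of_norm.hasSum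
  refine hasSum_of_eq (hasSum_mul_prod h1 (hasSum_theta_signedPow h0 hq 1 0 (m := 24)
    (P := q ^ 48) (by norm_num) (by norm_num))) (fun p => ?_) rfl
  rw [heckeTerm_pow h0, ← signedPow, mul_assoc, signedPow_mul h0, heckeTriple]
  congr 1
  exact signedPow_congr (-p.2) (by ring) (by push_cast; ring)

lemma jTheta_neg_one_ne_zero {q : ℂ} (h0 : q ≠ 0) (hq : ‖q‖ < 1) : jTheta (-1) q ≠ 0 := by
  refine jTheta_ne_zero h0 hq fun k hk => ?_
  have hn := congrArg norm hk
  rw [norm_neg, norm_one, norm_zpow] at hn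
  have : k = 0 := (zpow_eq_one_iff_right₀ (norm_nonneg q) hq.ne).1 hn.symm
  rw [this, zpow_zero] at hk
  norm_num at hk

/-- A part of the triple sum that is a product of a theta series and an Appell-Lerch series. -/
lemma hasSum_heckeTriple_left {q : ℂ} (h0 : q ≠ 0) (hq : ‖q‖ < 1) :
    HasSum (fun p : (ℤ × ℤ) × ℤ => cone p.1.1 (p.2 - p.1.1 - 1) * heckeTriple q p)
      (jTheta (signedPow q 0 5) (q ^ 2) *
        (jTheta (-1) (q ^ 48) * appellM (-q ^ 6) (q ^ 48) (-1))) ∧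
    Summable (appellTerm (-q ^ 6) (q ^ 48) (-1)) := by
  have h2 := hasSum_appell_signedPow h0 hq (x := -q ^ 6) (z := -1) (P := q ^ 48) (m := 24)
    (ε := 1) (a := 0) (δ := 0) (b := 6) (by norm_num) (by simp [signedPow])
    (jTheta_neg_one_ne_zero (pow_ne_zero _ h0) (norm_pow_lt_one hq (by norm_num)))
    (by simp [signedPow, zpow_ofNat]) (by norm_num) (by norm_num)
  refine ⟨hasSum_of_hasSum_comp (fun p : ℤ × (ℤ × ℤ) =>
    ((p.2.2, p.1 - 5 * p.2.2), p.2.1 + p.2.2 + 1))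
    (fun p => (p.1.2 + 5 * p.1.1, (p.2 - p.1.1 - 1, p.1.1)))
    (fun p => by ext <;> dsimp <;> ring) (fun p => by ext <;> dsimp <;> ring) ?_, h2.2⟩
  refine hasSum_of_eq (hasSum_mul_prod (hasSum_theta_signedPow h0 hq 0 5 (m := 1)
    (P := q ^ 2) (by norm_num) (by norm_num)) h2.1) (fun p => ?_) rfl
  obtain ⟨J, T, k⟩ := p
  dsimp only
  rw [mul_left_comm (signedPow q _ _) (cone _ _), signedPow_mul h0, heckeTriple]
  rw [cone_congr (k' := k) (l' := T) (by omega) (by omega)]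
  congr 1
  exact signedPow_congr (-T - 1 - 2 * k) (by ring) (by push_cast; ring)

/-- Another part of the triple sum that is a product of a theta series and an Appell-Lerch series. -/
lemma hasSum_heckeTriple_right {q : ℂ} (h0 : q ≠ 0) (hq : ‖q‖ < 1) :
    HasSum (fun p : (ℤ × ℤ) × ℤ => cone p.1.2 (-p.2 - p.1.2) * heckeTriple q p)
      (jTheta (signedPow q 0 3) (q ^ 2) *
        (jTheta (-1) (q ^ 48) * appellM (-q ^ 18) (q ^ 48) (-1))) ∧
    Summable (appellTerm (-q ^ 18) (q ^ 48) (-1)) := by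
  have h2 := hasSum_appell_signedPow h0 hq (x := -q ^ 18) (z := -1) (P := q ^ 48) (m := 24)
    (ε := 1) (a := 0) (δ := 0) (b := 18) (by norm_num) (by simp [signedPow])
    (jTheta_neg_one_ne_zero (pow_ne_zero _ h0) (norm_pow_lt_one hq (by norm_num)))
    (by simp [signedPow, zpow_ofNat]) (by norm_num) (by norm_num)
  refine ⟨hasSum_of_hasSum_comp (fun p : ℤ × (ℤ × ℤ) =>
    ((p.1 - 5 * p.2.2, p.2.2), -p.2.1 - p.2.2))
    (fun p => (p.1.1 + 5 * p.1.2, (-p.2 - p.1.2, p.1.2)))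
    (fun p => by ext <;> dsimp <;> ring) (fun p => by ext <;> dsimp <;> ring) ?_, h2.2⟩
  refine hasSum_of_eq (hasSum_mul_prod (hasSum_theta_signedPow h0 hq 0 3 (m := 1)
    (P := q ^ 2) (by norm_num) (by norm_num)) h2.1) (fun p => ?_) rfl
  obtain ⟨J, T, k⟩ := p
  dsimp only
  rw [mul_left_comm (signedPow q _ _) (cone _ _), signedPow_mul h0, heckeTriple]
  rw [cone_congr (k' := k) (l' := T) (by omega) (by omega)]
  congr 1
  exact signedPow_congr (-T - 1 - 2 * k) (by ring) (by push_cast; ring)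

/-- The remaining part of the triple sum splits into sixteen residue classes, each a theta series
times a Kronecker series. -/
lemma hasSum_heckeTriple_rest {q : ℂ} (h0 : q ≠ 0) (hq : ‖q‖ < 1) {v : ℂ}
    (hv : HasSum (fun p : (ℤ × ℤ) × ℤ =>
        cone (p.1.1 - p.2 + 1 - 1) (p.1.2 + p.2 - 1) * heckeTriple q p) v) :
    v = ∑ i : Fin 4 × Fin 4, signedPow q (i.1 + i.2 + 1)
        (i.1 ^ 2 + 10 * i.1 * i.2 + i.2 ^ 2 + 12 * i.1 + 6 * i.2 + 5) *
        (etaJ 192 q ^ 3 * jTheta (signedPow q (0 + 0) ((48 * i.2 + 30) + (48 * i.1 + 42)))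
            (q ^ 192) / (jTheta (signedPow q 0 (48 * i.2 + 30)) (q ^ 192) *
              jTheta (signedPow q 0 (48 * i.1 + 42)) (q ^ 192)) *
          jTheta (signedPow q 1 (8 * (i.2 - i.1) - 2)) (q ^ 32)) := by
  have hbij : Function.Bijective fun p : (Fin 4 × Fin 4) × ((ℤ × ℤ) × ℤ) =>
      ((4 * p.2.1.1 + (p.1.1 : ℤ) + (p.2.2 - (p.2.1.2 - p.2.1.1)),
        4 * p.2.1.2 + (p.1.2 : ℤ) + 1 - (p.2.2 - (p.2.1.2 - p.2.1.1))),
        p.2.2 - (p.2.1.2 - p.2.1.1)) := by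
    constructor
    · rintro ⟨⟨i, k⟩, ⟨n, d⟩, t⟩ ⟨⟨i', k'⟩, ⟨n', d'⟩, t'⟩ h
      simp only [Prod.mk.injEq] at h
      have := i.2; have := i'.2; have := k.2; have := k'.2
      simp only [Prod.mk.injEq, Fin.ext_iff]; omega
    · rintro ⟨⟨r, s⟩, t⟩
      refine ⟨((⟨((r - t) % 4).toNat, by omega⟩, ⟨((s + t - 1) % 4).toNat, by omega⟩),
        (((r - t) / 4, (s + t - 1) / 4), t + ((s + t - 1) / 4 - (r - t) / 4))), ?_⟩
      simp only [Prod.mk.injEq]; omega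
  rw [← hv.tsum_eq, tsum_eq_sum_tsum_of_bijective hv.summable _ hbij]
  refine Finset.sum_congr rfl fun i _ => ?_
  obtain ⟨⟨i, hi⟩, ⟨k, hk⟩⟩ := i
  refine HasSum.tsum_eq ?_
  have hK := hasSum_kron_signedPow h0 hq 0 0 (a := 48 * k + 30)
    (b := 48 * i + 42) (m := 192) (by omega) (by omega) (by omega) (by omega)
  refine hasSum_of_eq ((hasSum_mul_prod hK (hasSum_theta_signedPow h0 hq 1 (8 * (k - i) - 2)
    (m := 16) (P := q ^ 32) (by norm_num) (by norm_num))).mul_left (signedPow q (i + k + 1)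
      (i ^ 2 + 10 * i * k + k ^ 2 + 12 * i + 6 * k + 5))) (fun p => ?_) rfl
  obtain ⟨⟨r, l⟩, t⟩ := p
  simp only [heckeTriple]
  rw [mul_assoc (cone r l), signedPow_mul h0, mul_left_comm (signedPow q _ _) (cone _ _),
    signedPow_mul h0, cone_congr (k' := r) (l' := l) (by omega) (by omega)]
  congr 1
  exact signedPow_congr (2 * r + 2 * l - t) (by ring) (by push_cast; ring)

lemma signedPow_zero (q : ℂ) (a : ℕ) : signedPow q 0 a = q ^ a := by simp [signedPow]

lemma neg_signedPow (q : ℂ) (ε a : ℤ) : -signedPow q ε a = signedPow q (ε + 1) a := by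
  rw [signedPow, signedPow, zpow_add₀ (by norm_num)]; simp

lemma signedPow_div {q : ℂ} (h0 : q ≠ 0) (ε a ε' a' : ℤ) :
    signedPow q ε a / signedPow q ε' a' = signedPow q (ε - ε') (a - a') := by
  rw [div_eq_iff (signedPow_ne_zero h0 _ _), signedPow_mul h0, sub_add_cancel, sub_add_cancel]

lemma signedPow_pow (u : ℂ) (ε a : ℤ) (n : ℕ) :
    signedPow u ε a ^ n = signedPow u (ε * n) (a * n) := by
  rw [← signedPow_zpow, zpow_natCast]

/-- The remaining part of the triple sum is `j(-1;q^48) Φ_{1,4}(q³,q⁵,q²)`, term by term. -/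
lemma PhiHM_one_four {q : ℂ} (h0 : q ≠ 0) (hq : ‖q‖ < 1) :
    PhiHM 1 4 (q ^ 3) (q ^ 5) (q ^ 2) * jTheta (-1) (q ^ 48) =
      ∑ i : Fin 4 × Fin 4, signedPow q (i.1 + i.2 + 1)
        (i.1 ^ 2 + 10 * i.1 * i.2 + i.2 ^ 2 + 12 * i.1 + 6 * i.2 + 5) *
        (etaJ 192 q ^ 3 * jTheta (signedPow q (0 + 0) ((48 * i.2 + 30) + (48 * i.1 + 42)))
            (q ^ 192) / (jTheta (signedPow q 0 (48 * i.2 + 30)) (q ^ 192) *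
              jTheta (signedPow q 0 (48 * i.1 + 42)) (q ^ 192)) *
          jTheta (signedPow q 1 (8 * (i.2 - i.1) - 2)) (q ^ 32)) := by
  have hj := jTheta_neg_one_ne_zero (pow_ne_zero 48 h0) (norm_pow_lt_one hq (by norm_num))
  have e : (q ^ 2) ^ 24 = q ^ 48 := by rw [← pow_mul]
  have e1 : (q ^ 2) ^ 96 = q ^ 192 := by rw [← pow_mul]
  have e2 : (q ^ 2) ^ 16 = q ^ 32 := by rw [← pow_mul]
  have hsq : ∀ n : ℤ, (q ^ 2) ^ n = signedPow q 0 (2 * n) := fun n => by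
    rw [signedPow, zpow_mul, zpow_zero, one_mul]; norm_cast
  have p3 : q ^ 3 = signedPow q 0 3 := (signedPow_zero q 3).symm
  have p5 : q ^ 5 = signedPow q 0 5 := (signedPow_zero q 5).symm
  have eta : etaJ 96 (q ^ 2) = etaJ 192 q := etaJ_pow 96 2 q
  simp only [PhiHM]
  norm_num only
  rw [e, div_mul_eq_mul_div, div_mul_cancel₀ _ hj,
    Finset.sum_range, Finset.mul_sum, Fintype.sum_prod_type]
  refine Finset.sum_congr rfl fun x _ => ?_
  rw [Finset.sum_range, Finset.mul_sum]
  refine Finset.sum_congr rfl fun y _ => ?_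
  have hE : ∀ z : ℤ, 4 * (6 * (2 * z + 0) + 5) / 2 = 24 * z + 10 := fun z => by omega
  have hA : -(q ^ 2) ^ (4 * ((y : ℤ) - x)) * (q ^ 3) ^ 1 / (q ^ 5) ^ 1 =
      signedPow q 1 (8 * (y - x) - 2) := by
    rw [hsq, p3, p5, neg_signedPow, signedPow_pow, signedPow_pow, signedPow_mul h0,
      signedPow_div h0]
    exact signedPow_congr 0 (by simp) (by push_cast; ring)
  have hB : (q ^ 2) ^ (24 * ((x : ℤ) + y + 0) + 20) * (q ^ 3) ^ 4 * (q ^ 5) ^ 4 =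
      signedPow q 0 ((48 * y + 30) + (48 * x + 42)) := by
    rw [hsq, p3, p5, signedPow_pow, signedPow_pow, signedPow_mul h0, signedPow_mul h0]
    exact signedPow_congr 0 (by simp) (by push_cast; ring)
  have hC : (q ^ 2) ^ (24 * (x : ℤ) + 10) * (-q ^ 5) ^ 5 / (-q ^ 3) ^ 1 =
      signedPow q 0 (48 * x + 42) := by
    rw [hsq, p3, p5, neg_signedPow, neg_signedPow, signedPow_pow, signedPow_pow, signedPow_mul h0,
      signedPow_div h0]
    exact signedPow_congr 2 (by norm_num) (by push_cast; ring)
  have hD : (q ^ 2) ^ (24 * (y : ℤ) + 10) * (-q ^ 3) ^ 5 / (-q ^ 5) ^ 1 =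
      signedPow q 0 (48 * y + 30) := by
    rw [hsq, p3, p5, neg_signedPow, neg_signedPow, signedPow_pow, signedPow_pow, signedPow_mul h0,
      signedPow_div h0]
    exact signedPow_congr 2 (by norm_num) (by push_cast; ring)
  have hF : (q ^ 2) ^ (1 * binom2 ((x : ℤ) - 0) + 5 * ((x : ℤ) - 0) * ((y : ℤ) + 0 + 1) +
      1 * binom2 ((y : ℤ) + 0 + 1)) * (-q ^ 3) ^ ((x : ℤ) - 0) * (-q ^ 5) ^ ((y : ℤ) + 0 + 1) =
      signedPow q (x + y + 1) (x ^ 2 + 10 * x * y + y ^ 2 + 12 * x + 6 * y + 5) := by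
    rw [hsq, p3, p5, neg_signedPow, neg_signedPow, signedPow_zpow, signedPow_zpow,
      signedPow_mul h0, signedPow_mul h0]
    refine signedPow_congr 0 (by ring) ?_
    have h1 := two_mul_binom2 ((x : ℤ) - 0)
    have h2 := two_mul_binom2 ((y : ℤ) + 0 + 1)
    linear_combination h1 + h2
  rw [hE, hE, hA, hB, hC, hD, hF, e1, e2, eta]
  ring

/-- The identity of triple sums for `f_{1,5,1}(q³,q⁵,q²)`, in closed form. -/
lemma heckeF_psi_eq {q : ℂ} (h0 : q ≠ 0) (hq : ‖q‖ < 1) :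
    q * (1 / thetaJ 1 2 q) * heckeF 1 5 1 (q ^ 3) (q ^ 5) (q ^ 2) =
      -appellM (-q ^ 18) (q ^ 48) (-1) + q ^ (-3 : ℤ) * appellM (-q ^ 6) (q ^ 48) (-1) +
        q * (1 / thetaJ 1 2 q) * PhiHM 1 4 (q ^ 3) (q ^ 5) (q ^ 2) := by
  have h := hasSum_heckeTriple_rest h0 hq (hasSum_cone_split 1 (hasSum_heckeTriple h0 hq)
    (hasSum_heckeTriple_left h0 hq).1 (hasSum_heckeTriple_right h0 hq).1)
  rw [← PhiHM_one_four h0 hq] at h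
  have hj := jTheta_neg_one_ne_zero (pow_ne_zero 48 h0) (norm_pow_lt_one hq (by norm_num))
  have ht := thetaJ_ne_zero h0 hq (show 1 ≠ 0 by norm_num) (show 1 < 2 by norm_num)
  have r0 : signedPow q 1 0 = -1 := by simp [signedPow]
  have r3 : jTheta (signedPow q 0 3) (q ^ 2) = -q⁻¹ * thetaJ 1 2 q := by
    rw [jTheta_signedPow_add h0 hq 0 1 (by norm_num) (by norm_num), ← jTheta_signedPow_zero]
    simp [signedPow]
  have r5 : jTheta (signedPow q 0 5) (q ^ 2) = (q ^ 4)⁻¹ * thetaJ 1 2 q := by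
    rw [jTheta_signedPow_add h0 hq 0 3 (by norm_num) (by norm_num), r3]
    simp only [signedPow, zero_add, zpow_neg, zpow_ofNat]
    field_simp
  rw [r0, r3, r5] at h
  rw [show q ^ (-3 : ℤ) = (q ^ 3)⁻¹ by rw [zpow_neg]; norm_cast]
  have hF : heckeF 1 5 1 (q ^ 3) (q ^ 5) (q ^ 2) = (q ^ 4)⁻¹ * thetaJ 1 2 q *
      appellM (-q ^ 6) (q ^ 48) (-1) - q⁻¹ * thetaJ 1 2 q * appellM (-q ^ 18) (q ^ 48) (-1) +
      PhiHM 1 4 (q ^ 3) (q ^ 5) (q ^ 2) := by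
    refine mul_right_cancel₀ hj ?_
    linear_combination h
  rw [hF]
  field_simp
  ring

/-! ### Expressions through building blocks -/

lemma hasSum_cone_V {s : ℂ} (h0 : s ≠ 0) (hs : ‖s‖ < 1) {q : ℂ} (hsq : s ^ 2 = q) :
    HasSum (fun p : ℤ × ℤ => cone (p.1 + p.2) (p.1 - p.2) * signedPow s p.1
      (8 * p.1 ^ 2 + (8 + 2 * 0) * p.1 + 2 * 0 - 4 * p.2 ^ 2 - 2 * p.2))
      (heckeF 1 3 1 (q ^ 5) (q ^ 7) (q ^ 4) - q ^ 8 * heckeF 1 3 1 (q ^ 13) (q ^ 15) (q ^ 4)) := by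
  subst hsq
  have hq0 : s ^ 2 ≠ 0 := pow_ne_zero _ h0
  have hq := norm_pow_lt_one hs two_ne_zero
  have h1 := (summable_norm_cone_sub hq0 hq (a := 4) (b := 4) (by norm_num) (by norm_num)
    (fun p => (-1) ^ p.1) (fun p => norm_neg_one_zpow _)).of_norm.hasSum
  rw [tsum_cone_V hq0 hq] at h1
  refine hasSum_of_eq h1 (fun p => ?_) rfl
  rw [← signedPow, signedPow_sq]
  congr 2
  ring

/-- The exponent `8n² + 10n + 2` instead of `8n² + 6n` comes from the substitution `n ↦ -1 - n`. -/
lemma hasSum_cone_T {s : ℂ} (h0 : s ≠ 0) (hs : ‖s‖ < 1) {q : ℂ} (hsq : s ^ 2 = q) :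
    HasSum (fun p : ℤ × ℤ => cone (p.1 + p.2) (p.1 - p.2) * signedPow s p.1
      (8 * p.1 ^ 2 + (8 + 2 * 1) * p.1 + 2 * 1 - 4 * p.2 ^ 2 - 2 * p.2))
      (heckeF 1 3 1 (q ^ 4) (q ^ 6) (q ^ 4) - q ^ 7 * heckeF 1 3 1 (q ^ 12) (q ^ 14) (q ^ 4)) := by
  subst hsq
  have hq0 : s ^ 2 ≠ 0 := pow_ne_zero _ h0
  have hq := norm_pow_lt_one hs two_ne_zero
  have h1 := (summable_norm_cone_sub hq0 hq (a := 4) (b := 3) (by norm_num) (by norm_num)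
    (fun p => (-1) ^ p.1) (fun p => norm_neg_one_zpow _)).of_norm.hasSum
  rw [tsum_cone_T hq0 hq] at h1
  refine hasSum_of_hasSum_comp (fun p : ℤ × ℤ => (-1 - p.1, p.2)) (fun p => (-1 - p.1, p.2))
    (fun p => by ext <;> dsimp; ring) (fun p => by ext <;> dsimp; ring) ?_
  refine hasSum_of_eq h1 (fun p => ?_) rfl
  dsimp only
  rw [← signedPow, signedPow_sq, show -1 - p.1 + p.2 = -1 - (p.1 - p.2) by ring,
    show -1 - p.1 - p.2 = -1 - (p.1 + p.2) by ring, cone_neg_sub, neg_mul, ← mul_neg,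
    neg_signedPow]
  congr 1
  exact signedPow_congr (-p.1) (by ring) (by ring)

/-- The prefactor of `T_1^{(8)}(-q)` as an eta quotient. -/
lemma etaJ_quotient_T {q : ℂ} (hq : ‖q‖ < 1) :
    qPochInf (-q ^ 2) (q ^ 2) / qPochInf (q ^ 2) (q ^ 2) = etaJ 4 q / etaJ 2 q ^ 2 := by
  have h := qPochInf_neg_mul (norm_pow_lt_one hq two_ne_zero)
  rw [etaJ_pow, etaJ_pow] at h
  have h2 := etaJ_ne_zero hq two_ne_zero
  change qPochInf (-q ^ 2) (q ^ 2) / etaJ 2 q = _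
  rw [show etaJ 4 q = _ from h.symm]
  field_simp

/-- The prefactor of `ψ_-^{(6)}` as an eta quotient. -/
lemma etaJ_quotient_psi {q : ℂ} (hq : ‖q‖ < 1) :
    qPochInf (-q) q / qPochInf q q = etaJ 2 q / etaJ 1 q ^ 2 := by
  have h2 := etaJ_ne_zero hq one_ne_zero
  rw [← qPochInf_neg_mul hq, show qPochInf q q = etaJ 1 q by rw [etaJ, pow_one]]
  field_simp

/-- The prefactor of `V_1^{(8)}` as an eta quotient. -/
lemma etaJ_quotient_V {q : ℂ} (hq : ‖q‖ < 1) :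
    qPochInf (-q) (q ^ 2) / qPochInf (q ^ 2) (q ^ 2) = etaJ 2 q / (etaJ 1 q * etaJ 4 q) := by
  have h1 := etaJ_ne_zero hq one_ne_zero
  have h2 := etaJ_ne_zero hq two_ne_zero
  have h4 := etaJ_ne_zero hq four_ne_zero
  have h := qPochInf_neg_odd_mul hq
  change qPochInf (-q) (q ^ 2) / etaJ 2 q = _
  field_simp
  linear_combination h

lemma psiMinus_expressions {q : ℂ} (hq : ‖q‖ < 1) (h0 : q ≠ 0) :
      (Summable (heckeTerm 1 5 1 (q ^ 3) (q ^ 5) (q ^ 2)) ∧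
        Summable (heckeTerm 1 5 1 (q ^ 9) (q ^ 11) (q ^ 2)) ∧
        Summable (appellTerm (-q ^ 18) (q ^ 48) (-1)) ∧
        Summable (appellTerm (-q ^ 6) (q ^ 48) (-1)) ∧
        Summable (appellTerm (-q ^ 3) (q ^ 12) q) ∧
        psiMinus q =
          1 / 2 * q * (etaJ 2 q / etaJ 1 q ^ 2) *
            (heckeF 1 5 1 (q ^ 3) (q ^ 5) (q ^ 2)
              - q ^ 6 * heckeF 1 5 1 (q ^ 9) (q ^ 11) (q ^ 2)) ∧
        psiMinus q =
          q * (etaJ 2 q / etaJ 1 q ^ 2) * heckeF 1 5 1 (q ^ 3) (q ^ 5) (q ^ 2) ∧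
        psiMinus q =
          -appellM (-q ^ 18) (q ^ 48) (-1)
            + q ^ (-3 : ℤ) * appellM (-q ^ 6) (q ^ 48) (-1)
            + q * (etaJ 2 q / etaJ 1 q ^ 2) * PhiHM 1 4 (q ^ 3) (q ^ 5) (q ^ 2) ∧
        psiMinus q =
          -appellM (-q ^ 3) (q ^ 12) q
            + q ^ 2 * (etaJ 2 q ^ 2 * etaJ 12 q * etaJ 24 q * thetaJ 4 24 q ^ 2 /
              (etaJ 1 q ^ 2 * thetaJ 1 24 q * thetaJ 10 24 q * thetaJ 11 24 q))) := by
  have hs := fun x y : ℕ =>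
    (summable_heckeTerm_pow h0 hq (m := 1) (b := 5) le_rfl (by norm_num) x y).of_norm
  obtain ⟨-, S, hS, hpsi⟩ := psiMinus_hecke hq
  rw [hS.unique (hasSum_psi_of_cone h0 hq), etaJ_quotient_psi hq] at hpsi
  change psiMinus q = _ at hpsi
  have hr := heckeF_reflect h0 (q := q) (x := 3) (y := 5) (x' := 9) (y' := 11) (c := 6) (m := 1)
    (b := 5) (by norm_num) (by norm_num) (by norm_num)
  rw [show 2 * 1 = 2 from rfl] at hr
  have hθ : etaJ 2 q / etaJ 1 q ^ 2 = 1 / thetaJ 1 2 q := by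
    have h1 := etaJ_ne_zero hq one_ne_zero
    have ht := thetaJ_ne_zero h0 hq (show 1 ≠ 0 by norm_num) (show 1 < 2 by norm_num)
    have := thetaJ_two_mul h0 hq (show 1 ≠ 0 by norm_num) (show 2 = 2 * 1 by norm_num)
    field_simp
    linear_combination this
  have h2 : psiMinus q =
      q * (etaJ 2 q / etaJ 1 q ^ 2) * heckeF 1 5 1 (q ^ 3) (q ^ 5) (q ^ 2) := by
    rw [hpsi]; linear_combination -1 / 2 * q * (etaJ 2 q / etaJ 1 q ^ 2) * hr
  refine ⟨hs 3 5, hs 9 11, (hasSum_heckeTriple_right h0 hq).2, (hasSum_heckeTriple_left h0 hq).2,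
    (hasSum_psiTriple_right h0 hq).2, by rw [hpsi]; ring, h2, ?_, ?_⟩
  · rw [h2, hθ, heckeF_psi_eq h0 hq]
  · rw [← psi_theta_quotient h0 hq, ← psi_double_sum_eq h0 hq, hpsi, hθ]; ring

lemma V1_expressions {q : ℂ} (hq : ‖q‖ < 1) (h0 : q ≠ 0) :
      (Summable (heckeTerm 1 3 1 (q ^ 5) (q ^ 7) (q ^ 4)) ∧
        Summable (heckeTerm 1 3 1 (q ^ 13) (q ^ 15) (q ^ 4)) ∧
        V1 q =
          1 / 2 * q * (etaJ 2 q / (etaJ 1 q * etaJ 4 q)) *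
            (heckeF 1 3 1 (q ^ 5) (q ^ 7) (q ^ 4)
              - q ^ 8 * heckeF 1 3 1 (q ^ 13) (q ^ 15) (q ^ 4)) ∧
        V1 q =
          q * (etaJ 2 q / (etaJ 1 q * etaJ 4 q)) *
            heckeF 1 3 1 (q ^ 5) (q ^ 7) (q ^ 4) ∧
        ∀ s : ℂ, s ^ 2 = q →
          Summable (appellTerm (q ^ 2) (q ^ 8) s⁻¹) ∧
          V1 q =
            -appellM (q ^ 2) (q ^ 8) s⁻¹
              + jTheta (s ^ 5) (q ^ 8) * etaJ 8 q ^ 3 /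
                (jTheta s (q ^ 8) * thetaJ 1 8 q * thetaJ 3 8 q)) := by
  have hs := fun x y : ℕ =>
    (summable_heckeTerm_pow h0 hq (m := 2) (b := 3) (by norm_num) (by norm_num) x y).of_norm
  obtain ⟨-, S, hS, hV⟩ := V1_hecke hq
  rw [hS.unique (hasSum_V_of_cone h0 hq), etaJ_quotient_V hq] at hV
  change V1 q = _ at hV
  have hr := heckeF_reflect h0 (q := q) (x := 5) (y := 7) (x' := 13) (y' := 15) (c := 8) (m := 2)
    (b := 3) (by norm_num) (by norm_num) (by norm_num)
  rw [show 2 * 2 = 4 from rfl] at hr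
  have hθ : etaJ 2 q / (etaJ 1 q * etaJ 4 q) = 1 / thetaJ 1 4 q := by
    have h1 := etaJ_ne_zero hq one_ne_zero
    have h4 := etaJ_ne_zero hq four_ne_zero
    have ht := thetaJ_ne_zero h0 hq (show 1 ≠ 0 by norm_num) (show 1 < 4 by norm_num)
    have := thetaJ_four_mul h0 hq (show 1 ≠ 0 by norm_num) (show 4 = 4 * 1 by norm_num)
      (show 2 = 2 * 1 by norm_num)
    field_simp
    linear_combination this
  refine ⟨hs 5 7, hs 13 15, by rw [hV]; ring, ?_, fun s hsq => ?_⟩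
  · rw [hV]; linear_combination -1 / 2 * q * (etaJ 2 q / (etaJ 1 q * etaJ 4 q)) * hr
  · have hs0 : s ≠ 0 := by rintro rfl; exact h0 (by rw [← hsq]; norm_num)
    have hs1 : ‖s‖ < 1 := by
      rw [← hsq, norm_pow] at hq
      exact (pow_lt_one_iff_of_nonneg (norm_nonneg s) two_ne_zero).1 hq
    have e1 : q ^ 2 = s ^ 4 := by rw [← hsq, ← pow_mul]
    have e2 : q ^ 8 = s ^ 16 := by rw [← hsq, ← pow_mul]
    have e3 : thetaJ 1 4 q = thetaJ 2 8 s := by rw [← hsq, thetaJ_pow]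
    have e4 : thetaJ 1 8 q = thetaJ 2 16 s := by rw [← hsq, thetaJ_pow]
    have e5 : thetaJ 3 8 q = thetaJ 6 16 s := by rw [← hsq, thetaJ_pow]
    have e6 : etaJ 8 q = etaJ 16 s := by rw [← hsq, etaJ_pow]
    have e7 : jTheta s (s ^ 16) = thetaJ 1 16 s := by rw [thetaJ, pow_one]
    rw [e1, e2, e4, e5, e6, e7]
    refine ⟨(hasSum_eighthTriple_right hs0 hs1 le_rfl zero_le_one (signedPow_zero s 4).symm).2, ?_⟩
    change _ = _ + thetaJ 5 16 s * _ / _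
    rw [← V_double_sum_eq hs0 hs1 (hasSum_cone_V hs0 hs1 hsq), hV, hθ, e3, hsq]
    ring

lemma T1Neg_expressions {q : ℂ} (hq : ‖q‖ < 1) (h0 : q ≠ 0) :
      (Summable (heckeTerm 1 3 1 (q ^ 4) (q ^ 6) (q ^ 4)) ∧
        Summable (heckeTerm 1 3 1 (q ^ 12) (q ^ 14) (q ^ 4)) ∧
        ∑' n : ℕ, T1NegTerm q n =
          etaJ 4 q / etaJ 2 q ^ 2 *
            (heckeF 1 3 1 (q ^ 4) (q ^ 6) (q ^ 4)
              - q ^ 7 * heckeF 1 3 1 (q ^ 12) (q ^ 14) (q ^ 4)) ∧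
        ∀ s : ℂ, s ^ 2 = q →
          Summable (appellTerm q (q ^ 8) s⁻¹) ∧
          ∑' n : ℕ, T1NegTerm q n =
            -q⁻¹ * appellM q (q ^ 8) s⁻¹
              + q⁻¹ * (jTheta (s ^ 3) (q ^ 8) ^ 2 * etaJ 8 q ^ 3 /
                (jTheta s (q ^ 8) ^ 2 * thetaJ 1 8 q * thetaJ 2 8 q))) := by
  have hs := fun x y : ℕ =>
    (summable_heckeTerm_pow h0 hq (m := 2) (b := 3) (by norm_num) (by norm_num) x y).of_norm
  obtain ⟨-, S, hS, hT⟩ := T1Neg_hecke hq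
  rw [hS.unique (hasSum_T_of_cone h0 hq), etaJ_quotient_T hq] at hT
  have hθ : etaJ 4 q / etaJ 2 q ^ 2 = 1 / thetaJ 2 4 q := by
    have h2 := etaJ_ne_zero hq two_ne_zero
    have ht := thetaJ_ne_zero h0 hq (show 2 ≠ 0 by norm_num) (show 2 < 4 by norm_num)
    have := thetaJ_two_mul h0 hq (show 2 ≠ 0 by norm_num) (show 4 = 2 * 2 by norm_num)
    field_simp
    linear_combination this
  refine ⟨hs 4 6, hs 12 14, hT, fun s hsq => ?_⟩
  have hs0 : s ≠ 0 := by rintro rfl; exact h0 (by rw [← hsq]; norm_num)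
  have hs1 : ‖s‖ < 1 := by
    rw [← hsq, norm_pow] at hq
    exact (pow_lt_one_iff_of_nonneg (norm_nonneg s) two_ne_zero).1 hq
  have e2 : q ^ 8 = s ^ 16 := by rw [← hsq, ← pow_mul]
  have e3 : thetaJ 2 4 q = thetaJ 4 8 s := by rw [← hsq, thetaJ_pow]
  have e4 : thetaJ 1 8 q = thetaJ 2 16 s := by rw [← hsq, thetaJ_pow]
  have e5 : thetaJ 2 8 q = thetaJ 4 16 s := by rw [← hsq, thetaJ_pow]
  have e6 : etaJ 8 q = etaJ 16 s := by rw [← hsq, etaJ_pow]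
  have e7 : jTheta s (s ^ 16) = thetaJ 1 16 s := by rw [thetaJ, pow_one]
  rw [e2, e4, e5, e6, e7, ← hsq]
  refine ⟨(hasSum_eighthTriple_right hs0 hs1 zero_le_one le_rfl (signedPow_zero s 2).symm).2, ?_⟩
  change _ = _ + _ * (thetaJ 3 16 s ^ 2 * _ / _)
  rw [← T_double_sum_eq hs0 hs1 (hasSum_cone_T hs0 hs1 hsq), hsq, hT, hθ, e3]
  ring

end MockHecke

end

theorem mainTheorem3 (q : ℂ) (hq : ‖q‖ < 1) :
    -- the Eulerian series converge
    (Summable (F1Term q) ∧ Summable (altTerm q) ∧ Summable (T1NegTerm q) ∧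
      Summable (T1Term q) ∧ Summable (psiMinusTerm q) ∧ Summable (V1Term q)) ∧
    -- Hecke-type series of `F_1^{(5)}`
    (∃ S : ℂ,
      HasSum (fun n : ℕ => ∑ j ∈ Finset.Icc (0 : ℤ) (2 * n),
        (-1 : ℂ) ^ n * q ^ (5 * (n : ℤ) ^ 2 + 4 * n - binom2 (j + 1)) * (1 + q ^ (2 * n + 1))) S ∧
      F1 q = 1 / qPochInf (q ^ 2) (q ^ 2) * S) ∧
    -- the new Hecke-type identity
    HasSum (fun n : ℕ => ∑ j ∈ Finset.Icc (-(n : ℤ)) n,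
        (1 + q ^ (2 * n + 1)) * q ^ (4 * (n : ℤ) ^ 2 + 3 * n - 2 * j ^ 2 - j))
      (∑' n : ℕ, altTerm q n) ∧
    -- Hecke-type series of `T_1^{(8)}(-q)` and of `T_1^{(8)}(q)`
    (∃ S : ℂ,
      HasSum (fun n : ℕ => (1 + q ^ (2 * n + 1)) * (-1) ^ n *
        ∑ j ∈ Finset.Icc (-(n : ℤ)) n, q ^ (4 * (n : ℤ) ^ 2 + 3 * n - 2 * j ^ 2 - j)) S ∧
      ∑' n : ℕ, T1NegTerm q n =
        qPochInf (-q ^ 2) (q ^ 2) / qPochInf (q ^ 2) (q ^ 2) * S) ∧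
    T1 (-q) = ∑' n : ℕ, T1NegTerm q n ∧
    (∃ S : ℂ,
      HasSum (fun n : ℕ => (1 - q ^ (2 * n + 1)) *
        ∑ j ∈ Finset.Icc (-(n : ℤ)) n,
          (-1) ^ j * q ^ (4 * (n : ℤ) ^ 2 + 3 * n - 2 * j ^ 2 - j)) S ∧
      T1 q = qPochInf (-q ^ 2) (q ^ 2) / qPochInf (q ^ 2) (q ^ 2) * S) ∧
    -- Hecke-type series of `ψ_-^{(6)}`
    (∃ S : ℂ,
      HasSum (fun n : ℕ => (-1) ^ n *
        ∑ j ∈ Finset.Icc (-(n : ℤ)) n, q ^ (3 * (n : ℤ) ^ 2 + 3 * n - 2 * j ^ 2 - j)) S ∧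
      psiMinus q = q * (qPochInf (-q) q / qPochInf q q) * S) ∧
    -- Hecke-type series of `V_1^{(8)}`
    (∃ S : ℂ,
      HasSum (fun n : ℕ => (-1) ^ n *
        ∑ j ∈ Finset.Icc (-(n : ℤ)) n, q ^ (4 * (n : ℤ) ^ 2 + 4 * n - 2 * j ^ 2 - j)) S ∧
      V1 q = q * (qPochInf (-q) (q ^ 2) / qPochInf (q ^ 2) (q ^ 2)) * S) ∧
    -- expressions through the building blocks
    (q ≠ 0 →
      -- `∑ (-1)^n (q²;q²)_n q^{n(n+1)} / (q;q²)_{n+1}`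
      (Summable (heckeBarTerm 1 3 1 (-q ^ 4) (-q ^ 6) (q ^ 4)) ∧
        Summable (heckeBarTerm 1 3 1 (-q ^ 12) (-q ^ 14) (q ^ 4)) ∧
        ∑' n : ℕ, altTerm q n =
          heckeFbar 1 3 1 (-q ^ 4) (-q ^ 6) (q ^ 4)
            + q ^ 7 * heckeFbar 1 3 1 (-q ^ 12) (-q ^ 14) (q ^ 4)) ∧
      -- `T_1^{(8)}(-q)`; here `s` is any square root of `q`
      (Summable (heckeTerm 1 3 1 (q ^ 4) (q ^ 6) (q ^ 4)) ∧
        Summable (heckeTerm 1 3 1 (q ^ 12) (q ^ 14) (q ^ 4)) ∧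
        ∑' n : ℕ, T1NegTerm q n =
          etaJ 4 q / etaJ 2 q ^ 2 *
            (heckeF 1 3 1 (q ^ 4) (q ^ 6) (q ^ 4)
              - q ^ 7 * heckeF 1 3 1 (q ^ 12) (q ^ 14) (q ^ 4)) ∧
        ∀ s : ℂ, s ^ 2 = q →
          Summable (appellTerm q (q ^ 8) s⁻¹) ∧
          ∑' n : ℕ, T1NegTerm q n =
            -q⁻¹ * appellM q (q ^ 8) s⁻¹
              + q⁻¹ * (jTheta (s ^ 3) (q ^ 8) ^ 2 * etaJ 8 q ^ 3 /
                (jTheta s (q ^ 8) ^ 2 * thetaJ 1 8 q * thetaJ 2 8 q))) ∧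
      -- `ψ_-^{(6)}(q)`
      (Summable (heckeTerm 1 5 1 (q ^ 3) (q ^ 5) (q ^ 2)) ∧
        Summable (heckeTerm 1 5 1 (q ^ 9) (q ^ 11) (q ^ 2)) ∧
        Summable (appellTerm (-q ^ 18) (q ^ 48) (-1)) ∧
        Summable (appellTerm (-q ^ 6) (q ^ 48) (-1)) ∧
        Summable (appellTerm (-q ^ 3) (q ^ 12) q) ∧
        psiMinus q =
          1 / 2 * q * (etaJ 2 q / etaJ 1 q ^ 2) *
            (heckeF 1 5 1 (q ^ 3) (q ^ 5) (q ^ 2)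
              - q ^ 6 * heckeF 1 5 1 (q ^ 9) (q ^ 11) (q ^ 2)) ∧
        psiMinus q =
          q * (etaJ 2 q / etaJ 1 q ^ 2) * heckeF 1 5 1 (q ^ 3) (q ^ 5) (q ^ 2) ∧
        psiMinus q =
          -appellM (-q ^ 18) (q ^ 48) (-1)
            + q ^ (-3 : ℤ) * appellM (-q ^ 6) (q ^ 48) (-1)
            + q * (etaJ 2 q / etaJ 1 q ^ 2) * PhiHM 1 4 (q ^ 3) (q ^ 5) (q ^ 2) ∧
        psiMinus q =
          -appellM (-q ^ 3) (q ^ 12) q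
            + q ^ 2 * (etaJ 2 q ^ 2 * etaJ 12 q * etaJ 24 q * thetaJ 4 24 q ^ 2 /
              (etaJ 1 q ^ 2 * thetaJ 1 24 q * thetaJ 10 24 q * thetaJ 11 24 q))) ∧
      -- `V_1^{(8)}(q)`; here `s` is any square root of `q`
      (Summable (heckeTerm 1 3 1 (q ^ 5) (q ^ 7) (q ^ 4)) ∧
        Summable (heckeTerm 1 3 1 (q ^ 13) (q ^ 15) (q ^ 4)) ∧
        V1 q =
          1 / 2 * q * (etaJ 2 q / (etaJ 1 q * etaJ 4 q)) *
            (heckeF 1 3 1 (q ^ 5) (q ^ 7) (q ^ 4)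
              - q ^ 8 * heckeF 1 3 1 (q ^ 13) (q ^ 15) (q ^ 4)) ∧
        V1 q =
          q * (etaJ 2 q / (etaJ 1 q * etaJ 4 q)) *
            heckeF 1 3 1 (q ^ 5) (q ^ 7) (q ^ 4) ∧
        ∀ s : ℂ, s ^ 2 = q →
          Summable (appellTerm (q ^ 2) (q ^ 8) s⁻¹) ∧
          V1 q =
            -appellM (q ^ 2) (q ^ 8) s⁻¹
              + jTheta (s ^ 5) (q ^ 8) * etaJ 8 q ^ 3 /
                (jTheta s (q ^ 8) * thetaJ 1 8 q * thetaJ 3 8 q))) := by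
  refine ⟨⟨(F1_hecke hq).1, (alt_hecke hq).1, (T1Neg_hecke hq).1, (T1_hecke hq).1,
    (psiMinus_hecke hq).1, (V1_hecke hq).1⟩, (F1_hecke hq).2, (alt_hecke hq).2, (T1Neg_hecke hq).2,
    ?_, (T1_hecke hq).2, (psiMinus_hecke hq).2, (V1_hecke hq).2, fun h0 => ⟨⟨?_, ?_, ?_⟩,
    T1Neg_expressions hq h0, psiMinus_expressions hq h0, V1_expressions hq h0⟩⟩
  · rw [T1]
    refine tsum_congr fun n => ?_
    rw [← T1NegTerm_neg, neg_neg]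
  · exact (summable_heckeBarTerm_pow h0 hq (m := 2) (b := 3) (by norm_num) (by norm_num) 4
      6).of_norm
  · exact (summable_heckeBarTerm_pow h0 hq (m := 2) (b := 3) (by norm_num) (by norm_num) 12
      14).of_norm
  · exact (alt_hecke hq).2.unique (hasSum_alt_of_cone h0 hq)
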